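/- Let $N\in\mathbb N\cup\{\infty\}$ and let $A,B$ be row-finite $N\times N$ integer matrices such that $A_{i,j}\ge 0$ for all $i,j$, $A$ has no zero row, and $B_{i,j}=0$ whenever $A_{i,j}=0$; if $N=\infty$, assume also that $A$ has no zero column. **The groupoid.** Let $E$ be the graph with vertices $1,\dots,N$ and edges $e_{i,j,n}$, $0\le n<A_{i,j}$, from $i=s(e_{i,j,n})$ to $j=r(e_{i,j,n})$; let $E^n$ be the set of its paths of length $n$, and $E^\infty$ its infinite path space, a subspace of the product of copies of the discrete set $E^1$. For a finite path $\alpha$ of length $|\alpha|$ with range $r(\alpha)$ put $Z(\alpha)=\{\alpha y\in E^\infty\}$. For $m\in\mathbb Z$ write $mB_{i,j}+n=kA_{i,j}+l$ with $0\le l<A_{i,j}$ and put $\kappa_m(e_{i,j,n})=e_{i,j,l}$, $\varphi(m,e_{i,j,n})=k$; extend to paths by $\kappa_m(e\alpha)=\kappa_m(e)\kappa_{\varphi(m,e)}(\alpha)$, $\varphi(m,e\alpha)=\varphi(\varphi(m,e),\alpha)$. Assume that $(A,B)$ is pseudo free: $\kappa_m(e)=e$ and $\varphi(m,e)=0$ for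 an edge $e$ imply $m=0$. The Katsura–Exel–Pardo groupoid $\mathcal G_{A,B}$ consists of the classes $[\alpha,m,\beta;x]$, where $\alpha,\beta$ are finite paths with $r(\alpha)=r(\beta)$, $m\in\mathbb Z$, $x\in Z(\beta)$, for the equivalence relation generated by $(\alpha,m,\beta;x)\sim(\alpha\kappa_m(\gamma),\varphi(m,\gamma),\beta\gamma;x)$ for $x=\beta\gamma y$, $\gamma$ an edge. Its unit space is $E^\infty$, with $s([\alpha,m,\beta;\beta y])=\beta y$, $r([\alpha,m,\beta;\beta y])=\alpha\kappa_m(y)$; its product is $[\alpha,m',\beta;\beta\kappa_m(y)][\beta,m,\gamma;\gamma y]=[\alpha,m'+m,\gamma;\gamma y]$; its topology is generated by the sets $Z(\alpha,m,\beta;Z(\beta))=\{[\alpha,m,\beta;x]:x\in Z(\beta)\}$. It is a Hausdorff étale groupoid. Let $\rho:\mathcal G_{A,B}\to\mathbb Z$, $\rho([\alpha,m,\beta;x])=|\alpha|-|\beta|$, and $\mathcal H_{A,B}=\ker\rho$. **Homology.** For a Hausdorff étale groupoid $\mathcal G$, $H_0(\mathcal G)=\operatorname{coker}\delta_1$ and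 $H_1(\mathcal G)=\ker\delta_1/\operatorname{im}\delta_2$, where $\delta_1=s_*-r_*:C_c(\mathcal G,\mathbb Z)\to C_c(\mathcal G^{(0)},\mathbb Z)$ and $\delta_2=(d_0)_*-(d_1)_*+(d_2)_*:C_c(\mathcal G^{(2)},\mathbb Z)\to C_c(\mathcal G,\mathbb Z)$ with $d_0(g,h)=h$, $d_1(g,h)=gh$, $d_2(g,h)=g$ and $\pi_*f(y)=\sum_{\pi(x)=y}f(x)$. The skew product $\mathcal G_{A,B}\times_\rho\mathbb Z$ has the product $(g,k)(h,k+\rho(g))=(gh,k)$, and $\hat\rho^1$ denotes the maps induced on its homology by $(g,k)\mapsto(g,k+1)$. **Inductive limits.** For a row-finite integer matrix $M$, $\mathbb Z_M$ is the inductive limit of the sequence $\mathbb Z^{(N)}\to\mathbb Z^{(N)}\to\cdots$, indexed by $i=0,1,2,\dots$, where $\mathbb Z^{(N)}$ is the free abelian group with basis $(\mathbf 1_v)_v$ indexed by the vertices and every map is $\mathbf 1_v\mapsto\sum_w M_{v,w}\mathbf 1_w$; $\varphi^M_{i,\infty}:\mathbb Z^{(N)}\to\mathbb Z_M$ are the canonical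 maps. **Claim.** (0) For $j=0,1$ the embedding $\mathcal H_{A,B}\to\mathcal G_{A,B}\times_\rho\mathbb Z$, $g\mapsto(g,0)$, induces an isomorphism $H_j(\mathcal H_{A,B})\to H_j(\mathcal G_{A,B}\times_\rho\mathbb Z)$. Let $\Psi$ be its inverse and $\tilde\rho^1=\Psi\circ\hat\rho^1\circ\Psi^{-1}$ on $H_j(\mathcal H_{A,B})$. (1) There is an isomorphism $\Phi_A:H_0(\mathcal H_{A,B})\to\mathbb Z_A$ with $\Phi_A([\mathbf 1_{Z(\alpha)}])=\varphi^A_{n,\infty}(\mathbf 1_{r(\alpha)})$ for all $n\ge 0$ and $\alpha\in E^n$; and for every such $\Phi_A$ one has $\Phi_A\circ\tilde\rho^1\circ\Phi_A^{-1}(\varphi^A_{i,\infty}(x))=\varphi^A_{i+1,\infty}(x)$ for all $i\ge 0$ and $x\in\mathbb Z^{(N)}$. (2) There is an isomorphism $\Phi_B:H_1(\mathcal H_{A,B})\to\mathbb Z_B$ with $\Phi_B([\mathbf 1_{Z(\alpha,1,\alpha;Z(\alpha))}])=\varphi^B_{n,\infty}(\mathbf 1_{r(\alpha)})$ for all $n\ge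 0$ and $\alpha\in E^n$; and for every such $\Phi_B$ one has $\Phi_B\circ\tilde\rho^1\circ\Phi_B^{-1}(\varphi^B_{i,\infty}(x))=\varphi^B_{i+1,\infty}(x)$ for all $i\ge 0$ and $x\in\mathbb Z^{(N)}$. -/

import Mathlib

open Set Topology
open scoped CompactlySupported

noncomputable section

namespace KEP

section Pushforward

variable {X Y Z : Type*} [TopologicalSpace X] [TopologicalSpace Y] [TopologicalSpace Z]

/-- The sum of `f` along the fibres of `π`, `y ↦ ∑_{π x = y} f x`. -/
def fibreSum (π : X → Y) (f : X → ℤ) (y : Y) : ℤ := ∑ᶠ x ∈ π ⁻¹' {y}, f x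

theorem fibre_finite [T2Space Y] {π : X → Y} (hπ : IsLocalHomeomorph π) (f : C_c(X, ℤ)) (y : Y) :
    (π ⁻¹' {y} ∩ tsupport f).Finite := by
  refine IsCompact.finite ?_ ?_
  · exact f.hasCompactSupport.isCompact.inter_left (isClosed_singleton.preimage hπ.continuous)
  · refine (IsLocalHomeomorphOn.isDiscrete_of_image (f := π)
      (fun x _ => hπ x) (Set.Finite.isDiscrete ?_))
    refine (Set.finite_singleton y).subset ?_
    rintro _ ⟨x, hx, rfl⟩
    exact hx.1

theorem fibre_finite' [T2Space Y] {π : X → Y} (hπ : IsLocalHomeomorph π) (f : C_c(X, ℤ)) (y : Y) :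
    (π ⁻¹' {y} ∩ Function.support f).Finite :=
  (fibre_finite hπ f y).subset (inter_subset_inter_right _ (subset_tsupport _))

theorem fibreSum_continuous [T2Space X] [T2Space Y] {π : X → Y} (hπ : IsLocalHomeomorph π)
    (f : C_c(X, ℤ)) : Continuous (fibreSum π f) := by
  rw [← IsLocallyConstant.iff_continuous, IsLocallyConstant.iff_eventually_eq]
  intro y₀
  have hF := fibre_finite hπ f y₀
  obtain ⟨U, hU, hUd⟩ := hF.t2_separation
  have hV : ∀ x : X, ∃ V : Set X, IsOpen V ∧ x ∈ V ∧ V ⊆ U x ∧ V.InjOn π ∧ ∀ z ∈ V, f z = f x := by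
    intro x
    obtain ⟨e, hxe, rfl⟩ := hπ x
    refine ⟨U x ∩ e.source ∩ f ⁻¹' {f x}, ((hU x).2.inter e.open_source).inter
      ((isOpen_discrete _).preimage f.continuous), ⟨⟨(hU x).1, hxe⟩, rfl⟩,
      fun z hz => hz.1.1, e.injOn.mono (fun z hz => hz.1.2), fun z hz => hz.2⟩
  choose V hVo hxV hVU hVi hVf using hV
  set F := π ⁻¹' {y₀} ∩ tsupport f with hFdef
  have hKc : IsCompact (tsupport f \ ⋃ x ∈ F, V x) :=
    f.hasCompactSupport.isCompact.diff (isOpen_biUnion fun x _ => hVo x)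
  have hcl : IsClosed (π '' (tsupport f \ ⋃ x ∈ F, V x)) := (hKc.image hπ.continuous).isClosed
  have hy₀ : y₀ ∉ π '' (tsupport f \ ⋃ x ∈ F, V x) := by
    rintro ⟨x, ⟨hx1, hx2⟩, hx3⟩
    exact hx2 (mem_biUnion (show x ∈ F from ⟨hx3, hx1⟩) (hxV x))
  have hW : ∀ᶠ y in 𝓝 y₀, ∀ x ∈ F, y ∈ π '' V x := by
    rw [Filter.eventually_all_finite hF]
    intro x hx
    refine (hπ.isOpenMap _ (hVo x)).mem_nhds ⟨x, hxV x, hx.1⟩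
  filter_upwards [hW, hcl.isOpen_compl.mem_nhds hy₀] with y hy1 hy2
  have ht : ∀ x : X, ∃ z, x ∈ F → z ∈ V x ∧ π z = y := by
    intro x
    by_cases hx : x ∈ F
    · obtain ⟨z, hz, hz'⟩ := hy1 x hx
      exact ⟨z, fun _ => ⟨hz, hz'⟩⟩
    · exact ⟨x, fun h => absurd h hx⟩
  choose t ht using ht
  have h1 : fibreSum π f y₀ = ∑ᶠ x ∈ F, f x := by
    refine finsum_mem_inter_support_eq' _ _ _ ?_
    intro x hx
    exact ⟨fun h => ⟨h, subset_tsupport _ hx⟩, fun h => h.1⟩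
  have h2 : fibreSum π f y = ∑ᶠ x ∈ π ⁻¹' {y} ∩ ⋃ x ∈ F, V x, f x := by
    refine finsum_mem_inter_support_eq' _ _ _ ?_
    intro x hx
    refine ⟨fun h => ⟨h, ?_⟩, fun h => h.1⟩
    by_contra hn
    exact hy2 ⟨x, ⟨subset_tsupport _ hx, hn⟩, h⟩
  rw [h1, h2]
  symm
  refine finsum_mem_eq_of_bijOn t ⟨?_, ?_, ?_⟩ ?_
  · intro x hx
    exact ⟨(ht x hx).2, mem_biUnion hx (ht x hx).1⟩
  · intro x hx x' hx' h
    by_contra hne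
    refine Set.disjoint_left.1 (hUd hx hx' hne) (hVU x (ht x hx).1) ?_
    rw [h]
    exact hVU x' (ht x' hx').1
  · rintro z ⟨hz1, hz2⟩
    obtain ⟨x, hx, hzx⟩ := mem_iUnion₂.1 hz2
    refine ⟨x, hx, hVi x (ht x hx).1 hzx ?_⟩
    rw [(ht x hx).2]
    exact hz1.symm
  · intro x hx
    exact (hVf x _ (ht x hx).1).symm

theorem fibreSum_hasCompactSupport [T2Space Y] {π : X → Y} (hπ : IsLocalHomeomorph π)
    (f : C_c(X, ℤ)) : HasCompactSupport (fibreSum π f) := by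
  refine HasCompactSupport.intro (f.hasCompactSupport.isCompact.image hπ.continuous) ?_
  intro y hy
  refine finsum_mem_eq_zero_of_forall_eq_zero fun x hx => ?_
  by_contra hne
  exact hy ⟨x, subset_tsupport _ hne, hx⟩

/-- The homomorphism `π_* : C_c(X, ℤ) → C_c(Y, ℤ)`, `π_*(f)(y) = ∑_{π x = y} f x`, of a local
homeomorphism `π` between Hausdorff spaces. -/
def push [T2Space X] [T2Space Y] (π : X → Y) (hπ : IsLocalHomeomorph π) :
    C_c(X, ℤ) →+ C_c(Y, ℤ) where
  toFun f := ⟨⟨fibreSum π f, fibreSum_continuous hπ f⟩, fibreSum_hasCompactSupport hπ f⟩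
  map_zero' := by
    ext y
    exact finsum_mem_eq_zero_of_forall_eq_zero fun x _ => rfl
  map_add' f g := by
    ext y
    exact finsum_mem_add_distrib' (fibre_finite' hπ f y) (fibre_finite' hπ g y)

theorem push_apply [T2Space X] [T2Space Y] (π : X → Y) (hπ : IsLocalHomeomorph π)
    (f : C_c(X, ℤ)) (y : Y) : push π hπ f y = ∑ᶠ x ∈ π ⁻¹' {y}, f x := rfl

theorem push_push [T2Space X] [T2Space Y] [T2Space Z] {π : X → Y} (hπ : IsLocalHomeomorph π)
    {τ : Y → Z} (hτ : IsLocalHomeomorph τ) (f : C_c(X, ℤ)) :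
    push τ hτ (push π hπ f) = push (τ ∘ π) (hτ.comp hπ) f := by
  ext z
  have hfin := fibre_finite' (hτ.comp hπ) f z
  set S := (τ ∘ π) ⁻¹' {z} ∩ Function.support f with hS
  have h2 : ∀ y ∈ τ ⁻¹' {z}, push π hπ f y = ∑ᶠ x ∈ S ∩ π ⁻¹' {y}, f x := by
    intro y hy
    refine finsum_mem_inter_support_eq' _ _ _ ?_
    intro x hx
    refine ⟨fun h => ⟨⟨?_, hx⟩, h⟩, fun h => h.2⟩
    have : π x = y := h
    simpa [this] using hy
  have h3 : push τ hτ (push π hπ f) z = ∑ᶠ y ∈ π '' S, ∑ᶠ x ∈ S ∩ π ⁻¹' {y}, f x := by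
    rw [push_apply, finsum_mem_congr rfl h2]
    refine finsum_mem_inter_support_eq' _ _ _ ?_
    intro y hy
    constructor
    · intro _
      by_contra hn
      refine hy (finsum_mem_eq_zero_of_forall_eq_zero fun x hx => ?_)
      exact absurd ⟨x, hx.1, hx.2⟩ hn
    · rintro ⟨x, hx, rfl⟩
      exact hx.1
  rw [h3, ← finsum_mem_biUnion]
  · rw [push_apply]
    refine finsum_mem_inter_support_eq' _ _ _ ?_
    intro x hx
    constructor
    · intro h
      obtain ⟨_, _, h'⟩ := mem_iUnion₂.1 h
      exact h'.1.1
    · intro h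
      exact mem_biUnion (mem_image_of_mem π (show x ∈ S from ⟨h, hx⟩)) ⟨⟨h, hx⟩, rfl⟩
  · intro y _ y' _ hne
    refine Set.disjoint_left.2 fun x hx hx' => hne ?_
    rw [← show π x = y from hx.2, ← show π x = y' from hx'.2]
  · exact hfin.image π
  · intro y _
    exact hfin.inter_of_left _

theorem push_congr [T2Space X] [T2Space Y] {π τ : X → Y} (hπ : IsLocalHomeomorph π)
    (hτ : IsLocalHomeomorph τ) (h : π = τ) : push π hπ = push τ hτ := by
  subst h
  rfl

/-- The indicator function `1_S` of a compact open set `S`. -/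
def ind [T2Space X] (S : Set X) (hc : IsCompact S) (ho : IsOpen S) : C_c(X, ℤ) where
  toFun := S.indicator 1
  continuous_toFun := continuous_const.indicator (by
    intro x hx
    rw [(show IsClopen S from ⟨hc.isClosed, ho⟩).frontier_eq] at hx
    exact absurd hx (Set.notMem_empty x))
  hasCompactSupport' := HasCompactSupport.intro hc fun _ hx => Set.indicator_of_notMem hx _

theorem push_ind [T2Space X] [T2Space Y] {π : X → Y} (hπ : IsLocalHomeomorph π) {S : Set X}
    (hc : IsCompact S) (ho : IsOpen S) (hi : S.InjOn π) {T : Set Y} (hT : π '' S = T)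
    (hc' : IsCompact T) (ho' : IsOpen T) :
    push π hπ (ind S hc ho) = ind T hc' ho' := by
  subst hT
  ext y
  rw [push_apply]
  change ∑ᶠ x ∈ π ⁻¹' {y}, S.indicator 1 x = (π '' S).indicator 1 y
  by_cases hy : y ∈ π '' S
  · obtain ⟨x, hx, rfl⟩ := hy
    rw [Set.indicator_of_mem (mem_image_of_mem π hx)]
    have : ∑ᶠ z ∈ π ⁻¹' {π x}, S.indicator (1 : X → ℤ) z
        = ∑ᶠ z ∈ ({x} : Set X), S.indicator (1 : X → ℤ) z := by
      refine finsum_mem_inter_support_eq' _ _ _ ?_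
      intro z hz
      have hzS : z ∈ S := by
        by_contra hn
        exact hz (Set.indicator_of_notMem hn _)
      exact ⟨fun h => hi hzS hx h, fun h => congrArg π h⟩
    rw [this, finsum_mem_singleton, Set.indicator_of_mem hx]
    rfl
  · rw [Set.indicator_of_notMem hy]
    refine finsum_mem_eq_zero_of_forall_eq_zero fun x hx => ?_
    refine Set.indicator_of_notMem (fun hxS => hy ⟨x, hxS, hx⟩) _

end Pushforward

section Groupoids

theorem isLocalHomeomorph_of_isOpenMap {X Y : Type*} [TopologicalSpace X] [TopologicalSpace Y]
    {f : X → Y} (hc : Continuous f) (ho : IsOpenMap f) (hi : ∀ x, ∃ U ∈ 𝓝 x, U.InjOn f) :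
    IsLocalHomeomorph f := by
  rw [isLocalHomeomorph_iff_isOpenEmbedding_restrict]
  intro x
  obtain ⟨U, hU, hUi⟩ := hi x
  obtain ⟨W, hWU, hW, hxW⟩ := mem_nhds_iff.1 hU
  refine ⟨W, hW.mem_nhds hxW, .of_continuous_injective_isOpenMap
    (hc.comp continuous_subtype_val) ?_ (ho.comp hW.isOpenMap_subtype_val)⟩
  exact (hUi.mono hWU).injective

theorem exists_injOn {X Y : Type*} [TopologicalSpace X] [TopologicalSpace Y] {f : X → Y}
    (hf : IsLocalHomeomorph f) (x : X) : ∃ U ∈ 𝓝 x, U.InjOn f := by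
  obtain ⟨e, hx, rfl⟩ := hf x
  exact ⟨e.source, e.open_source.mem_nhds hx, e.injOn⟩

theorem isOpenEmbedding_prodMk_zero (X : Type*) [TopologicalSpace X] :
    IsOpenEmbedding fun x : X => (x, (0 : ℤ)) := by
  refine .of_continuous_injective_isOpenMap (by fun_prop)
    (fun x y h => congrArg Prod.fst h) fun U hU => ?_
  convert hU.prod (isOpen_discrete {(0 : ℤ)}) using 1
  ext ⟨x, k⟩
  constructor
  · rintro ⟨y, hy, h⟩
    cases h
    exact ⟨hy, rfl⟩
  · rintro ⟨hx, hk⟩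
    have hk : k = 0 := hk
    exact ⟨x, hx, by rw [hk]⟩

/-- A Hausdorff étale groupoid with space of arrows `G` and unit space `X`; the unit at `x` is
`one x`, and `mul g h` is defined when `s(g) = r(h)`. -/
structure EtaleGroupoid (G X : Type*) [TopologicalSpace G] [TopologicalSpace X] where
  src : G → X
  rng : G → X
  one : X → G
  inv : G → G
  mul : (g h : G) → src g = rng h → G
  src_one : ∀ x, src (one x) = x
  rng_one : ∀ x, rng (one x) = x
  src_inv : ∀ g, src (inv g) = rng g
  rng_inv : ∀ g, rng (inv g) = src g
  src_mul : ∀ g h p, src (mul g h p) = src h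
  rng_mul : ∀ g h p, rng (mul g h p) = rng g
  mul_assoc : ∀ g h k (p : src g = rng h) (q : src h = rng k),
    mul (mul g h p) k ((src_mul g h p).trans q) = mul g (mul h k q) (p.trans (rng_mul h k q).symm)
  one_mul : ∀ g, mul (one (rng g)) g (src_one _) = g
  mul_one : ∀ g, mul g (one (src g)) (rng_one _).symm = g
  inv_mul : ∀ g, mul (inv g) g (src_inv g) = one (src g)
  mul_inv : ∀ g, mul g (inv g) (rng_inv g).symm = one (rng g)
  t2_arrows : T2Space G
  t2_units : T2Space X
  continuous_one : Continuous one
  continuous_inv : Continuous inv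
  continuous_mul : Continuous fun p : {p : G × G // src p.1 = rng p.2} => mul p.1.1 p.1.2 p.2
  isLocalHomeomorph_src : IsLocalHomeomorph src

namespace EtaleGroupoid

variable {G X : Type*} [TopologicalSpace G] [TopologicalSpace X] (𝒢 : EtaleGroupoid G X)

theorem mul_congr {g g' h h' : G} (hg : g = g') (hh : h = h') (p : 𝒢.src g = 𝒢.rng h)
    (p' : 𝒢.src g' = 𝒢.rng h') : 𝒢.mul g h p = 𝒢.mul g' h' p' := by
  subst hg
  subst hh
  rfl

theorem inv_inv (g : G) : 𝒢.inv (𝒢.inv g) = g := by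
  have h1 := 𝒢.mul_assoc (𝒢.inv (𝒢.inv g)) (𝒢.inv g) g (𝒢.src_inv _) (𝒢.src_inv _)
  have h2 := 𝒢.one_mul g
  have h3 := 𝒢.mul_one (𝒢.inv (𝒢.inv g))
  rw [𝒢.mul_congr (𝒢.inv_mul (𝒢.inv g)) rfl _ ((𝒢.src_one _).trans (𝒢.src_inv g)),
    𝒢.mul_congr rfl (𝒢.inv_mul g) _
      (((𝒢.src_inv _).trans (𝒢.rng_inv g)).trans (𝒢.rng_one _).symm)] at h1
  rw [𝒢.mul_congr (g' := 𝒢.one (𝒢.rng g)) (by rw [𝒢.src_inv]) rfl _ (𝒢.src_one _), h2] at h1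
  refine (Eq.trans h1 ?_).symm
  refine Eq.trans ?_ h3
  exact 𝒢.mul_congr rfl (by rw [𝒢.src_inv, 𝒢.rng_inv]) _ _

theorem isLocalHomeomorph_inv : IsLocalHomeomorph 𝒢.inv :=
  (Homeomorph.mk ⟨𝒢.inv, 𝒢.inv, 𝒢.inv_inv, 𝒢.inv_inv⟩ 𝒢.continuous_inv
    𝒢.continuous_inv).isLocalHomeomorph

theorem isLocalHomeomorph_rng : IsLocalHomeomorph 𝒢.rng := by
  have h : 𝒢.rng = 𝒢.src ∘ 𝒢.inv := funext fun g => (𝒢.src_inv g).symm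
  rw [h]
  exact 𝒢.isLocalHomeomorph_src.comp 𝒢.isLocalHomeomorph_inv

/-- The space `G^(2)` of composable pairs. -/
abbrev Comp : Type _ := {p : G × G // 𝒢.src p.1 = 𝒢.rng p.2}

/-- The face map `d_0(g, h) = h`. -/
def d0 (p : 𝒢.Comp) : G := p.1.2

/-- The face map `d_1(g, h) = gh`. -/
def d1 (p : 𝒢.Comp) : G := 𝒢.mul p.1.1 p.1.2 p.2

/-- The face map `d_2(g, h) = g`. -/
def d2 (p : 𝒢.Comp) : G := p.1.1

theorem isLocalHomeomorph_d0 : IsLocalHomeomorph 𝒢.d0 := by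
  refine isLocalHomeomorph_of_isOpenMap (continuous_snd.comp continuous_subtype_val) ?_ ?_
  · rw [isOpenMap_iff_nhds_le]
    rintro ⟨⟨g, h⟩, p⟩ W hW
    obtain ⟨T, hT, hTW⟩ :=
      (mem_nhds_subtype {p : G × G | 𝒢.src p.1 = 𝒢.rng p.2} _ _).1 (Filter.mem_map.1 hW)
    obtain ⟨N, hN, M, hM, hNM⟩ := mem_nhds_prod_iff.1 hT
    have h1 : 𝒢.src '' N ∈ 𝓝 (𝒢.rng h) := by
      rw [← show 𝒢.src g = 𝒢.rng h from p]
      exact 𝒢.isLocalHomeomorph_src.isOpenMap.image_mem_nhds hN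
    filter_upwards [hM, 𝒢.isLocalHomeomorph_rng.continuous.continuousAt h1] with k hk hk'
    obtain ⟨g', hg', hg''⟩ := hk'
    exact hTW (a := ⟨(g', k), hg''⟩) (hNM ⟨hg', hk⟩)
  · rintro ⟨⟨g, h⟩, p⟩
    obtain ⟨U, hU, hUi⟩ := exists_injOn 𝒢.isLocalHomeomorph_src g
    refine ⟨{q | q.1.1 ∈ U}, (continuous_fst.comp continuous_subtype_val).continuousAt hU, ?_⟩
    rintro ⟨⟨g₁, h₁⟩, p₁⟩ q₁ ⟨⟨g₂, h₂⟩, p₂⟩ q₂ (rfl : h₁ = h₂)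
    have : g₁ = g₂ := hUi q₁ q₂ (p₁.trans p₂.symm)
    subst this
    rfl

theorem isLocalHomeomorph_d2 : IsLocalHomeomorph 𝒢.d2 := by
  refine isLocalHomeomorph_of_isOpenMap (continuous_fst.comp continuous_subtype_val) ?_ ?_
  · rw [isOpenMap_iff_nhds_le]
    rintro ⟨⟨g, h⟩, p⟩ W hW
    obtain ⟨T, hT, hTW⟩ :=
      (mem_nhds_subtype {p : G × G | 𝒢.src p.1 = 𝒢.rng p.2} _ _).1 (Filter.mem_map.1 hW)
    obtain ⟨N, hN, M, hM, hNM⟩ := mem_nhds_prod_iff.1 hT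
    have h1 : 𝒢.rng '' M ∈ 𝓝 (𝒢.src g) := by
      rw [show 𝒢.src g = 𝒢.rng h from p]
      exact 𝒢.isLocalHomeomorph_rng.isOpenMap.image_mem_nhds hM
    filter_upwards [hN, 𝒢.isLocalHomeomorph_src.continuous.continuousAt h1] with k hk hk'
    obtain ⟨h', hh', hh''⟩ := hk'
    exact hTW (a := ⟨(k, h'), hh''.symm⟩) (hNM ⟨hk, hh'⟩)
  · rintro ⟨⟨g, h⟩, p⟩
    obtain ⟨U, hU, hUi⟩ := exists_injOn 𝒢.isLocalHomeomorph_rng h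
    refine ⟨{q | q.1.2 ∈ U}, (continuous_snd.comp continuous_subtype_val).continuousAt hU, ?_⟩
    rintro ⟨⟨g₁, h₁⟩, p₁⟩ q₁ ⟨⟨g₂, h₂⟩, p₂⟩ q₂ (rfl : g₁ = g₂)
    have : h₁ = h₂ := hUi q₁ q₂ (p₁.symm.trans p₂)
    subst this
    rfl

theorem isLocalHomeomorph_d1 : IsLocalHomeomorph 𝒢.d1 := by
  refine IsLocalHomeomorph.of_comp (g := 𝒢.src) ?_ 𝒢.isLocalHomeomorph_src 𝒢.continuous_mul
  have h : 𝒢.src ∘ 𝒢.d1 = 𝒢.src ∘ 𝒢.d0 := funext fun p => 𝒢.src_mul _ _ _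
  rw [h]
  exact 𝒢.isLocalHomeomorph_src.comp 𝒢.isLocalHomeomorph_d0

instance t2_comp : T2Space 𝒢.Comp :=
  haveI := 𝒢.t2_arrows
  inferInstance

/-- `δ_1 = s_* - r_*`. -/
def δ₁ : C_c(G, ℤ) →+ C_c(X, ℤ) :=
  haveI := 𝒢.t2_arrows
  haveI := 𝒢.t2_units
  push 𝒢.src 𝒢.isLocalHomeomorph_src - push 𝒢.rng 𝒢.isLocalHomeomorph_rng

/-- `δ_2 = (d_0)_* - (d_1)_* + (d_2)_*`. -/
def δ₂ : C_c(𝒢.Comp, ℤ) →+ C_c(G, ℤ) :=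
  haveI := 𝒢.t2_arrows
  push 𝒢.d0 𝒢.isLocalHomeomorph_d0 - push 𝒢.d1 𝒢.isLocalHomeomorph_d1
    + push 𝒢.d2 𝒢.isLocalHomeomorph_d2

theorem δ₁_δ₂ (f : C_c(𝒢.Comp, ℤ)) : 𝒢.δ₁ (𝒢.δ₂ f) = 0 := by
  have := 𝒢.t2_arrows
  have := 𝒢.t2_units
  simp only [δ₁, δ₂, AddMonoidHom.sub_apply, AddMonoidHom.add_apply, map_add, map_sub, push_push]
  rw [push_congr _ (𝒢.isLocalHomeomorph_src.comp 𝒢.isLocalHomeomorph_d0)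
      (show 𝒢.src ∘ 𝒢.d1 = 𝒢.src ∘ 𝒢.d0 from funext fun p => 𝒢.src_mul _ _ _),
    push_congr _ (𝒢.isLocalHomeomorph_rng.comp 𝒢.isLocalHomeomorph_d2)
      (show 𝒢.rng ∘ 𝒢.d1 = 𝒢.rng ∘ 𝒢.d2 from funext fun p => 𝒢.rng_mul _ _ _),
    push_congr _ (𝒢.isLocalHomeomorph_rng.comp 𝒢.isLocalHomeomorph_d0)
      (show 𝒢.src ∘ 𝒢.d2 = 𝒢.rng ∘ 𝒢.d0 from funext fun p => p.2)]
  abel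

/-- `H_0(𝒢) = coker δ_1`. -/
abbrev H₀ : Type _ := C_c(X, ℤ) ⧸ 𝒢.δ₁.range

/-- `H_1(𝒢) = ker δ_1 / im δ_2`. -/
abbrev H₁ : Type _ := 𝒢.δ₁.ker ⧸ 𝒢.δ₂.range.addSubgroupOf 𝒢.δ₁.ker

/-- The class in `H_0(𝒢)` of a function on the unit space. -/
def cls₀ (f : C_c(X, ℤ)) : 𝒢.H₀ := QuotientAddGroup.mk f

/-- The class in `H_1(𝒢)` of a cycle. -/
def cls₁ (f : C_c(G, ℤ)) (hf : 𝒢.δ₁ f = 0) : 𝒢.H₁ :=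
  QuotientAddGroup.mk (⟨f, hf⟩ : 𝒢.δ₁.ker)

end EtaleGroupoid

/-- A groupoid homomorphism that is a local homeomorphism on arrows and on units. -/
structure EtaleHom {G X G' X' : Type*} [TopologicalSpace G] [TopologicalSpace X]
    [TopologicalSpace G'] [TopologicalSpace X'] (𝒢 : EtaleGroupoid G X)
    (𝒢' : EtaleGroupoid G' X') where
  arr : G → G'
  pt : X → X'
  src_arr : ∀ g, 𝒢'.src (arr g) = pt (𝒢.src g)
  rng_arr : ∀ g, 𝒢'.rng (arr g) = pt (𝒢.rng g)
  arr_mul : ∀ g h p, arr (𝒢.mul g h p)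
    = 𝒢'.mul (arr g) (arr h) (by rw [src_arr, rng_arr, p])
  isLocalHomeomorph_arr : IsLocalHomeomorph arr
  isLocalHomeomorph_pt : IsLocalHomeomorph pt

namespace EtaleHom

variable {G X G' X' : Type*} [TopologicalSpace G] [TopologicalSpace X]
  [TopologicalSpace G'] [TopologicalSpace X'] {𝒢 : EtaleGroupoid G X}
  {𝒢' : EtaleGroupoid G' X'} (F : EtaleHom 𝒢 𝒢')

/-- The map induced on composable pairs. -/
def comp (p : 𝒢.Comp) : 𝒢'.Comp :=
  ⟨(F.arr p.1.1, F.arr p.1.2), by rw [F.src_arr, F.rng_arr, p.2]⟩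

theorem isLocalHomeomorph_comp : IsLocalHomeomorph F.comp := by
  refine IsLocalHomeomorph.of_comp (g := 𝒢'.d0)
    (F.isLocalHomeomorph_arr.comp 𝒢.isLocalHomeomorph_d0) 𝒢'.isLocalHomeomorph_d0 ?_
  have h := F.isLocalHomeomorph_arr.continuous
  exact ((h.comp (continuous_fst.comp continuous_subtype_val)).prodMk
    (h.comp (continuous_snd.comp continuous_subtype_val))).subtype_mk _

/-- The map induced on chains in degree zero. -/
def chain₀ : C_c(X, ℤ) →+ C_c(X', ℤ) :=
  haveI := 𝒢.t2_units
  haveI := 𝒢'.t2_units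
  push F.pt F.isLocalHomeomorph_pt

/-- The map induced on chains in degree one. -/
def chain₁ : C_c(G, ℤ) →+ C_c(G', ℤ) :=
  haveI := 𝒢.t2_arrows
  haveI := 𝒢'.t2_arrows
  push F.arr F.isLocalHomeomorph_arr

/-- The map induced on chains in degree two. -/
def chain₂ : C_c(𝒢.Comp, ℤ) →+ C_c(𝒢'.Comp, ℤ) :=
  push F.comp F.isLocalHomeomorph_comp

theorem δ₁_chain₁ (f : C_c(G, ℤ)) : 𝒢'.δ₁ (F.chain₁ f) = F.chain₀ (𝒢.δ₁ f) := by
  have := 𝒢.t2_arrows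
  have := 𝒢'.t2_arrows
  have := 𝒢.t2_units
  have := 𝒢'.t2_units
  simp only [EtaleGroupoid.δ₁, chain₀, chain₁, AddMonoidHom.sub_apply, map_sub, push_push]
  rw [push_congr _ (F.isLocalHomeomorph_pt.comp 𝒢.isLocalHomeomorph_src)
      (show 𝒢'.src ∘ F.arr = F.pt ∘ 𝒢.src from funext F.src_arr),
    push_congr _ (F.isLocalHomeomorph_pt.comp 𝒢.isLocalHomeomorph_rng)
      (show 𝒢'.rng ∘ F.arr = F.pt ∘ 𝒢.rng from funext F.rng_arr)]

theorem δ₂_chain₂ (f : C_c(𝒢.Comp, ℤ)) : 𝒢'.δ₂ (F.chain₂ f) = F.chain₁ (𝒢.δ₂ f) := by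
  have := 𝒢.t2_arrows
  have := 𝒢'.t2_arrows
  simp only [EtaleGroupoid.δ₂, chain₁, chain₂, AddMonoidHom.sub_apply, AddMonoidHom.add_apply,
    map_add, map_sub, push_push]
  rw [push_congr _ (F.isLocalHomeomorph_arr.comp 𝒢.isLocalHomeomorph_d1)
      (show 𝒢'.d1 ∘ F.comp = F.arr ∘ 𝒢.d1 from funext fun p => (F.arr_mul _ _ _).symm)]
  rfl

/-- The map induced on `H_0`. -/
def mapH₀ : 𝒢.H₀ →+ 𝒢'.H₀ :=
  QuotientAddGroup.map _ _ F.chain₀ (by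
    rintro _ ⟨f, rfl⟩
    exact ⟨F.chain₁ f, F.δ₁_chain₁ f⟩)

/-- The map induced on `1`-cycles. -/
def cycle : 𝒢.δ₁.ker →+ 𝒢'.δ₁.ker where
  toFun f := ⟨F.chain₁ f.1, by
    rw [AddMonoidHom.mem_ker, F.δ₁_chain₁, (AddMonoidHom.mem_ker).1 f.2, map_zero]⟩
  map_zero' := Subtype.ext (map_zero F.chain₁)
  map_add' f g := Subtype.ext (map_add F.chain₁ f.1 g.1)

/-- The map induced on `H_1`. -/
def mapH₁ : 𝒢.H₁ →+ 𝒢'.H₁ :=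
  QuotientAddGroup.map _ _ F.cycle (by
    rintro ⟨f, hf⟩ ⟨k, hk⟩
    refine ⟨F.chain₂ k, ?_⟩
    rw [F.δ₂_chain₂, hk]
    rfl)

end EtaleHom

section Skew

variable {G X : Type*} [TopologicalSpace G] [TopologicalSpace X] (𝒢 : EtaleGroupoid G X)

/-- A continuous groupoid homomorphism `𝒢 → ℤ`. -/
structure Cocycle where
  toFun : G → ℤ
  map_mul : ∀ g h p, toFun (𝒢.mul g h p) = toFun g + toFun h
  continuous_toFun : Continuous toFun

variable {𝒢} (ρ : Cocycle 𝒢)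

theorem Cocycle.map_one (x : X) : ρ.toFun (𝒢.one x) = 0 := by
  have h := ρ.map_mul (𝒢.one x) (𝒢.one x) (by rw [𝒢.src_one, 𝒢.rng_one])
  have h' := 𝒢.one_mul (𝒢.one x)
  rw [𝒢.mul_congr (g' := 𝒢.one x) (by rw [𝒢.rng_one]) rfl _
    (by rw [𝒢.src_one, 𝒢.rng_one])] at h'
  rw [h'] at h
  omega

theorem Cocycle.map_inv (g : G) : ρ.toFun (𝒢.inv g) = - ρ.toFun g := by
  have h := ρ.map_mul (𝒢.inv g) g (𝒢.src_inv g)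
  rw [𝒢.inv_mul, ρ.map_one] at h
  omega

/-- The skew product `𝒢 ×_ρ ℤ`: `(g, k)` and `(h, l)` are composable iff `g` and `h` are and
`k + ρ(g) = l`, with `(g, k)(h, k + ρ(g)) = (gh, k)` and `(g, k)⁻¹ = (g⁻¹, k + ρ(g))`. -/
def skew : EtaleGroupoid (G × ℤ) (X × ℤ) where
  src a := (𝒢.src a.1, a.2 + ρ.toFun a.1)
  rng a := (𝒢.rng a.1, a.2)
  one y := (𝒢.one y.1, y.2)
  inv a := (𝒢.inv a.1, a.2 + ρ.toFun a.1)
  mul a b p := (𝒢.mul a.1 b.1 (congrArg Prod.fst p), a.2)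
  src_one y := by simp [𝒢.src_one, ρ.map_one]
  rng_one y := by simp [𝒢.rng_one]
  src_inv a := by simp [𝒢.src_inv, ρ.map_inv]
  rng_inv a := by simp [𝒢.rng_inv]
  src_mul a b p := by
    have h : a.2 + ρ.toFun a.1 = b.2 := congrArg Prod.snd p
    simp only [𝒢.src_mul, ρ.map_mul, ← h, add_assoc]
  rng_mul a b p := by simp [𝒢.rng_mul]
  mul_assoc a b c p q := Prod.ext (𝒢.mul_assoc a.1 b.1 c.1 (congrArg Prod.fst p)
    (congrArg Prod.fst q)) rfl
  one_mul a := by simp [𝒢.one_mul]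
  mul_one a := by simp [𝒢.mul_one]
  inv_mul a := by simp [𝒢.inv_mul]
  mul_inv a := by simp [𝒢.mul_inv]
  t2_arrows := haveI := 𝒢.t2_arrows; inferInstance
  t2_units := haveI := 𝒢.t2_units; inferInstance
  continuous_one := (𝒢.continuous_one.comp continuous_fst).prodMk continuous_snd
  continuous_inv := (𝒢.continuous_inv.comp continuous_fst).prodMk
    (continuous_snd.add (ρ.continuous_toFun.comp continuous_fst))
  continuous_mul := by
    refine Continuous.prodMk ?_ (continuous_snd.comp (continuous_fst.comp continuous_subtype_val))
    refine 𝒢.continuous_mul.comp (Continuous.subtype_mk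
      (f := fun p : {p : (G × ℤ) × (G × ℤ) // (𝒢.src p.1.1, p.1.2 + ρ.toFun p.1.1)
        = (𝒢.rng p.2.1, p.2.2)} => (p.1.1.1, p.1.2.1)) ?_ fun p => congrArg Prod.fst p.2)
    fun_prop
  isLocalHomeomorph_src := by
    have hc := ρ.continuous_toFun
    have hs := 𝒢.isLocalHomeomorph_src.continuous
    refine isLocalHomeomorph_of_isOpenMap (by fun_prop) ?_ ?_
    · rw [isOpenMap_iff_nhds_le]
      rintro ⟨g, k⟩ W hW
      rw [Filter.mem_map, nhds_prod_eq, nhds_discrete ℤ, Filter.prod_pure, Filter.mem_map] at hW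
      rw [nhds_prod_eq, nhds_discrete ℤ, Filter.prod_pure, Filter.mem_map]
      have h1 : {g' | ρ.toFun g' = ρ.toFun g} ∈ 𝓝 g :=
        hc.continuousAt ((isOpen_discrete {ρ.toFun g}).mem_nhds rfl)
      filter_upwards [𝒢.isLocalHomeomorph_src.isOpenMap.image_mem_nhds (Filter.inter_mem hW h1)]
        with x hx
      obtain ⟨g', ⟨h2, h3⟩, rfl⟩ := hx
      have h4 : ρ.toFun g' = ρ.toFun g := h3
      have h5 : (𝒢.src g', k + ρ.toFun g') ∈ W := h2
      rwa [h4] at h5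
    · rintro ⟨g, k⟩
      obtain ⟨U, hU, hUi⟩ := exists_injOn 𝒢.isLocalHomeomorph_src g
      refine ⟨U ×ˢ univ, prod_mem_nhds hU Filter.univ_mem, ?_⟩
      rintro ⟨g₁, k₁⟩ h₁ ⟨g₂, k₂⟩ h₂ h
      have h3 : g₁ = g₂ := hUi h₁.1 h₂.1 (congrArg Prod.fst h)
      subst h3
      have h4 : k₁ + ρ.toFun g₁ = k₂ + ρ.toFun g₁ := congrArg Prod.snd h
      rw [add_right_cancel h4]

/-- The dual action on the skew product: `ρ̂^m (g, k) = (g, m + k)`. -/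
def dual (m : ℤ) : EtaleHom (skew ρ) (skew ρ) where
  arr a := (a.1, m + a.2)
  pt y := (y.1, m + y.2)
  src_arr a := by simp [skew, add_assoc]
  rng_arr a := rfl
  arr_mul a b p := rfl
  isLocalHomeomorph_arr := ((Homeomorph.refl G).prodCongr (Homeomorph.addLeft m)).isLocalHomeomorph
  isLocalHomeomorph_pt := ((Homeomorph.refl X).prodCongr (Homeomorph.addLeft m)).isLocalHomeomorph

theorem Cocycle.isOpen_ker : IsOpen {g : G | ρ.toFun g = 0} :=
  (isOpen_discrete {(0 : ℤ)}).preimage ρ.continuous_toFun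

/-- The open subgroupoid `ker ρ`, with the same unit space. -/
def kernel : EtaleGroupoid {g : G // ρ.toFun g = 0} X where
  src g := 𝒢.src g.1
  rng g := 𝒢.rng g.1
  one x := ⟨𝒢.one x, ρ.map_one x⟩
  inv g := ⟨𝒢.inv g.1, by rw [ρ.map_inv, g.2, neg_zero]⟩
  mul g h p := ⟨𝒢.mul g.1 h.1 p, by rw [ρ.map_mul, g.2, h.2, add_zero]⟩
  src_one x := 𝒢.src_one x
  rng_one x := 𝒢.rng_one x
  src_inv g := 𝒢.src_inv g.1
  rng_inv g := 𝒢.rng_inv g.1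
  src_mul g h p := 𝒢.src_mul g.1 h.1 p
  rng_mul g h p := 𝒢.rng_mul g.1 h.1 p
  mul_assoc g h k p q := Subtype.ext (𝒢.mul_assoc g.1 h.1 k.1 p q)
  one_mul g := Subtype.ext (𝒢.one_mul g.1)
  mul_one g := Subtype.ext (𝒢.mul_one g.1)
  inv_mul g := Subtype.ext (𝒢.inv_mul g.1)
  mul_inv g := Subtype.ext (𝒢.mul_inv g.1)
  t2_arrows := haveI := 𝒢.t2_arrows; inferInstance
  t2_units := 𝒢.t2_units
  continuous_one := Topology.IsInducing.subtypeVal.continuous_iff.2 𝒢.continuous_one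
  continuous_inv := Topology.IsInducing.subtypeVal.continuous_iff.2
    (𝒢.continuous_inv.comp continuous_subtype_val)
  continuous_mul := by
    refine Topology.IsInducing.subtypeVal.continuous_iff.2 (𝒢.continuous_mul.comp
      (Continuous.subtype_mk (f := fun p : {p : {g : G // ρ.toFun g = 0} × {g : G // ρ.toFun g = 0} //
        𝒢.src p.1.1 = 𝒢.rng p.2.1} => (p.1.1.1, p.1.2.1)) ?_ fun p => p.2))
    fun_prop
  isLocalHomeomorph_src :=
    𝒢.isLocalHomeomorph_src.comp ρ.isOpen_ker.isOpenEmbedding_subtypeVal.isLocalHomeomorph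

/-- The embedding `ker ρ → 𝒢 ×_ρ ℤ`, `g ↦ (g, 0)`, which identifies `ker ρ` with the restriction
of `𝒢 ×_ρ ℤ` to the open set `𝒢^(0) × {0}`. -/
def incl : EtaleHom (kernel ρ) (skew ρ) where
  arr g := (g.1, 0)
  pt x := (x, 0)
  src_arr g := by simp [skew, kernel, g.2]
  rng_arr g := rfl
  arr_mul g h p := rfl
  isLocalHomeomorph_arr := IsLocalHomeomorph.comp (isOpenEmbedding_prodMk_zero G).isLocalHomeomorph
    ρ.isOpen_ker.isOpenEmbedding_subtypeVal.isLocalHomeomorph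
  isLocalHomeomorph_pt := (isOpenEmbedding_prodMk_zero X).isLocalHomeomorph

/-- If the embedding of `ker ρ` induces an isomorphism on `H_0`, this is the inverse isomorphism
`Ψ : H_0(𝒢 ×_ρ ℤ) → H_0(ker ρ)`, `[f] ↦ [f]`. -/
def Ψ₀ (h : Function.Bijective (incl ρ).mapH₀) : (skew ρ).H₀ ≃+ (kernel ρ).H₀ :=
  (AddEquiv.ofBijective (incl ρ).mapH₀ h).symm

/-- The same in degree one. -/
def Ψ₁ (h : Function.Bijective (incl ρ).mapH₁) : (skew ρ).H₁ ≃+ (kernel ρ).H₁ :=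
  (AddEquiv.ofBijective (incl ρ).mapH₁ h).symm

/-- The action `ρ̃^m = Ψ ∘ ρ̂^m ∘ Ψ⁻¹` of `m : ℤ` on `H_0(ker ρ)`. -/
def tilde₀ (h : Function.Bijective (incl ρ).mapH₀) (m : ℤ) : (kernel ρ).H₀ →+ (kernel ρ).H₀ :=
  ((Ψ₀ ρ h).toAddMonoidHom.comp (dual ρ m).mapH₀).comp (Ψ₀ ρ h).symm.toAddMonoidHom

/-- The action `ρ̃^m = Ψ ∘ ρ̂^m ∘ Ψ⁻¹` of `m : ℤ` on `H_1(ker ρ)`. -/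
def tilde₁ (h : Function.Bijective (incl ρ).mapH₁) (m : ℤ) : (kernel ρ).H₁ →+ (kernel ρ).H₁ :=
  ((Ψ₁ ρ h).toAddMonoidHom.comp (dual ρ m).mapH₁).comp (Ψ₁ ρ h).symm.toAddMonoidHom

end Skew

end Groupoids

section Paths

universe u

variable {V : Type u} (A B : Matrix V V ℤ)

/-- Every row has only finitely many nonzero entries. -/
def RowFinite (M : Matrix V V ℤ) : Prop := ∀ i, {j | M i j ≠ 0}.Finite

/-- The edges `e_{i,j,n}`, `0 ≤ n < A i j`, with source `i` and range `j`. -/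
@[ext] structure Edge where
  s : V
  r : V
  idx : ℤ
  nonneg : 0 ≤ idx
  lt : idx < A s r

instance : TopologicalSpace (Edge A) := ⊥
instance : DiscreteTopology (Edge A) := ⟨rfl⟩

variable {A}

theorem Edge.pos (e : Edge A) : 0 < A e.s e.r := lt_of_le_of_lt e.nonneg e.lt

/-- `κ_m(e_{i,j,n}) = e_{i,j,l}` where `m B_{i,j} + n = k A_{i,j} + l`, `0 ≤ l < A_{i,j}`. -/
def Edge.act (m : ℤ) (e : Edge A) : Edge A where
  s := e.s
  r := e.r
  idx := (m * B e.s e.r + e.idx) % A e.s e.r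
  nonneg := Int.emod_nonneg _ e.pos.ne'
  lt := Int.emod_lt_of_pos _ e.pos

/-- `φ(m, e_{i,j,n}) = k` where `m B_{i,j} + n = k A_{i,j} + l`, `0 ≤ l < A_{i,j}`. -/
def Edge.coc (m : ℤ) (e : Edge A) : ℤ := (m * B e.s e.r + e.idx) / A e.s e.r

theorem Edge.act_zero (e : Edge A) : e.act B 0 = e := by
  ext
  · rfl
  · rfl
  · simp [Edge.act, Int.emod_eq_of_lt e.nonneg e.lt]

theorem Edge.coc_zero (e : Edge A) : e.coc B 0 = 0 := by
  simp [Edge.coc, Int.ediv_eq_zero_of_lt e.nonneg e.lt]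

theorem Edge.eq_aux (m₁ m₂ : ℤ) (e : Edge A) : (m₁ + m₂) * B e.s e.r + e.idx
    = (m₁ * B e.s e.r + (e.act B m₂).idx) + A e.s e.r * e.coc B m₂ := by
  have h := Int.mul_ediv_add_emod (m₂ * B e.s e.r + e.idx) (A e.s e.r)
  simp only [Edge.act, Edge.coc]
  linarith

theorem Edge.act_add (m₁ m₂ : ℤ) (e : Edge A) :
    e.act B (m₁ + m₂) = (e.act B m₂).act B m₁ := by
  ext
  · rfl
  · rfl
  · change ((m₁ + m₂) * B e.s e.r + e.idx) % A e.s e.r = _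
    rw [Edge.eq_aux, Int.add_mul_emod_self_left]
    rfl

theorem Edge.coc_add (m₁ m₂ : ℤ) (e : Edge A) :
    e.coc B (m₁ + m₂) = (e.act B m₂).coc B m₁ + e.coc B m₂ := by
  change ((m₁ + m₂) * B e.s e.r + e.idx) / A e.s e.r = _
  rw [Edge.eq_aux, Int.add_mul_ediv_left _ _ e.pos.ne']
  rfl

variable (A) in
/-- The action `κ` is pseudo free. -/
def PseudoFree : Prop := ∀ (m : ℤ) (e : Edge A), e.act B m = e → e.coc B m = 0 → m = 0

variable {B} in
theorem PseudoFree.eq (hp : PseudoFree A B) {m m' : ℤ} {e : Edge A}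
    (h : e.act B m = e.act B m') (h' : e.coc B m = e.coc B m') : m = m' := by
  have h1 := Edge.act_add B (m - m') m' e
  have h2 := Edge.coc_add B (m - m') m' e
  rw [sub_add_cancel] at h1 h2
  have := hp (m - m') (e.act B m') (by rw [← h1, h]) (by omega)
  omega

variable (A) in
/-- The infinite path space, a subspace of the product of copies of the discrete edge set. -/
abbrev InfPath : Type u := {x : ℕ → Edge A // ∀ n, (x n).r = (x (n + 1)).s}

variable (A) in
/-- Finite paths: a source vertex and a list of consecutive edges starting there. The paths of
length zero are the vertices. -/
@[ext] structure FinPath where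
  s : V
  edges : List (Edge A)
  head : ∀ h : 0 < edges.length, edges[0].s = s
  link : ∀ (i : ℕ) (h : i + 1 < edges.length), (edges[i]).r = (edges[i + 1]).s

namespace FinPath

/-- The length `|α|`. -/
def len (α : FinPath A) : ℕ := α.edges.length

/-- The range `r(α)`. -/
def r (α : FinPath A) : V :=
  if h : 0 < α.edges.length then (α.edges[α.edges.length - 1]).r else α.s

theorem r_of_pos {α : FinPath A} (h : 0 < α.edges.length) :
    α.r = (α.edges[α.edges.length - 1]).r := dif_pos h

theorem r_of_not {α : FinPath A} (h : ¬ 0 < α.edges.length) : α.r = α.s := dif_neg h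

/-- The path `αe`. -/
def snoc (α : FinPath A) (e : Edge A) (h : α.r = e.s) : FinPath A where
  s := α.s
  edges := α.edges ++ [e]
  head _ := by
    by_cases hα : 0 < α.edges.length
    · rw [List.getElem_append_left hα]
      exact α.head hα
    · rw [List.getElem_append_right (by omega), ← r_of_not hα, h]
      simp
  link i hi := by
    simp only [List.length_append, List.length_singleton] at hi
    by_cases h' : i + 1 < α.edges.length
    · rw [List.getElem_append_left h', List.getElem_append_left (by omega)]
      exact α.link i h'
    · have h1 : i = α.edges.length - 1 := by omega
      rw [List.getElem_append_left (by omega), List.getElem_append_right (by omega)]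
      rw [r_of_pos (by omega)] at h
      simp only [h1, h, List.getElem_singleton]

/-- The infinite path `αy`. -/
def append (α : FinPath A) (y : InfPath A) (h : α.r = (y.1 0).s) : InfPath A :=
  ⟨fun n => if hn : n < α.edges.length then α.edges[n] else y.1 (n - α.edges.length), by
    intro n
    beta_reduce
    by_cases h1 : n + 1 < α.edges.length
    · rw [dif_pos h1, dif_pos (by omega)]
      exact α.link n h1
    · rw [dif_neg h1]
      by_cases h2 : n < α.edges.length
      · have h3 : n = α.edges.length - 1 := by omega
        have h4 : n + 1 - α.edges.length = 0 := by omega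
        rw [dif_pos h2, h4, ← h, r_of_pos (by omega)]
        simp only [h3]
      · rw [dif_neg h2, show n + 1 - α.edges.length = (n - α.edges.length) + 1 by omega]
        exact y.2 _⟩

end FinPath

namespace InfPath

/-- The initial segment `x_{|n}`. -/
def take (x : InfPath A) (n : ℕ) : FinPath A where
  s := (x.1 0).s
  edges := List.ofFn fun i : Fin n => x.1 i
  head h := by simp
  link i h := by simpa using x.2 i

/-- The remaining path after deleting `n` edges. -/
def drop (x : InfPath A) (n : ℕ) : InfPath A := ⟨fun i => x.1 (n + i), fun i => x.2 (n + i)⟩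

theorem length_take (x : InfPath A) (n : ℕ) : (x.take n).edges.length = n := by simp [take]

theorem len_take (x : InfPath A) (n : ℕ) : (x.take n).len = n := x.length_take n

theorem r_take (x : InfPath A) (n : ℕ) : (x.take n).r = (x.1 n).s := by
  cases n with
  | zero => exact FinPath.r_of_not (by simp [take])
  | succ n =>
    have h : ∀ k (hk : k < (x.take (n + 1)).edges.length), (x.take (n + 1)).edges[k] = x.1 k :=
      fun k hk => List.getElem_ofFn hk
    rw [FinPath.r_of_pos (by simp [take]), h, length_take]
    exact x.2 n

theorem take_succ (x : InfPath A) (n : ℕ) :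
    x.take (n + 1) = (x.take n).snoc (x.1 n) (x.r_take n) := by
  ext1
  · rfl
  · exact List.ofFn_succ_last

theorem take_eq_take_iff {x y : InfPath A} {n : ℕ} :
    x.take n = y.take n ↔ (x.1 0).s = (y.1 0).s ∧ ∀ i < n, x.1 i = y.1 i := by
  constructor
  · intro h
    refine ⟨congrArg FinPath.s h, fun i hi => ?_⟩
    have h1 : (List.ofFn fun i : Fin n => x.1 i) = List.ofFn fun i : Fin n => y.1 i :=
      congrArg FinPath.edges h
    exact congrFun (List.ofFn_injective h1) ⟨i, hi⟩
  · rintro ⟨h1, h2⟩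
    ext1
    · exact h1
    · exact congrArg List.ofFn (funext fun i => h2 i i.2)

theorem take_append (α : FinPath A) (y : InfPath A) (h : α.r = (y.1 0).s) :
    (α.append y h).take α.len = α := by
  ext1
  · change (dite _ _ _ : Edge A).s = _
    split_ifs with h0
    · exact α.head h0
    · rw [← FinPath.r_of_not h0, h, Nat.zero_sub]
  · refine List.ext_getElem (length_take _ _) fun i h1 h2 => ?_
    simp [take, FinPath.append, h2]

theorem drop_append (α : FinPath A) (y : InfPath A) (h : α.r = (y.1 0).s) :
    (α.append y h).drop α.len = y := by
  refine Subtype.ext (funext fun i => ?_)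
  simp [drop, FinPath.append, FinPath.len]

theorem append_take_drop (x : InfPath A) (n : ℕ) (h) : (x.take n).append (x.drop n) h = x := by
  refine Subtype.ext (funext fun i => ?_)
  change dite _ _ _ = _
  split_ifs with hi
  · simp [take]
  · rw [length_take] at hi ⊢
    change x.1 (n + (i - n)) = _
    rw [Nat.add_sub_cancel' (not_lt.1 hi)]

theorem drop_drop (x : InfPath A) (n k : ℕ) : (x.drop n).drop k = x.drop (n + k) :=
  Subtype.ext (funext fun i => congrArg x.1 (add_assoc n k i).symm)

/-- `φ(m, x_{|n})`, where `φ(m, αe) = φ(φ(m, α), e)`. -/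
def coc (m : ℤ) (x : InfPath A) : ℕ → ℤ
  | 0 => m
  | n + 1 => (x.1 n).coc B (coc m x n)

/-- The action `κ_m` on infinite paths, the `n`-th edge of `κ_m(x)` being
`κ_{φ(m, x_{|n})}(x_n)`. -/
def act (m : ℤ) (x : InfPath A) : InfPath A :=
  ⟨fun n => (x.1 n).act B (coc B m x n), fun n => x.2 n⟩

theorem coc_zero (x : InfPath A) (n : ℕ) : coc B 0 x n = 0 := by
  induction n with
  | zero => rfl
  | succ n ih => rw [coc, ih, Edge.coc_zero]

theorem act_zero (x : InfPath A) : x.act B 0 = x :=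
  Subtype.ext (funext fun n => by
    change (x.1 n).act B (coc B 0 x n) = _
    rw [coc_zero, Edge.act_zero])

theorem coc_add (m₁ m₂ : ℤ) (x : InfPath A) (n : ℕ) :
    coc B (m₁ + m₂) x n = coc B m₁ (x.act B m₂) n + coc B m₂ x n := by
  induction n with
  | zero => rfl
  | succ n ih =>
    rw [coc, ih, Edge.coc_add]
    rfl

theorem act_add (m₁ m₂ : ℤ) (x : InfPath A) : x.act B (m₁ + m₂) = (x.act B m₂).act B m₁ :=
  Subtype.ext (funext fun n => by
    change (x.1 n).act B (coc B (m₁ + m₂) x n) = _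
    rw [coc_add, Edge.act_add]
    rfl)

theorem coc_coc (m : ℤ) (x : InfPath A) (n k : ℕ) :
    coc B (coc B m x n) (x.drop n) k = coc B m x (n + k) := by
  induction k with
  | zero => rfl
  | succ k ih =>
    rw [coc, ih]
    rfl

theorem drop_act (m : ℤ) (x : InfPath A) (n : ℕ) :
    (x.act B m).drop n = (x.drop n).act B (coc B m x n) :=
  Subtype.ext (funext fun k => by
    change (x.1 (n + k)).act B _ = (x.1 (n + k)).act B _
    rw [coc_coc])

end InfPath

/-- The cylinder set `Z(α)` of the infinite paths with initial segment `α`. -/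
def cyl (α : FinPath A) : Set (InfPath A) := {x | x.take α.len = α}

end Paths

section KatsuraExelPardo

universe u

variable {V : Type u} {A : Matrix V V ℤ} (B : Matrix V V ℤ)

theorem FinPath.r_snoc (α : FinPath A) (e : Edge A) (h : α.r = e.s) : (α.snoc e h).r = e.r := by
  rw [FinPath.r_of_pos (by simp [FinPath.snoc])]
  simp [FinPath.snoc]

theorem FinPath.len_snoc (α : FinPath A) (e : Edge A) (h : α.r = e.s) :
    (α.snoc e h).len = α.len + 1 := by simp [FinPath.snoc, FinPath.len]

theorem FinPath.snoc_congr {α α' : FinPath A} {e e' : Edge A} (h : α.r = e.s) (h' : α'.r = e'.s)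
    (hα : α = α') (he : e = e') : α.snoc e h = α'.snoc e' h' := by
  subst hα
  subst he
  rfl

theorem FinPath.snoc_inj {α α' : FinPath A} {e e' : Edge A} {h : α.r = e.s} {h' : α'.r = e'.s}
    (hh : α.snoc e h = α'.snoc e' h') : α = α' ∧ e = e' := by
  have h1 : α.edges ++ [e] = α'.edges ++ [e'] := congrArg FinPath.edges hh
  have h2 := List.append_inj' h1 rfl
  refine ⟨FinPath.ext (congrArg FinPath.s hh :) h2.1, ?_⟩
  simpa using h2.2

variable (A) in
/-- The quadruples `(α, m, β; x)` with `r(α) = r(β)` and `x ∈ Z(β)`. -/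
@[ext] structure Quad where
  α : FinPath A
  m : ℤ
  β : FinPath A
  x : InfPath A
  hr : α.r = β.r
  hx : x ∈ cyl β

namespace Quad

variable {B}

/-- The infinite path `y` with `x = βy`. -/
def tail (q : Quad A) : InfPath A := q.x.drop q.β.len

theorem r_β (q : Quad A) : q.β.r = (q.x.1 q.β.len).s := by
  have h := q.x.r_take q.β.len
  rwa [show q.x.take q.β.len = q.β from q.hx] at h

variable (B)

/-- The infinite path `α κ_m(y)`, where `x = βy`. -/
def rng (q : Quad A) : InfPath A := q.α.append (q.tail.act B q.m) (q.hr.trans q.r_β)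

/-- The quadruple `(α κ_m(γ), φ(m, γ), βγ; x)`, where `x = βγy` with an edge `γ`. -/
def next (q : Quad A) : Quad A where
  α := q.α.snoc ((q.x.1 q.β.len).act B q.m) (q.hr.trans q.r_β)
  m := (q.x.1 q.β.len).coc B q.m
  β := q.β.snoc (q.x.1 q.β.len) q.r_β
  x := q.x
  hr := by
    rw [FinPath.r_snoc, FinPath.r_snoc]
    rfl
  hx := by
    change q.x.take _ = _
    rw [FinPath.len_snoc, InfPath.take_succ]
    exact FinPath.snoc_congr _ _ q.hx rfl

theorem r_α (q : Quad A) : q.α.r = ((q.x.1 q.β.len).act B q.m).s := q.hr.trans q.r_β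

/-- The quadruple with range `u`, source `x`, and initial segments of lengths `a` and `b`. -/
def ofPaths (u x : InfPath A) (a b : ℕ) (m : ℤ) (h : u.drop a = (x.drop b).act B m) : Quad A where
  α := u.take a
  m := m
  β := x.take b
  x := x
  hr := by
    rw [InfPath.r_take, InfPath.r_take]
    exact congrArg (fun z : InfPath A => (z.1 0).s) h
  hx := by
    change x.take _ = _
    rw [InfPath.len_take]

theorem rng_ofPaths (u x : InfPath A) (a b : ℕ) (m : ℤ) (h) : (ofPaths B u x a b m h).rng B = u := by
  have h1 : (ofPaths B u x a b m h).tail = x.drop b := by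
    change x.drop (x.take b).len = _
    rw [InfPath.len_take]
  have h2 : ∀ (y : InfPath A) (hy : y = u.drop a) (h3), (u.take a).append y h3 = u := by
    rintro y rfl h3
    exact InfPath.append_take_drop u a h3
  refine h2 _ ?_ _
  rw [h1, h]
  rfl

theorem exists_ofPaths (q : Quad A) : ∃ h, q = ofPaths B (q.rng B) q.x q.α.len q.β.len q.m h := by
  refine ⟨InfPath.drop_append _ _ _, ?_⟩
  ext1
  · exact (InfPath.take_append _ _ _).symm
  · rfl
  · exact q.hx.symm
  · rfl

theorem ofPaths_step {u x : InfPath A} {a b : ℕ} {m : ℤ} (h : u.drop a = (x.drop b).act B m) :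
    u.drop (a + 1) = (x.drop (b + 1)).act B ((x.1 b).coc B m) := by
  rw [← InfPath.drop_drop, h, InfPath.drop_act, InfPath.drop_drop]
  rfl

theorem next_ofPaths (u x : InfPath A) (a b : ℕ) (m : ℤ) (h) :
    (ofPaths B u x a b m h).next B
      = ofPaths B u x (a + 1) (b + 1) ((x.1 b).coc B m) (ofPaths_step B h) := by
  have hb : x.1 (x.take b).len = x.1 b := by rw [InfPath.len_take]
  have hu : u.1 a = (x.1 b).act B m := congrArg (fun z : InfPath A => z.1 0) h
  ext1
  · refine Eq.trans (FinPath.snoc_congr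
      ((ofPaths B u x a b m h).r_α B) (u.r_take a) rfl ?_) (u.take_succ a).symm
    rw [hu]
    exact congrArg (Edge.act B m) hb
  · exact congrArg (Edge.coc B m) hb
  · exact Eq.trans (FinPath.snoc_congr (ofPaths B u x a b m h).r_β (x.r_take b) rfl hb) (x.take_succ b).symm
  · rfl

theorem rng_next (q : Quad A) : (q.next B).rng B = q.rng B := by
  obtain ⟨h, hq⟩ := q.exists_ofPaths B
  generalize q.rng B = u at *
  rw [hq, next_ofPaths, rng_ofPaths]

/-- The quadruple `(β, -m, α; α κ_m(y))`, where `x = βy`. -/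
def inv (q : Quad A) : Quad A where
  α := q.β
  m := -q.m
  β := q.α
  x := q.rng B
  hr := q.hr.symm
  hx := InfPath.take_append _ _ _

theorem ofPaths_inv {u x : InfPath A} {a b : ℕ} {m : ℤ} (h : u.drop a = (x.drop b).act B m) :
    x.drop b = (u.drop a).act B (-m) := by
  rw [h, ← InfPath.act_add, neg_add_cancel, InfPath.act_zero]

theorem inv_ofPaths (u x : InfPath A) (a b : ℕ) (m : ℤ) (h) :
    (ofPaths B u x a b m h).inv B = ofPaths B x u b a (-m) (ofPaths_inv B h) := by
  ext1
  · rfl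
  · rfl
  · rfl
  · exact rng_ofPaths B u x a b m h

theorem ofPaths_congr {u u' x x' : InfPath A} {a a' b b' : ℕ} {m m' : ℤ} (h h') (hu : u = u')
    (hx : x = x') (ha : a = a') (hb : b = b') (hm : m = m') :
    ofPaths B u x a b m h = ofPaths B u' x' a' b' m' h' := by
  subst hu hx ha hb hm
  rfl

theorem next_inv (q : Quad A) : (q.next B).inv B = (q.inv B).next B := by
  obtain ⟨h, hq⟩ := q.exists_ofPaths B
  generalize q.rng B = u at *
  generalize q.x = x, q.α.len = a, q.β.len = b, q.m = m at *
  subst hq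
  rw [next_ofPaths, inv_ofPaths, inv_ofPaths, next_ofPaths]
  refine ofPaths_congr B _ _ rfl rfl rfl rfl ?_
  have hu : u.1 a = (x.1 b).act B m := congrArg (fun z : InfPath A => z.1 0) h
  have h1 := Edge.coc_add B (-m) m (x.1 b)
  rw [neg_add_cancel, Edge.coc_zero] at h1
  rw [hu]
  omega

theorem inv_inv (q : Quad A) : (q.inv B).inv B = q := by
  obtain ⟨h, hq⟩ := q.exists_ofPaths B
  generalize q.rng B = u at *
  generalize q.x = x, q.α.len = a, q.β.len = b, q.m = m at *
  subst hq
  rw [inv_ofPaths, inv_ofPaths]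
  exact ofPaths_congr B _ _ rfl rfl rfl rfl (neg_neg m)

/-- The product `(α, m', β; β κ_m(x)) (β, m, γ; γx) = (α, m' + m, γ; γx)`. -/
def mul (q q' : Quad A) (h : q.β = q'.α) : Quad A where
  α := q.α
  m := q.m + q'.m
  β := q'.β
  x := q'.x
  hr := q.hr.trans ((congrArg FinPath.r h).trans q'.hr)
  hx := q'.hx

theorem ofPaths_mul {u w x : InfPath A} {a b c : ℕ} {m' m : ℤ}
    (h : u.drop a = (w.drop b).act B m') (h' : w.drop b = (x.drop c).act B m) :
    u.drop a = (x.drop c).act B (m' + m) := by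
  rw [h, h', InfPath.act_add]

theorem mul_ofPaths (u w x : InfPath A) (a b c : ℕ) (m' m : ℤ) (h h') :
    (ofPaths B u w a b m' h).mul (ofPaths B w x b c m h') rfl
      = ofPaths B u x a c (m' + m) (ofPaths_mul B h h') := rfl

theorem mul_next (q q' : Quad A) (h : q.β = q'.α) (hx : q.x = q'.rng B) :
    ∃ h', (q.next B).mul (q'.next B) h' = (q.mul q' h).next B := by
  have hu : q.x.1 q.β.len = (q'.x.1 q'.β.len).act B q'.m := by
    have h1 := congrArg (fun z : InfPath A => z.1 0)
      (InfPath.drop_append q'.α (q'.tail.act B q'.m) (q'.hr.trans q'.r_β))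
    rw [h, hx]
    exact h1
  refine ⟨FinPath.snoc_congr q.r_β (q'.r_α B) h hu, ?_⟩
  have h1 := Edge.coc_add B q.m q'.m (q'.x.1 q'.β.len)
  ext1
  · refine FinPath.snoc_congr (q.r_α B) ((q.mul q' h).r_α B) rfl ?_
    rw [hu]
    exact (Edge.act_add B q.m q'.m _).symm
  · change (q.x.1 q.β.len).coc B q.m + _ = _
    rw [hu]
    exact h1.symm
  · rfl
  · rfl

theorem lenα_next (q : Quad A) : (q.next B).α.len = q.α.len + 1 :=
  FinPath.len_snoc _ _ (q.r_α B)

theorem lenβ_next (q : Quad A) : (q.next B).β.len = q.β.len + 1 := FinPath.len_snoc _ _ q.r_β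

theorem x_iterate (q : Quad A) (n : ℕ) : ((Quad.next B)^[n] q).x = q.x := by
  induction n with
  | zero => rfl
  | succ n ih =>
    rw [Function.iterate_succ_apply']
    exact ih

theorem rng_iterate (q : Quad A) (n : ℕ) : ((Quad.next B)^[n] q).rng B = q.rng B := by
  induction n with
  | zero => rfl
  | succ n ih => rw [Function.iterate_succ_apply', rng_next, ih]

theorem lenα_iterate (q : Quad A) (n : ℕ) : ((Quad.next B)^[n] q).α.len = q.α.len + n := by
  induction n with
  | zero => rfl
  | succ n ih => rw [Function.iterate_succ_apply', lenα_next, ih, add_assoc]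

theorem lenβ_iterate (q : Quad A) (n : ℕ) : ((Quad.next B)^[n] q).β.len = q.β.len + n := by
  induction n with
  | zero => rfl
  | succ n ih => rw [Function.iterate_succ_apply', lenβ_next, ih, add_assoc]

theorem mul_iterate (q q' : Quad A) (h : q.β = q'.α) (hx : q.x = q'.rng B) (n : ℕ) :
    ∃ h', ((Quad.next B)^[n] q).mul ((Quad.next B)^[n] q') h' = (Quad.next B)^[n] (q.mul q' h) := by
  induction n with
  | zero => exact ⟨h, rfl⟩
  | succ n ih =>
    obtain ⟨h1, h2⟩ := ih
    obtain ⟨h3, h4⟩ := mul_next B _ _ h1 (by rw [x_iterate, rng_iterate, hx])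
    rw [h2] at h4
    simp only [Function.iterate_succ_apply']
    exact ⟨h3, h4⟩

end Quad

variable (A) in
/-- The arrows of the Katsura-Exel-Pardo groupoid: the quotient of the quadruples by the equivalence
relation generated by `(α, m, β; x) ∼ (α κ_m(γ), φ(m, γ), βγ; x)`, `x = βγy`. -/
def KArrow : Type u := Quot fun q q' : Quad A => q' = q.next B

namespace KArrow

variable {B}

variable (B) in
/-- The class `[α, m, β; x]`. -/
def mk (q : Quad A) : KArrow A B := Quot.mk _ q

theorem mk_next (q : Quad A) : mk B (q.next B) = mk B q :=
  (Quot.sound (r := fun q q' : Quad A => q' = q.next B) rfl).symm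

theorem mk_iterate (q : Quad A) (n : ℕ) : mk B ((Quad.next B)^[n] q) = mk B q := by
  induction n with
  | zero => rfl
  | succ n ih => rw [Function.iterate_succ_apply', mk_next, ih]

theorem exists_mk (g : KArrow A B) : ∃ q, mk B q = g := Quot.exists_rep g

theorem mk_eq_mk {q q' : Quad A} (h : mk B q = mk B q') :
    ∃ i j, (Quad.next B)^[i] q = (Quad.next B)^[j] q' := by
  have h1 := Quot.eqvGen_exact h
  induction h1 with
  | rel x y hxy => exact ⟨1, 0, hxy.symm⟩
  | refl x => exact ⟨0, 0, rfl⟩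
  | symm x y _ ih =>
    obtain ⟨i, j, hij⟩ := ih (Quot.eqvGen_sound (by assumption))
    exact ⟨j, i, hij.symm⟩
  | trans x y z h1 h2 ih1 ih2 =>
    obtain ⟨i, j, hij⟩ := ih1 (Quot.eqvGen_sound h1)
    obtain ⟨k, l, hkl⟩ := ih2 (Quot.eqvGen_sound h2)
    refine ⟨k + i, j + l, ?_⟩
    rw [Function.iterate_add_apply, hij, Function.iterate_add_apply, ← hkl,
      ← Function.iterate_add_apply, ← Function.iterate_add_apply, add_comm]

theorem mk_eq_mk_of {q q' : Quad A} (i j : ℕ) (h : (Quad.next B)^[i] q = (Quad.next B)^[j] q') :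
    mk B q = mk B q' := by
  rw [← mk_iterate q i, h, mk_iterate]

/-- `s([α, m, β; x]) = x`. -/
def src : KArrow A B → InfPath A := Quot.lift Quad.x (by rintro q _ rfl; rfl)

/-- `r([α, m, β; βy]) = α κ_m(y)`. -/
def rng : KArrow A B → InfPath A :=
  Quot.lift (Quad.rng B) (by rintro q _ rfl; exact (q.rng_next B).symm)

/-- `[α, m, β; βy]⁻¹ = [β, -m, α; α κ_m(y)]`. -/
def inv : KArrow A B → KArrow A B :=
  Quot.lift (fun q => mk B (q.inv B)) (by
    rintro q _ rfl
    rw [Quad.next_inv, mk_next])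

/-- `ρ([α, m, β; x]) = |α| - |β|`. -/
def lag : KArrow A B → ℤ :=
  Quot.lift (fun q => (q.α.len : ℤ) - q.β.len) (by
    rintro q _ rfl
    rw [Quad.lenα_next, Quad.lenβ_next]
    push_cast
    ring)

variable (B) in
/-- The unit `[v, 0, v; x]`, where `v` is the source of `x`. -/
def one (x : InfPath A) : KArrow A B := mk B
  { α := x.take 0
    m := 0
    β := x.take 0
    x := x
    hr := rfl
    hx := rfl }

theorem one_eq (x : InfPath A) (n : ℕ) (h) : one B x = mk B (Quad.ofPaths B x x n n 0 h) := by
  induction n with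
  | zero => rfl
  | succ n ih =>
    have h0 : x.drop n = (x.drop n).act B 0 := (InfPath.act_zero B _).symm
    rw [ih h0, ← mk_next, Quad.next_ofPaths]
    exact congrArg _ (Quad.ofPaths_congr B _ _ rfl rfl rfl rfl (Edge.coc_zero B _))

theorem exists_reps (g h : KArrow A B) (p : g.src = h.rng) :
    ∃ q q' : Quad A, mk B q = g ∧ mk B q' = h ∧ q.β = q'.α := by
  obtain ⟨q, rfl⟩ := exists_mk g
  obtain ⟨q', rfl⟩ := exists_mk h
  have p : q.x = q'.rng B := p
  refine ⟨(Quad.next B)^[q'.α.len] q, (Quad.next B)^[q.β.len] q', mk_iterate _ _, mk_iterate _ _, ?_⟩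
  have h1 := ((Quad.next B)^[q'.α.len] q).hx
  have h2 := (((Quad.next B)^[q.β.len] q').inv B).hx
  change InfPath.take _ _ = _ at h1
  change InfPath.take (((Quad.next B)^[q.β.len] q').rng B) ((Quad.next B)^[q.β.len] q').α.len
    = ((Quad.next B)^[q.β.len] q').α at h2
  rw [← h1, ← h2, Quad.x_iterate, Quad.rng_iterate, Quad.lenα_iterate, Quad.lenβ_iterate, p,
    add_comm]

/-- The product, given by `[α, m', β; β κ_m(x)] [β, m, γ; γx] = [α, m' + m, γ; γx]`; it does not
depend on the representatives, see `mul_mk`. -/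
def mul (g h : KArrow A B) (p : g.src = h.rng) : KArrow A B :=
  mk B ((exists_reps g h p).choose.mul (exists_reps g h p).choose_spec.choose
    (exists_reps g h p).choose_spec.choose_spec.2.2)

theorem mul_mk (q q' : Quad A) (p : (mk B q).src = (mk B q').rng) (h : q.β = q'.α) :
    mul (mk B q) (mk B q') p = mk B (q.mul q' h) := by
  obtain ⟨h1, h2, h3⟩ := (exists_reps (mk B q) (mk B q') p).choose_spec.choose_spec
  change mk B (Quad.mul _ _ h3) = _
  generalize (exists_reps (mk B q) (mk B q') p).choose_spec.choose = q₁' at *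
  generalize (exists_reps (mk B q) (mk B q') p).choose = q₁ at *
  obtain ⟨i, j, hij⟩ := mk_eq_mk h1
  obtain ⟨k, l, hkl⟩ := mk_eq_mk h2
  have p1 : q₁.x = q₁'.rng B := by
    have e1 : q₁.x = q.x := congrArg src h1
    have e2 : q₁'.rng B = q'.rng B := congrArg rng h2
    rw [e1, e2]
    exact p
  obtain ⟨h4, h5⟩ := Quad.mul_iterate B q₁ q₁' h3 p1 (k + i)
  obtain ⟨h6, h7⟩ := Quad.mul_iterate B q q' h p (k + j)
  have l1 := congrArg (fun q : Quad A => q.β.len) hij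
  have l2 := congrArg (fun q : Quad A => q.α.len) hkl
  simp only [Quad.lenα_iterate, Quad.lenβ_iterate] at l1 l2
  rw [h3, h] at l1
  have e1 : (Quad.next B)^[k + i] q₁ = (Quad.next B)^[k + j] q := by
    rw [Function.iterate_add_apply, hij, ← Function.iterate_add_apply]
  have e2 : (Quad.next B)^[k + i] q₁' = (Quad.next B)^[k + j] q' := by
    rw [add_comm k i, Function.iterate_add_apply, hkl, ← Function.iterate_add_apply,
      show i + l = k + j by omega]
  refine mk_eq_mk_of (k + i) (k + j) ?_
  rw [← h5, ← h7]
  congr 1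

theorem exists_ofPaths (g : KArrow A B) : ∃ a b m, ∃ h : g.rng.drop a = (g.src.drop b).act B m,
    mk B (Quad.ofPaths B g.rng g.src a b m h) = g := by
  obtain ⟨q, rfl⟩ := exists_mk g
  obtain ⟨h, hq⟩ := q.exists_ofPaths B
  exact ⟨q.α.len, q.β.len, q.m, h, congrArg (mk B) hq.symm⟩

end KArrow

section Topology

theorem InfPath.eventually_eq (x : InfPath A) (n : ℕ) :
    ∀ᶠ y : InfPath A in 𝓝 x, ∀ i < n, y.1 i = x.1 i := by
  refine (Filter.eventually_all_finite (Set.finite_lt_nat n)).2 fun i _ => ?_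
  exact ((continuous_apply i).comp continuous_subtype_val).continuousAt
    ((isOpen_discrete {x.1 i}).mem_nhds rfl)

theorem InfPath.eventually_take (x : InfPath A) (n : ℕ) :
    ∀ᶠ y : InfPath A in 𝓝 x, y.take n = x.take n := by
  filter_upwards [x.eventually_eq (n + 1)] with y hy
  exact InfPath.take_eq_take_iff.2 ⟨congrArg Edge.s (hy 0 (by omega)),
    fun i hi => hy i (by omega)⟩

theorem isOpen_cyl (α : FinPath A) : IsOpen (cyl α) := by
  rw [isOpen_iff_mem_nhds]
  intro x hx
  filter_upwards [x.eventually_take α.len] with y hy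
  exact hy.trans hx

theorem isClosed_cyl (α : FinPath A) : IsClosed (cyl α) := by
  rw [← isOpen_compl_iff, isOpen_iff_mem_nhds]
  intro x hx
  filter_upwards [x.eventually_take α.len] with y hy hy'
  exact hx (hy.symm.trans hy')

theorem InfPath.exists_cyl_subset {x : InfPath A} {U : Set (InfPath A)} (hU : U ∈ 𝓝 x) :
    ∃ n, ∀ k, n ≤ k → cyl (x.take k) ⊆ U := by
  obtain ⟨W, hW, hWU⟩ :=
    (mem_nhds_subtype {x : ℕ → Edge A | ∀ n, (x n).r = (x (n + 1)).s} x U).1 hU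
  obtain ⟨O, hOW, hO, hxO⟩ := mem_nhds_iff.1 hW
  obtain ⟨C, ⟨z, n, rfl⟩, hxC, hCO⟩ :=
    (PiNat.isTopologicalBasis_cylinders (fun _ : ℕ => Edge A)).exists_subset_of_mem_open hxO hO
  refine ⟨n, fun k hk y hy => hWU (hOW (hCO ?_))⟩
  have hy : y.take (x.take k).len = x.take k := hy
  rw [InfPath.len_take] at hy
  have h1 := (InfPath.take_eq_take_iff.1 hy).2
  rw [PiNat.mem_cylinder_iff] at hxC ⊢
  intro i hi
  rw [← hxC i hi]
  exact h1 i (by omega)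

theorem Edge.finite_source (hA : RowFinite A) (v : V) : {e : Edge A | e.s = v}.Finite := by
  have h1 : (⋃ j ∈ {j | A v j ≠ 0}, ({j} : Set V) ×ˢ Set.Ico (0 : ℤ) (A v j)).Finite :=
    (hA v).biUnion fun j _ => (Set.finite_singleton j).prod (Set.finite_Ico _ _)
  refine Set.Finite.of_injOn (f := fun e : Edge A => (e.r, e.idx)) ?_ ?_ h1
  · rintro e rfl
    refine mem_biUnion (show e.r ∈ {j | A e.s j ≠ 0} from e.pos.ne') ⟨rfl, e.nonneg, e.lt⟩
  · rintro e rfl e' h h'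
    exact Edge.ext h.symm (congrArg Prod.fst h') (congrArg Prod.snd h')

theorem InfPath.isCompact_source (hA : RowFinite A) (v : V) :
    IsCompact {x : InfPath A | (x.1 0).s = v} := by
  let F : ℕ → Set (Edge A) := fun n =>
    n.rec {e | e.s = v} (fun _ S => ⋃ e ∈ S, {f | f.s = e.r})
  have hF : ∀ n, (F n).Finite := by
    intro n
    induction n with
    | zero => exact Edge.finite_source hA v
    | succ n ih => exact ih.biUnion fun e _ => Edge.finite_source hA e.r
  have hc : IsCompact (univ.pi F) := isCompact_univ_pi fun n => (hF n).isCompact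
  rw [Topology.IsEmbedding.subtypeVal.isCompact_iff]
  refine hc.of_isClosed_subset ?_ ?_
  · have h1 : (Subtype.val '' {x : InfPath A | (x.1 0).s = v})
        = {x : ℕ → Edge A | (x 0).s = v} ∩ ⋂ n, {x | (x n).r = (x (n + 1)).s} := by
      ext x
      simp only [mem_image, mem_inter_iff, mem_iInter, mem_ofPred_eq]
      constructor
      · rintro ⟨y, hy, rfl⟩
        exact ⟨hy, y.2⟩
      · rintro ⟨hx, hx'⟩
        exact ⟨⟨x, hx'⟩, hx, rfl⟩
    rw [h1]
    have hc0 : ∀ n, Continuous fun x : ℕ → Edge A => x n := fun n => continuous_apply n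
    refine IsClosed.inter ?_ (isClosed_iInter fun n => ?_)
    · exact (isClosed_discrete {e : Edge A | e.s = v}).preimage (hc0 0)
    · exact (isClosed_discrete {e : Edge A × Edge A | e.1.r = e.2.s}).preimage
        ((hc0 n).prodMk (hc0 (n + 1)))
  · rintro _ ⟨x, hx, rfl⟩ n _
    induction n with
    | zero => exact hx
    | succ n ih => exact mem_biUnion (ih trivial) (x.2 n).symm

theorem isCompact_cyl (hA : RowFinite A) (α : FinPath A) : IsCompact (cyl α) := by
  refine (InfPath.isCompact_source hA α.s).of_isClosed_subset (isClosed_cyl α) fun x hx => ?_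
  exact congrArg FinPath.s (show x.take α.len = α from hx)

namespace KArrow

/-- The set `Z(α, m, β; Z(β))` of all `[α, m, β; x]` with `x ∈ Z(β)`. -/
def Z (α : FinPath A) (m : ℤ) (β : FinPath A) : Set (KArrow A B) :=
  {g | ∃ q : Quad A, q.α = α ∧ q.m = m ∧ q.β = β ∧ mk B q = g}

/-- The topology generated by the sets `Z(α, m, β; Z(β))`. -/
instance : TopologicalSpace (KArrow A B) :=
  TopologicalSpace.generateFrom
    {S | ∃ (α : FinPath A) (m : ℤ) (β : FinPath A), α.r = β.r ∧ S = Z B α m β}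

variable {B}

theorem isOpen_Z {α β : FinPath A} (h : α.r = β.r) (m : ℤ) : IsOpen (Z B α m β) :=
  TopologicalSpace.isOpen_generateFrom_of_mem ⟨α, m, β, h, rfl⟩

theorem mk_mem_Z (q : Quad A) : mk B q ∈ Z B q.α q.m q.β := ⟨q, rfl, rfl, rfl, rfl⟩

theorem Z_next (q : Quad A) : Z B (q.next B).α (q.next B).m (q.next B).β ⊆ Z B q.α q.m q.β := by
  rintro _ ⟨p, hα, hm, hβ, rfl⟩
  have h1 : p.x.take p.β.len = p.β := p.hx
  rw [hβ, Quad.lenβ_next, InfPath.take_succ] at h1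
  obtain ⟨h2, h3⟩ := FinPath.snoc_inj (h' := q.r_β) h1
  refine ⟨⟨q.α, q.m, q.β, p.x, q.hr, h2⟩, rfl, rfl, rfl, ?_⟩
  rw [← mk_next]
  refine congrArg (mk B) (Quad.ext ?_ ?_ ?_ rfl)
  · rw [hα]
    exact FinPath.snoc_congr (Quad.r_α B ⟨q.α, q.m, q.β, p.x, q.hr, h2⟩) (q.r_α B) rfl
      (congrArg (Edge.act B q.m) h3)
  · rw [hm]
    exact congrArg (Edge.coc B q.m) h3
  · rw [hβ]
    exact FinPath.snoc_congr (Quad.r_β ⟨q.α, q.m, q.β, p.x, q.hr, h2⟩) q.r_β rfl h3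

theorem Z_iterate (q : Quad A) (n : ℕ) :
    Z B ((Quad.next B)^[n] q).α ((Quad.next B)^[n] q).m ((Quad.next B)^[n] q).β
      ⊆ Z B q.α q.m q.β := by
  induction n with
  | zero => exact subset_rfl
  | succ n ih =>
    rw [Function.iterate_succ_apply']
    exact (Z_next _).trans ih

theorem isBasis : TopologicalSpace.IsTopologicalBasis
    {S | ∃ (α : FinPath A) (m : ℤ) (β : FinPath A), α.r = β.r ∧ S = Z B α m β} where
  exists_subset_inter := by
    rintro _ ⟨α, m, β, h, rfl⟩ _ ⟨α', m', β', h', rfl⟩ _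
      ⟨⟨q, rfl, rfl, rfl, rfl⟩, q', rfl, rfl, rfl, hq⟩
    obtain ⟨i, j, hij⟩ := mk_eq_mk hq
    refine ⟨_, ⟨_, _, _, ((Quad.next B)^[i] q').hr, rfl⟩, ?_,
      subset_inter ?_ (Z_iterate q' i)⟩
    · rw [← hq, ← mk_iterate q' i]
      exact mk_mem_Z _
    · rw [hij]
      exact Z_iterate q j
  sUnion_eq := by
    refine eq_univ_of_forall fun g => ?_
    obtain ⟨q, rfl⟩ := exists_mk g
    exact ⟨_, ⟨_, _, _, q.hr, rfl⟩, mk_mem_Z q⟩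
  eq_generateFrom := rfl

/-- Every neighbourhood of `[q]` contains the basic sets of all sufficiently long representatives. -/
theorem exists_Z_subset {q : Quad A} {N : Set (KArrow A B)} (hN : N ∈ 𝓝 (mk B q)) :
    ∃ n, Z B ((Quad.next B)^[n] q).α ((Quad.next B)^[n] q).m ((Quad.next B)^[n] q).β ⊆ N := by
  obtain ⟨_, ⟨α, m, β, h, rfl⟩, ⟨q', rfl, rfl, rfl, hq⟩, hS⟩ := isBasis.mem_nhds_iff.1 hN
  obtain ⟨i, j, hij⟩ := mk_eq_mk hq
  refine ⟨j, Subset.trans ?_ hS⟩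
  rw [← hij]
  exact Z_iterate q' i

theorem Z_mem_nhds (q : Quad A) : Z B q.α q.m q.β ∈ 𝓝 (mk B q) :=
  (isOpen_Z q.hr q.m).mem_nhds (mk_mem_Z q)

theorem Z_iterate_mem_nhds (q : Quad A) (n : ℕ) :
    Z B ((Quad.next B)^[n] q).α ((Quad.next B)^[n] q).m ((Quad.next B)^[n] q).β ∈ 𝓝 (mk B q) := by
  rw [← mk_iterate q n]
  exact Z_mem_nhds _

theorem src_injOn_Z (α : FinPath A) (m : ℤ) (β : FinPath A) : (Z B α m β).InjOn src := by
  rintro _ ⟨q, rfl, rfl, rfl, rfl⟩ _ ⟨q', hα, hm, hβ, rfl⟩ hx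
  exact congrArg (mk B) (Quad.ext hα.symm hm.symm hβ.symm hx)

theorem src_image_Z {α β : FinPath A} (h : α.r = β.r) (m : ℤ) : src '' Z B α m β = cyl β := by
  ext x
  constructor
  · rintro ⟨_, ⟨q, rfl, rfl, rfl, rfl⟩, rfl⟩
    exact q.hx
  · intro hx
    exact ⟨_, ⟨⟨α, m, β, x, h, hx⟩, rfl, rfl, rfl, rfl⟩, rfl⟩

theorem continuous_src : Continuous (src : KArrow A B → InfPath A) := by
  rw [continuous_iff_continuousAt]
  intro g U hU
  obtain ⟨q, rfl⟩ := exists_mk g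
  have hU : U ∈ 𝓝 q.x := hU
  obtain ⟨n, hn⟩ := InfPath.exists_cyl_subset hU
  refine Filter.mem_map.2 (Filter.mem_of_superset (Z_iterate_mem_nhds q n) ?_)
  rintro _ ⟨p, hα, hm, hβ, rfl⟩
  refine hn (q.β.len + n) (by omega) ?_
  have h1 := p.hx
  have h2 := ((Quad.next B)^[n] q).hx
  change InfPath.take _ _ = _ at h1 h2
  change InfPath.take p.x (q.x.take _).len = _
  rw [InfPath.len_take]
  rw [Quad.x_iterate, Quad.lenβ_iterate] at h2
  rw [hβ, Quad.lenβ_iterate, ← h2] at h1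
  exact h1

theorem isLocalHomeomorph_src : IsLocalHomeomorph (src : KArrow A B → InfPath A) := by
  refine isLocalHomeomorph_of_isOpenMap continuous_src ?_ ?_
  · refine isBasis.isOpenMap_iff.2 ?_
    rintro _ ⟨α, m, β, h, rfl⟩
    rw [src_image_Z h]
    exact isOpen_cyl β
  · intro g
    obtain ⟨q, rfl⟩ := exists_mk g
    exact ⟨_, Z_mem_nhds q, src_injOn_Z _ _ _⟩

theorem isCompact_Z (hA : RowFinite A) {α β : FinPath A} (h : α.r = β.r) (m : ℤ) :
    IsCompact (Z B α m β) := by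
  have h1 : IsOpenEmbedding fun g : Z B α m β => src g.1 :=
    .of_continuous_injective_isOpenMap (continuous_src.comp continuous_subtype_val)
      (fun g g' hg => Subtype.ext (src_injOn_Z α m β g.2 g'.2 hg))
      (isLocalHomeomorph_src.isOpenMap.comp (isOpen_Z h m).isOpenMap_subtype_val)
  rw [isCompact_iff_isCompact_univ, h1.isInducing.isCompact_iff]
  convert isCompact_cyl hA β
  rw [← src_image_Z (B := B) h m]
  ext x
  simp

theorem inv_inv (g : KArrow A B) : g.inv.inv = g := by
  obtain ⟨q, rfl⟩ := exists_mk g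
  exact congrArg (mk B) (q.inv_inv B)

theorem inv_mem_Z {g : KArrow A B} {α β : FinPath A} {m : ℤ} (hg : g ∈ Z B α m β) :
    g.inv ∈ Z B β (-m) α := by
  obtain ⟨q, rfl, rfl, rfl, rfl⟩ := hg
  exact ⟨q.inv B, rfl, rfl, rfl, rfl⟩

theorem continuous_inv : Continuous (inv : KArrow A B → KArrow A B) := by
  refine continuous_generateFrom_iff.2 ?_
  rintro _ ⟨α, m, β, h, rfl⟩
  convert isOpen_Z (B := B) h.symm (-m)
  ext g
  refine ⟨fun hg => ?_, fun hg => ?_⟩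
  · have := inv_mem_Z (show g.inv ∈ _ from hg)
    rwa [inv_inv] at this
  · have := inv_mem_Z hg
    rwa [neg_neg] at this

theorem continuous_one : Continuous (one B : InfPath A → KArrow A B) := by
  rw [continuous_iff_continuousAt]
  intro x N hN
  have h0 : ∀ (y : InfPath A) (n : ℕ), y.drop n = (y.drop n).act B 0 :=
    fun y n => (InfPath.act_zero B _).symm
  rw [one_eq x 0 (h0 x 0)] at hN
  obtain ⟨n, hn⟩ := exists_Z_subset hN
  have h1 : (Quad.next B)^[n] (Quad.ofPaths B x x 0 0 0 (h0 x 0))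
      = Quad.ofPaths B x x n n 0 (h0 x n) := by
    clear hn
    induction n with
    | zero => rfl
    | succ n ih =>
      rw [Function.iterate_succ_apply', ih, Quad.next_ofPaths]
      exact Quad.ofPaths_congr B _ _ rfl rfl rfl rfl (Edge.coc_zero B _)
  rw [h1] at hn
  change ∀ᶠ y in 𝓝 x, one B y ∈ N
  filter_upwards [x.eventually_take n] with y hy
  refine hn ?_
  rw [one_eq y n (h0 y n)]
  exact ⟨Quad.ofPaths B y y n n 0 (h0 y n), hy, rfl, hy, rfl⟩

theorem rng_inv (g : KArrow A B) : g.inv.rng = g.src := by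
  rw [← inv_inv g]
  obtain ⟨q, hq⟩ := exists_mk g.inv
  rw [← hq]
  have h := congrArg Quad.x (q.inv_inv B)
  change rng (mk B ((q.inv B).inv B)) = q.rng B
  rw [q.inv_inv B]
  rfl

theorem src_inv (g : KArrow A B) : g.inv.src = g.rng := by
  obtain ⟨q, rfl⟩ := exists_mk g
  rfl

theorem src_mul (g h : KArrow A B) (p) : (mul g h p).src = h.src := by
  obtain ⟨q, q', rfl, rfl, hh⟩ := exists_reps g h p
  rw [mul_mk q q' p hh]
  rfl

theorem mul_ofPaths (u w x : InfPath A) (a b c : ℕ) (m' m : ℤ) (h h' p) :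
    mul (mk B (Quad.ofPaths B u w a b m' h)) (mk B (Quad.ofPaths B w x b c m h')) p
      = mk B (Quad.ofPaths B u x a c (m' + m) (Quad.ofPaths_mul B h h')) :=
  mul_mk _ _ _ rfl

theorem exists_ofPaths₂ (g h : KArrow A B) (p : g.src = h.rng) : ∃ u w x a b c m' m, ∃ h₁ h₂,
    mk B (Quad.ofPaths B u w a b m' h₁) = g ∧ mk B (Quad.ofPaths B w x b c m h₂) = h := by
  obtain ⟨q, q', rfl, rfl, hh⟩ := exists_reps g h p
  have p : q.x = q'.rng B := p
  obtain ⟨h₁, e₁⟩ := q.exists_ofPaths B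
  obtain ⟨h₂, e₂⟩ := q'.exists_ofPaths B
  have hl : q'.α.len = q.β.len := by rw [hh]
  refine ⟨q.rng B, q.x, q'.x, q.α.len, q.β.len, q'.β.len, q.m, q'.m, h₁, ?_, ?_, ?_⟩
  · rw [p, ← hl]
    exact h₂
  · exact congrArg (mk B) e₁.symm
  · refine congrArg (mk B) (Eq.trans ?_ e₂.symm)
    exact Quad.ofPaths_congr B _ _ p rfl hl.symm rfl rfl

theorem iterate_ofPaths (u x : InfPath A) (a b : ℕ) (m : ℤ) (h) (n : ℕ) : ∃ h',
    (Quad.next B)^[n] (Quad.ofPaths B u x a b m h)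
      = Quad.ofPaths B u x (a + n) (b + n) (InfPath.coc B m (x.drop b) n) h' := by
  induction n with
  | zero => exact ⟨h, rfl⟩
  | succ n ih =>
    obtain ⟨h', ih⟩ := ih
    rw [Function.iterate_succ_apply', ih, Quad.next_ofPaths]
    exact ⟨_, rfl⟩

theorem rng_mul (g h : KArrow A B) (p) : (mul g h p).rng = g.rng := by
  obtain ⟨u, w, x, a, b, c, m', m, h₁, h₂, rfl, rfl⟩ := exists_ofPaths₂ g h p
  rw [mul_ofPaths]
  exact (Quad.rng_ofPaths B _ _ _ _ _ _).trans (Quad.rng_ofPaths B _ _ _ _ _ _).symm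

theorem lag_mul (g h : KArrow A B) (p) : (mul g h p).lag = g.lag + h.lag := by
  obtain ⟨q, q', rfl, rfl, hh⟩ := exists_reps g h p
  rw [mul_mk q q' p hh]
  change (q.α.len : ℤ) - q'.β.len = ((q.α.len : ℤ) - q.β.len) + (q'.α.len - q'.β.len)
  rw [hh]
  ring

theorem exists_ofPaths₃ (g h k : KArrow A B) (p : g.src = h.rng) (p' : h.src = k.rng) :
    ∃ u w x y a b c d m₁ m₂ m₃, ∃ h₁ h₂ h₃,
      mk B (Quad.ofPaths B u w a b m₁ h₁) = g ∧ mk B (Quad.ofPaths B w x b c m₂ h₂) = h ∧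
      mk B (Quad.ofPaths B x y c d m₃ h₃) = k := by
  obtain ⟨u, w, x, a, b, c, m', m, h₁, h₂, rfl, rfl⟩ := exists_ofPaths₂ g h p
  obtain ⟨c', d, m₃, h₃, hk⟩ := exists_ofPaths k
  have p' : x = k.rng := p'
  generalize k.src = y at *
  generalize k.rng = z at *
  subst hk p'
  obtain ⟨i₁, e₁⟩ := iterate_ofPaths u w a b m' h₁ c'
  obtain ⟨i₂, e₂⟩ := iterate_ofPaths w x b c m h₂ c'
  obtain ⟨i₃, e₃⟩ := iterate_ofPaths x y c' d m₃ h₃ c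
  rw [add_comm c' c] at i₃
  refine ⟨u, w, x, y, a + c', b + c', c + c', d + c, _, _, _, i₁, i₂, i₃, ?_, ?_, ?_⟩
  · rw [← e₁, mk_iterate]
  · rw [← e₂, mk_iterate]
  · rw [← mk_iterate (Quad.ofPaths B x y c' d m₃ h₃) c, e₃]
    exact congrArg (mk B) (Quad.ofPaths_congr B _ _ rfl rfl (add_comm c c') rfl rfl)

theorem mul_assoc (g h k : KArrow A B) (p : g.src = h.rng) (p' : h.src = k.rng) :
    mul (mul g h p) k ((src_mul g h p).trans p') = mul g (mul h k p') (p.trans (rng_mul h k p').symm)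
    := by
  obtain ⟨u, w, x, y, a, b, c, d, m₁, m₂, m₃, h₁, h₂, h₃, rfl, rfl, rfl⟩ :=
    exists_ofPaths₃ g h k p p'
  simp only [mul_ofPaths]
  exact congrArg (mk B) (Quad.ofPaths_congr B _ _ rfl rfl rfl rfl (add_assoc _ _ _))

theorem src_one (x : InfPath A) : (one B x).src = x := rfl

theorem rng_one (x : InfPath A) : (one B x).rng = x := by
  rw [one_eq x 0 (InfPath.act_zero B _).symm]
  exact Quad.rng_ofPaths B _ _ _ _ _ _

theorem mul_congr {g g' h h' : KArrow A B} (hg : g = g') (hh : h = h') (p : g.src = h.rng)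
    (p' : g'.src = h'.rng) : mul g h p = mul g' h' p' := by
  subst hg hh
  rfl

theorem mul_eq {g h k : KArrow A B} (p) {u w x : InfPath A} {a b c : ℕ} {m' m n : ℤ} {h₁ h₂ h₃}
    (hg : mk B (Quad.ofPaths B u w a b m' h₁) = g) (hh : mk B (Quad.ofPaths B w x b c m h₂) = h)
    (hk : mk B (Quad.ofPaths B u x a c n h₃) = k) (hn : m' + m = n) : mul g h p = k := by
  subst hg hh hk hn
  exact mul_ofPaths u w x a b c m' m h₁ h₂ p

theorem one_eq' (x : InfPath A) (n : ℕ) :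
    mk B (Quad.ofPaths B x x n n 0 (InfPath.act_zero B _).symm) = one B x := (one_eq x n _).symm

theorem exists_ofPaths_inv (g : KArrow A B) : ∃ a b m,
    ∃ h : g.rng.drop a = (g.src.drop b).act B m, ∃ h' : g.src.drop b = (g.rng.drop a).act B (-m),
      mk B (Quad.ofPaths B g.rng g.src a b m h) = g ∧
      mk B (Quad.ofPaths B g.src g.rng b a (-m) h') = g.inv := by
  obtain ⟨a, b, m, h, hg⟩ := exists_ofPaths g
  refine ⟨a, b, m, h, Quad.ofPaths_inv B h, hg, ?_⟩
  rw [← Quad.inv_ofPaths]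
  exact congrArg inv hg

theorem one_mul (g : KArrow A B) (p) : mul (one B g.rng) g p = g := by
  obtain ⟨a, b, m, h, hg⟩ := exists_ofPaths g
  exact mul_eq p (one_eq' g.rng a) hg hg (zero_add m)

theorem mul_one (g : KArrow A B) (p) : mul g (one B g.src) p = g := by
  obtain ⟨a, b, m, h, hg⟩ := exists_ofPaths g
  exact mul_eq p hg (one_eq' g.src b) hg (add_zero m)

theorem inv_mul (g : KArrow A B) (p) : mul g.inv g p = one B g.src := by
  obtain ⟨a, b, m, h, h', hg, hi⟩ := exists_ofPaths_inv g
  exact mul_eq p hi hg (one_eq' g.src b) (neg_add_cancel m)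

theorem mul_inv (g : KArrow A B) (p) : mul g g.inv p = one B g.rng := by
  obtain ⟨a, b, m, h, h', hg, hi⟩ := exists_ofPaths_inv g
  exact mul_eq p hg hi (one_eq' g.rng a) (add_neg_cancel m)

theorem continuous_mul :
    Continuous fun p : {p : KArrow A B × KArrow A B // p.1.src = p.2.rng} =>
      mul p.1.1 p.1.2 p.2 := by
  rw [continuous_iff_continuousAt]
  rintro ⟨⟨g, h⟩, p⟩ N hN
  obtain ⟨q, q', rfl, rfl, hh⟩ := exists_reps g h p
  have hN : N ∈ 𝓝 (mul (mk B q) (mk B q') p) := hN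
  rw [mul_mk q q' p hh] at hN
  obtain ⟨n, hn⟩ := exists_Z_subset hN
  obtain ⟨h₁, h₂⟩ := Quad.mul_iterate B q q' hh p n
  rw [← h₂] at hn
  have h3 := prod_mem_nhds (Z_iterate_mem_nhds (B := B) q n) (Z_iterate_mem_nhds (B := B) q' n)
  refine Filter.mem_map.2 (Filter.mem_of_superset (continuous_subtype_val.continuousAt h3) ?_)
  rintro ⟨⟨g, h⟩, p⟩ ⟨⟨r, hα, hm, hβ, hg⟩, r', hα', hm', hβ', hg'⟩
  have hg : mk B r = g := hg
  have hg' : mk B r' = h := hg'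
  subst hg hg'
  refine hn ?_
  change mul (mk B r) (mk B r') p ∈ _
  rw [mul_mk r r' p (by rw [hβ, h₁, hα'])]
  refine ⟨r.mul r' (by rw [hβ, h₁, hα']), hα, ?_, hβ', rfl⟩
  exact congrArg₂ (· + ·) hm hm'

theorem continuous_lag : Continuous (lag : KArrow A B → ℤ) := by
  rw [← IsLocallyConstant.iff_continuous, IsLocallyConstant.iff_eventually_eq]
  intro g
  obtain ⟨q, rfl⟩ := exists_mk g
  filter_upwards [Z_mem_nhds (B := B) q]
  rintro _ ⟨p, hα, hm, hβ, rfl⟩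
  change (p.α.len : ℤ) - p.β.len = (q.α.len : ℤ) - q.β.len
  rw [hα, hβ]

theorem next_injective (hp : PseudoFree A B) : Function.Injective (Quad.next B (A := A)) := by
  intro q q' h
  obtain ⟨h1, h2⟩ := FinPath.snoc_inj (h := q.r_α B) (h' := q'.r_α B) (congrArg Quad.α h)
  obtain ⟨h3, h4⟩ := FinPath.snoc_inj (h := q.r_β) (h' := q'.r_β) (congrArg Quad.β h)
  have h5 : (q.x.1 q.β.len).coc B q.m = (q'.x.1 q'.β.len).coc B q'.m := congrArg Quad.m h
  rw [← h4] at h2 h5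
  exact Quad.ext h1 (hp.eq h2 h5) h3 (congrArg Quad.x h :)

theorem t2Space (hp : PseudoFree A B) : T2Space (KArrow A B) := by
  refine ⟨fun g h hgh => ?_⟩
  by_cases hs : g.src = h.src
  · obtain ⟨q₀, rfl⟩ := exists_mk g
    obtain ⟨q₀', rfl⟩ := exists_mk h
    have hs : q₀.x = q₀'.x := hs
    obtain ⟨q, q', e, e', hx, hβ⟩ : ∃ q q' : Quad A, mk B q = mk B q₀ ∧ mk B q' = mk B q₀' ∧
        q.x = q'.x ∧ q.β = q'.β := by
      refine ⟨(Quad.next B)^[q₀'.β.len] q₀, (Quad.next B)^[q₀.β.len] q₀', mk_iterate _ _,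
        mk_iterate _ _, by rw [Quad.x_iterate, Quad.x_iterate, hs], ?_⟩
      have h1 := ((Quad.next B)^[q₀'.β.len] q₀).hx
      have h2 := ((Quad.next B)^[q₀.β.len] q₀').hx
      change InfPath.take _ _ = _ at h1 h2
      rw [← h1, ← h2, Quad.x_iterate, Quad.x_iterate, Quad.lenβ_iterate, Quad.lenβ_iterate, hs,
        add_comm]
    rw [← e, ← e'] at hgh ⊢
    refine ⟨_, _, isOpen_Z q.hr q.m, isOpen_Z q'.hr q'.m, mk_mem_Z q, mk_mem_Z q',
      Set.disjoint_left.2 ?_⟩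
    rintro _ ⟨r, hα, hm, hrβ, rfl⟩ ⟨r', hα', hm', hrβ', hr⟩
    obtain ⟨i, j, hij⟩ := mk_eq_mk hr
    have hl := congrArg (fun q : Quad A => q.β.len) hij
    simp only [Quad.lenβ_iterate] at hl
    rw [hrβ, hrβ', hβ] at hl
    have hl : i = j := by omega
    subst hl
    have hrr := (next_injective hp).iterate i hij
    subst hrr
    exact hgh (congrArg (mk B) (Quad.ext (hα.symm.trans hα') (hm.symm.trans hm') hβ hx))
  · obtain ⟨U, W, hU, hW, hgU, hhW, hUW⟩ := t2_separation hs
    exact ⟨_, _, hU.preimage continuous_src, hW.preimage continuous_src, hgU, hhW,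
      hUW.preimage src⟩

end KArrow

open KArrow

variable {B}

/-- The Katsura-Exel-Pardo groupoid `𝒢_{A,B}` of a pseudo free pair, with unit space the space of
infinite paths. -/
def katsura (hp : PseudoFree A B) : EtaleGroupoid (KArrow A B) (InfPath A) where
  src := src
  rng := rng
  one := one B
  inv := inv
  mul := mul
  src_one := src_one
  rng_one := rng_one
  src_inv := src_inv
  rng_inv := rng_inv
  src_mul := src_mul
  rng_mul := rng_mul
  mul_assoc := mul_assoc
  one_mul g := one_mul g _
  mul_one g := mul_one g _
  inv_mul g := inv_mul g _
  mul_inv g := mul_inv g _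
  t2_arrows := t2Space hp
  t2_units := inferInstance
  continuous_one := continuous_one
  continuous_inv := continuous_inv
  continuous_mul := continuous_mul
  isLocalHomeomorph_src := isLocalHomeomorph_src

/-- The homomorphism `ρ : 𝒢_{A,B} → ℤ`, `ρ([α, m, β; x]) = |α| - |β|`. -/
def rho (hp : PseudoFree A B) : Cocycle (katsura hp) where
  toFun := lag
  map_mul := lag_mul
  continuous_toFun := continuous_lag

/-- The groupoid `ℋ_{A,B} = ker ρ`. -/
abbrev ℋ (hp : PseudoFree A B) :
    EtaleGroupoid {g : KArrow A B // (rho hp).toFun g = 0} (InfPath A) := kernel (rho hp)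

/-- The class `[1_{Z(α)}]` in `H_0(ℋ_{A,B})`. -/
def pathClass (hA : RowFinite A) (hp : PseudoFree A B) (α : FinPath A) : (ℋ hp).H₀ :=
  (ℋ hp).cls₀ (ind (cyl α) (isCompact_cyl hA α) (isOpen_cyl α))

/-- The set `Z(α, m, α; Z(α))` as a subset of `ℋ_{A,B}`. -/
def loopSet (hp : PseudoFree A B) (α : FinPath A) (m : ℤ) :
    Set {g : KArrow A B // (rho hp).toFun g = 0} := Subtype.val ⁻¹' Z B α m α

theorem isOpen_loopSet (hp : PseudoFree A B) (α : FinPath A) (m : ℤ) :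
    IsOpen (loopSet hp α m) := (isOpen_Z rfl m).preimage continuous_subtype_val

theorem val_image_loopSet (hp : PseudoFree A B) (α : FinPath A) (m : ℤ) :
    Subtype.val '' loopSet hp α m = Z B α m α := by
  refine (Subtype.image_preimage_coe _ _).trans (inter_eq_right.2 ?_)
  rintro _ ⟨q, rfl, rfl, h, rfl⟩
  change (q.α.len : ℤ) - q.β.len = 0
  rw [h, sub_self]

theorem isCompact_loopSet (hA : RowFinite A) (hp : PseudoFree A B) (α : FinPath A) (m : ℤ) :
    IsCompact (loopSet hp α m) := by
  rw [Topology.IsEmbedding.subtypeVal.isCompact_iff, val_image_loopSet]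
  exact isCompact_Z hA rfl m

/-- The function `1_{Z(α, m, α; Z(α))}` on `ℋ_{A,B}`. -/
def loopInd (hA : RowFinite A) (hp : PseudoFree A B) (α : FinPath A) (m : ℤ) :
    C_c({g : KArrow A B // (rho hp).toFun g = 0}, ℤ) :=
  haveI := (ℋ hp).t2_arrows
  ind (loopSet hp α m) (isCompact_loopSet hA hp α m) (isOpen_loopSet hp α m)

theorem δ₁_loopInd (hA : RowFinite A) (hp : PseudoFree A B) (α : FinPath A) (m : ℤ) :
    (ℋ hp).δ₁ (loopInd hA hp α m) = 0 := by
  have := (ℋ hp).t2_arrows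
  have h1 : (ℋ hp).src = src ∘ Subtype.val := rfl
  have h2 : (ℋ hp).rng = src ∘ inv ∘ Subtype.val := funext fun g => (src_inv g.1).symm
  have h3 : inv '' Z B α m α = Z B α (-m) α := by
    ext g
    constructor
    · rintro ⟨k, hk, rfl⟩
      exact inv_mem_Z hk
    · intro hg
      refine ⟨g.inv, ?_, inv_inv g⟩
      have := inv_mem_Z hg
      rwa [neg_neg] at this
  have i1 : (ℋ hp).src '' loopSet hp α m = cyl α := by
    rw [h1, image_comp, val_image_loopSet, src_image_Z rfl]
  have i2 : (ℋ hp).rng '' loopSet hp α m = cyl α := by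
    rw [h2, image_comp, image_comp, val_image_loopSet, h3, src_image_Z rfl]
  have j1 : (loopSet hp α m).InjOn (ℋ hp).src := fun g hg k hk h =>
    Subtype.ext (src_injOn_Z α m α hg hk h)
  have j2 : (loopSet hp α m).InjOn (ℋ hp).rng := fun g hg k hk h => by
    refine Subtype.ext ?_
    rw [← inv_inv g.1, ← inv_inv k.1]
    refine congrArg inv (src_injOn_Z α (-m) α (inv_mem_Z hg) (inv_mem_Z hk) ?_)
    rw [src_inv, src_inv]
    exact h
  change push _ (ℋ hp).isLocalHomeomorph_src (ind _ _ _)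
    - push _ (ℋ hp).isLocalHomeomorph_rng (ind _ _ _) = 0
  rw [push_ind _ _ _ j1 i1 (isCompact_cyl hA α) (isOpen_cyl α),
    push_ind _ _ _ j2 i2 (isCompact_cyl hA α) (isOpen_cyl α), sub_self]

/-- The class `[1_{Z(α, 1, α; Z(α))}]` in `H_1(ℋ_{A,B})`. -/
def loopClass (hA : RowFinite A) (hp : PseudoFree A B) (α : FinPath A) : (ℋ hp).H₁ :=
  (ℋ hp).cls₁ (loopInd hA hp α 1) (δ₁_loopInd hA hp α 1)

end Topology

section IndLimit

variable {M : Matrix V V ℤ}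

/-- The endomorphism `1_v ↦ ∑_w M v w 1_w` of the free abelian group on the vertices. -/
def rowMap (hM : RowFinite M) : Module.End ℤ (V →₀ ℤ) :=
  Finsupp.linearCombination ℤ fun v => Finsupp.ofSupportFinite (M v) (hM v)

/-- The inductive limit `ℤ_M` of the sequence `ℤ^(V) → ℤ^(V) → ⋯` with all maps `rowMap`. -/
abbrev IndLim (hM : RowFinite M) : Type u :=
  Module.DirectLimit (fun _ : ℕ => V →₀ ℤ) fun i j (_ : i ≤ j) => rowMap hM ^ (j - i)

/-- The canonical map `φ_{i,∞}`. -/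
def toLim (hM : RowFinite M) (i : ℕ) : (V →₀ ℤ) →ₗ[ℤ] IndLim hM :=
  Module.DirectLimit.of ℤ ℕ (fun _ : ℕ => V →₀ ℤ) (fun i j (_ : i ≤ j) => rowMap hM ^ (j - i)) i

end IndLimit

variable {B}

/-- `Φ : H_0(ℋ_{A,B}) → ℤ_A` is given by `[1_{Z(α)}] ↦ φ_{n,∞}(1_v)`, where `n = |α|` and
`v = r(α)`. -/
def IsPhiA (hA : RowFinite A) (hp : PseudoFree A B) (Φ : (ℋ hp).H₀ ≃+ IndLim hA) : Prop :=
  ∀ α : FinPath A, Φ (pathClass hA hp α) = toLim hA α.len (Finsupp.single α.r 1)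

/-- `Φ : H_1(ℋ_{A,B}) → ℤ_B` is given by `[1_{Z(α, 1, α; Z(α))}] ↦ φ_{n,∞}(1_v)`, where `n = |α|`
and `v = r(α)`. -/
def IsPhiB (hA : RowFinite A) (hB : RowFinite B) (hp : PseudoFree A B)
    (Φ : (ℋ hp).H₁ ≃+ IndLim hB) : Prop :=
  ∀ α : FinPath A, Φ (loopClass hA hp α) = toLim hB α.len (Finsupp.single α.r 1)

end KatsuraExelPardo

end KEP

end

/-!
Let `ρ` be the degree and `ℋ = ker ρ`. Since paths of every length reach the vertices at the end of
sufficiently long paths, each unit `(x, k)` of the skew product can be moved, continuously in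
`(x, k)`, to a unit of `ℋ × {0}` by replacing a long initial segment of `x` with a path that is
longer by `k`. Conjugation by the arrows chosen is a retraction of the skew product onto `ℋ`, up to
a natural transformation; hence the inclusion of `ℋ` induces isomorphisms on homology.

The group `C_c(X, ℤ)` of a totally disconnected space with successively finer partitions into
compact open cells is the group of formal sums of cells modulo replacing a cell by the sum of its
children. For the cylinders in `E^∞` and the sets `Z(α, m, β)`, `|α| = |β|`, in `ℋ` this makes
`1_{Z(α)} ↦ φ_{n,∞}(1_{r(α)})` and `1_{Z(α, m, β)} ↦ m φ_{n,∞}(1_{r(β)})` well defined; the second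
one because `∑_{0 ≤ n < a} ⌊(c + n) / a⌋ = c`, which gives `∑_e φ(m, e) = m B_{v,w}` over the edges
from `v` to `w`. They vanish on boundaries. Modulo boundaries, the class of a cell depends on the
path only through its length and range, and the class of `Z(α, m, β)` is the class of `Z(α, 0, β)`
plus `m` times that of `Z(β, 1, β)`; so the kernels consist of boundaries.

Finally, for `α'` one edge longer than `α` and with the same range, `Z(α', 0, α)` is a bisection of
degree one which carries `Z(α)` to `Z(α')` and conjugates the loops over one to those over the
other, so `ρ̃` shifts the inductive limits by one step.
-/

noncomputable section

namespace KEP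

section Pushforward

theorem push_id {X : Type*} [TopologicalSpace X] [T2Space X] (h : IsLocalHomeomorph fun x : X => x)
    (f : C_c(X, ℤ)) : push (fun x : X => x) h f = f := by
  ext x
  rw [push_apply]
  exact finsum_mem_singleton

end Pushforward

namespace EtaleGroupoid

variable {G X : Type*} [TopologicalSpace G] [TopologicalSpace X] (𝒢 : EtaleGroupoid G X)

theorem mul_inv_mul_cancel (g h : G) (p : 𝒢.src g = 𝒢.src h) :
    𝒢.mul (𝒢.mul g (𝒢.inv h) (p.trans (𝒢.rng_inv h).symm)) h
      ((𝒢.src_mul _ _ _).trans (𝒢.src_inv h)) = g := by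
  rw [𝒢.mul_assoc g (𝒢.inv h) h _ (𝒢.src_inv h),
    𝒢.mul_congr rfl (𝒢.inv_mul h) _ (p.trans (𝒢.rng_one _).symm),
    𝒢.mul_congr rfl (congrArg 𝒢.one p.symm) _ (𝒢.rng_one _).symm, 𝒢.mul_one]

theorem mul_mul_inv_cancel (g h : G) (p : 𝒢.src g = 𝒢.rng h) :
    𝒢.mul (𝒢.mul g h p) (𝒢.inv h) ((𝒢.src_mul _ _ _).trans (𝒢.rng_inv h).symm) = g := by
  rw [𝒢.mul_assoc g h (𝒢.inv h) _ (𝒢.rng_inv h).symm,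
    𝒢.mul_congr rfl (𝒢.mul_inv h) _ (p.trans (𝒢.rng_one _).symm),
    𝒢.mul_congr rfl (congrArg 𝒢.one p.symm) _ (𝒢.rng_one _).symm, 𝒢.mul_one]

theorem mul_right_cancel {g g' h : G} (p : 𝒢.src g = 𝒢.rng h) (p' : 𝒢.src g' = 𝒢.rng h)
    (e : 𝒢.mul g h p = 𝒢.mul g' h p') : g = g' := by
  rw [← 𝒢.mul_mul_inv_cancel g h p, ← 𝒢.mul_mul_inv_cancel g' h p']
  exact 𝒢.mul_congr e rfl _ _

/-- A compact open bisection: a compact open set of arrows on which source and range are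
injective. The indicator functions of these sets are the basic chains. -/
structure IsBisection (U : Set G) : Prop where
  isCompact : IsCompact U
  isOpen : IsOpen U
  injOn_src : U.InjOn 𝒢.src
  injOn_rng : U.InjOn 𝒢.rng

/-- The composable pairs in `U × W`. -/
def pairs (U W : Set G) : Set 𝒢.Comp := {p | p.1.1 ∈ U ∧ p.1.2 ∈ W}

theorem isOpen_pairs {U W : Set G} (hU : IsOpen U) (hW : IsOpen W) : IsOpen (𝒢.pairs U W) :=
  (hU.prod hW).preimage continuous_subtype_val

theorem isCompact_pairs {U W : Set G} (hU : IsCompact U) (hW : IsCompact W) :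
    IsCompact (𝒢.pairs U W) := by
  have := 𝒢.t2_units
  have hc : IsClosed {p : G × G | 𝒢.src p.1 = 𝒢.rng p.2} :=
    isClosed_eq (𝒢.isLocalHomeomorph_src.continuous.comp continuous_fst)
      (𝒢.isLocalHomeomorph_rng.continuous.comp continuous_snd)
  exact hc.isClosedEmbedding_subtypeVal.isCompact_preimage (hU.prod hW)

variable {𝒢} {U W : Set G}

theorem injOn_d0_pairs (hU : U.InjOn 𝒢.src) : (𝒢.pairs U W).InjOn 𝒢.d0 := by
  rintro ⟨⟨g, h⟩, p⟩ ⟨hg, _⟩ ⟨⟨g', h'⟩, p'⟩ ⟨hg', _⟩ (rfl : h = h')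
  obtain rfl : g = g' := hU hg hg' (p.trans p'.symm)
  rfl

theorem injOn_d1_pairs (hW : W.InjOn 𝒢.src) : (𝒢.pairs U W).InjOn 𝒢.d1 := by
  rintro ⟨⟨g, h⟩, p⟩ ⟨_, hh⟩ ⟨⟨g', h'⟩, p'⟩ ⟨_, hh'⟩ (e : 𝒢.mul g h p = 𝒢.mul g' h' p')
  have hs : 𝒢.src h = 𝒢.src h' := by rw [← 𝒢.src_mul g h p, e, 𝒢.src_mul]
  obtain rfl : h = h' := hW hh hh' hs
  obtain rfl : g = g' := 𝒢.mul_right_cancel p p' e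
  rfl

theorem injOn_d2_pairs (hW : W.InjOn 𝒢.rng) : (𝒢.pairs U W).InjOn 𝒢.d2 := by
  rintro ⟨⟨g, h⟩, p⟩ ⟨_, hh⟩ ⟨⟨g', h'⟩, p'⟩ ⟨_, hh'⟩ (rfl : g = g')
  obtain rfl : h = h' := hW hh hh' (p.symm.trans p')
  rfl

theorem image_d0_pairs (h : 𝒢.rng '' W ⊆ 𝒢.src '' U) : 𝒢.d0 '' 𝒢.pairs U W = W := by
  refine Subset.antisymm (image_subset_iff.2 fun p hp => hp.2) fun k hk => ?_
  obtain ⟨g, hg, p⟩ := h (mem_image_of_mem _ hk)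
  exact ⟨⟨(g, k), p⟩, ⟨hg, hk⟩, rfl⟩

theorem image_d2_pairs (h : 𝒢.src '' U ⊆ 𝒢.rng '' W) : 𝒢.d2 '' 𝒢.pairs U W = U := by
  refine Subset.antisymm (image_subset_iff.2 fun p hp => hp.1) fun g hg => ?_
  obtain ⟨k, hk, p⟩ := h (mem_image_of_mem _ hg)
  exact ⟨⟨(g, k), p.symm⟩, ⟨hg, hk⟩, rfl⟩

theorem δ₁_ind [T2Space G] [T2Space X] (hU : 𝒢.IsBisection U) {S R : Set X} (hS : 𝒢.src '' U = S)
    (hR : 𝒢.rng '' U = R) (cS : IsCompact S) (oS : IsOpen S) (cR : IsCompact R) (oR : IsOpen R) :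
    𝒢.δ₁ (ind U hU.isCompact hU.isOpen) = ind S cS oS - ind R cR oR := by
  change push _ 𝒢.isLocalHomeomorph_src _ - push _ 𝒢.isLocalHomeomorph_rng _ = _
  rw [push_ind _ _ _ hU.injOn_src hS cS oS, push_ind _ _ _ hU.injOn_rng hR cR oR]

theorem δ₂_ind_pairs [T2Space G] (hU : 𝒢.IsBisection U) (hW : 𝒢.IsBisection W)
    (hUW : 𝒢.src '' U = 𝒢.rng '' W) {P : Set G} (hP : 𝒢.d1 '' 𝒢.pairs U W = P)
    (cP : IsCompact P) (oP : IsOpen P) :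
    𝒢.δ₂ (ind (𝒢.pairs U W) (𝒢.isCompact_pairs hU.isCompact hW.isCompact)
        (𝒢.isOpen_pairs hU.isOpen hW.isOpen))
      = ind W hW.isCompact hW.isOpen - ind P cP oP + ind U hU.isCompact hU.isOpen := by
  change push _ 𝒢.isLocalHomeomorph_d0 _ - push _ 𝒢.isLocalHomeomorph_d1 _
    + push _ 𝒢.isLocalHomeomorph_d2 _ = _
  rw [push_ind _ _ _ (injOn_d0_pairs hU.injOn_src) (image_d0_pairs hUW.ge),
    push_ind _ _ _ (injOn_d1_pairs hW.injOn_src) hP cP oP,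
    push_ind _ _ _ (injOn_d2_pairs hW.injOn_rng) (image_d2_pairs hUW.le)]

end EtaleGroupoid

namespace EtaleHom

variable {G X G' X' G'' X'' : Type*} [TopologicalSpace G] [TopologicalSpace X]
  [TopologicalSpace G'] [TopologicalSpace X'] [TopologicalSpace G''] [TopologicalSpace X'']
  {𝒢 : EtaleGroupoid G X} {𝒢' : EtaleGroupoid G' X'} {𝒢'' : EtaleGroupoid G'' X''}

variable (𝒢) in
/-- The identity homomorphism. -/
def id : EtaleHom 𝒢 𝒢 where
  arr g := g
  pt x := x
  src_arr _ := rfl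
  rng_arr _ := rfl
  arr_mul _ _ _ := rfl
  isLocalHomeomorph_arr := (Homeomorph.refl G).isLocalHomeomorph
  isLocalHomeomorph_pt := (Homeomorph.refl X).isLocalHomeomorph

/-- The composite of two homomorphisms, the first one applied first. -/
def trans (F : EtaleHom 𝒢 𝒢') (F' : EtaleHom 𝒢' 𝒢'') : EtaleHom 𝒢 𝒢'' where
  arr g := F'.arr (F.arr g)
  pt x := F'.pt (F.pt x)
  src_arr g := by rw [F'.src_arr, F.src_arr]
  rng_arr g := by rw [F'.rng_arr, F.rng_arr]
  arr_mul g h p := by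
    rw [← F'.arr_mul _ _ (by rw [F.src_arr, F.rng_arr, p])]
    exact congrArg F'.arr (F.arr_mul g h p)
  isLocalHomeomorph_arr := F'.isLocalHomeomorph_arr.comp F.isLocalHomeomorph_arr
  isLocalHomeomorph_pt := F'.isLocalHomeomorph_pt.comp F.isLocalHomeomorph_pt

theorem chain₀_id (f : C_c(X, ℤ)) : (id 𝒢).chain₀ f = f :=
  have := 𝒢.t2_units
  push_id _ f

theorem chain₁_id (f : C_c(G, ℤ)) : (id 𝒢).chain₁ f = f :=
  have := 𝒢.t2_arrows
  push_id _ f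

theorem mapH₀_id (ξ : 𝒢.H₀) : (id 𝒢).mapH₀ ξ = ξ := by
  induction ξ using QuotientAddGroup.induction_on with
  | H f => exact congrArg (QuotientAddGroup.mk (s := 𝒢.δ₁.range)) (chain₀_id f)

theorem mapH₁_id (ξ : 𝒢.H₁) : (id 𝒢).mapH₁ ξ = ξ := by
  induction ξ using QuotientAddGroup.induction_on with
  | H f =>
    exact congrArg (QuotientAddGroup.mk (s := 𝒢.δ₂.range.addSubgroupOf 𝒢.δ₁.ker))
      (Subtype.ext (chain₁_id f.1))

theorem mapH₀_trans (F : EtaleHom 𝒢 𝒢') (F' : EtaleHom 𝒢' 𝒢'') (ξ : 𝒢.H₀) :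
    (F.trans F').mapH₀ ξ = F'.mapH₀ (F.mapH₀ ξ) := by
  have := 𝒢.t2_units
  have := 𝒢'.t2_units
  have := 𝒢''.t2_units
  induction ξ using QuotientAddGroup.induction_on with
  | H f =>
    exact congrArg (QuotientAddGroup.mk (s := 𝒢''.δ₁.range))
      (push_push F.isLocalHomeomorph_pt F'.isLocalHomeomorph_pt f).symm

theorem mapH₁_trans (F : EtaleHom 𝒢 𝒢') (F' : EtaleHom 𝒢' 𝒢'') (ξ : 𝒢.H₁) :
    (F.trans F').mapH₁ ξ = F'.mapH₁ (F.mapH₁ ξ) := by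
  have := 𝒢.t2_arrows
  have := 𝒢'.t2_arrows
  have := 𝒢''.t2_arrows
  induction ξ using QuotientAddGroup.induction_on with
  | H f =>
    exact congrArg (QuotientAddGroup.mk (s := 𝒢''.δ₂.range.addSubgroupOf 𝒢''.δ₁.ker))
      (Subtype.ext (push_push F.isLocalHomeomorph_arr F'.isLocalHomeomorph_arr f.1).symm)

/-- A continuous family of arrows out of the units `F(x)`, along which `F` can be conjugated. -/
structure Gauge (F : EtaleHom 𝒢 𝒢') where
  app : X → G'
  continuous_app : Continuous app
  src_app : ∀ x, 𝒢'.src (app x) = F.pt x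

/-- A continuous natural transformation between homomorphisms. -/
structure NatTrans (F F' : EtaleHom 𝒢 𝒢') extends Gauge F where
  rng_app : ∀ x, 𝒢'.rng (app x) = F'.pt x
  naturality : ∀ g, 𝒢'.mul (app (𝒢.rng g)) (F.arr g) ((src_app _).trans (F.rng_arr g).symm)
    = 𝒢'.mul (F'.arr g) (app (𝒢.src g)) ((F'.src_arr g).trans (rng_app _).symm)

namespace Gauge

variable {F : EtaleHom 𝒢 𝒢'} (θ : Gauge F)

theorem isLocalHomeomorph_app : IsLocalHomeomorph θ.app := by
  refine IsLocalHomeomorph.of_comp (g := 𝒢'.src) ?_ 𝒢'.isLocalHomeomorph_src θ.continuous_app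
  rw [show 𝒢'.src ∘ θ.app = F.pt from funext θ.src_app]
  exact F.isLocalHomeomorph_pt

/-- The arrow `θ(r(g)) F(g)`. -/
def lmul (g : G) : G' :=
  𝒢'.mul (θ.app (𝒢.rng g)) (F.arr g) ((θ.src_app _).trans (F.rng_arr g).symm)

theorem src_lmul (g : G) : 𝒢'.src (θ.lmul g) = 𝒢'.src (θ.app (𝒢.src g)) := by
  rw [lmul, 𝒢'.src_mul, F.src_arr, θ.src_app]

/-- The arrow `θ(r(g)) F(g) θ(s(g))⁻¹`. -/
def conjArr (g : G) : G' :=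
  𝒢'.mul (θ.lmul g) (𝒢'.inv (θ.app (𝒢.src g))) ((θ.src_lmul g).trans (𝒢'.rng_inv _).symm)

theorem src_conjArr (g : G) : 𝒢'.src (θ.conjArr g) = 𝒢'.rng (θ.app (𝒢.src g)) :=
  (𝒢'.src_mul _ _ _).trans (𝒢'.src_inv _)

theorem rng_conjArr (g : G) : 𝒢'.rng (θ.conjArr g) = 𝒢'.rng (θ.app (𝒢.rng g)) :=
  (𝒢'.rng_mul _ _ _).trans (𝒢'.rng_mul _ _ _)

theorem conjArr_mul_app {g : G} {x : X} (hx : 𝒢.src g = x) :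
    𝒢'.mul (θ.conjArr g) (θ.app x) (by rw [src_conjArr, hx]) = θ.lmul g := by
  subst hx
  exact 𝒢'.mul_inv_mul_cancel _ _ (θ.src_lmul g)

theorem lmul_mul (g h : G) (p : 𝒢.src g = 𝒢.rng h) :
    θ.lmul (𝒢.mul g h p) = 𝒢'.mul (θ.lmul g) (F.arr h)
      (by rw [lmul, 𝒢'.src_mul, F.src_arr, F.rng_arr, p]) := by
  rw [lmul, 𝒢'.mul_congr (congrArg θ.app (𝒢.rng_mul g h p)) (F.arr_mul g h p) _
    (by rw [θ.src_app, 𝒢'.rng_mul, F.rng_arr])]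
  exact (𝒢'.mul_assoc _ _ _ _ _).symm

theorem conjArr_mul (g h : G) (p : 𝒢.src g = 𝒢.rng h) :
    θ.conjArr (𝒢.mul g h p) = 𝒢'.mul (θ.conjArr g) (θ.conjArr h)
      (by rw [src_conjArr, rng_conjArr, p]) := by
  have hgh : 𝒢'.src (θ.conjArr (𝒢.mul g h p)) = 𝒢'.rng (θ.app (𝒢.src h)) := by
    rw [src_conjArr, 𝒢.src_mul]
  have hr : 𝒢'.src (θ.conjArr g) = 𝒢'.rng (θ.app (𝒢.rng h)) := by rw [src_conjArr, p]
  refine 𝒢'.mul_right_cancel hgh ((𝒢'.src_mul _ _ _).trans (θ.src_conjArr h)) ?_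
  rw [θ.conjArr_mul_app (𝒢.src_mul g h p), lmul_mul, 𝒢'.mul_assoc _ _ _ _ (θ.src_conjArr h),
    𝒢'.mul_congr rfl (θ.conjArr_mul_app rfl) _ (hr.trans (𝒢'.rng_mul _ _ _).symm)]
  refine (𝒢'.mul_congr (θ.conjArr_mul_app p).symm rfl _ ?_).trans (𝒢'.mul_assoc _ _ _ hr _)
  rw [𝒢'.src_mul, θ.src_app, F.rng_arr]

theorem continuous_lmul : Continuous θ.lmul :=
  𝒢'.continuous_mul.comp (((θ.continuous_app.comp 𝒢.isLocalHomeomorph_rng.continuous).prodMk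
    F.isLocalHomeomorph_arr.continuous).subtype_mk
      fun g => (θ.src_app (𝒢.rng g)).trans (F.rng_arr g).symm)

theorem continuous_conjArr : Continuous θ.conjArr :=
  𝒢'.continuous_mul.comp ((θ.continuous_lmul.prodMk (𝒢'.continuous_inv.comp
    (θ.continuous_app.comp 𝒢.isLocalHomeomorph_src.continuous))).subtype_mk
      fun g => (θ.src_lmul g).trans (𝒢'.rng_inv (θ.app (𝒢.src g))).symm)

/-- The conjugate of `F` along `θ`. -/
def conj : EtaleHom 𝒢 𝒢' where
  arr := θ.conjArr
  pt x := 𝒢'.rng (θ.app x)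
  src_arr := θ.src_conjArr
  rng_arr := θ.rng_conjArr
  arr_mul := θ.conjArr_mul
  isLocalHomeomorph_arr := by
    refine IsLocalHomeomorph.of_comp (g := 𝒢'.src) ?_ 𝒢'.isLocalHomeomorph_src θ.continuous_conjArr
    rw [show 𝒢'.src ∘ θ.conjArr = 𝒢'.rng ∘ θ.app ∘ 𝒢.src from funext θ.src_conjArr]
    exact 𝒢'.isLocalHomeomorph_rng.comp (θ.isLocalHomeomorph_app.comp 𝒢.isLocalHomeomorph_src)
  isLocalHomeomorph_pt := 𝒢'.isLocalHomeomorph_rng.comp θ.isLocalHomeomorph_app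

/-- The family `θ` as a natural transformation from `F` to its conjugate. -/
def toConj : NatTrans F θ.conj where
  __ := θ
  rng_app _ := rfl
  naturality _ := (θ.conjArr_mul_app rfl).symm

end Gauge

namespace NatTrans

variable {F F' : EtaleHom 𝒢 𝒢'} (θ : NatTrans F F')

/-- The composable pair `(θ(r(g)), F(g))`. -/
def left (g : G) : 𝒢'.Comp :=
  ⟨(θ.app (𝒢.rng g), F.arr g), (θ.src_app _).trans (F.rng_arr g).symm⟩

/-- The composable pair `(F'(g), θ(s(g)))`. -/
def right (g : G) : 𝒢'.Comp :=
  ⟨(F'.arr g, θ.app (𝒢.src g)), (F'.src_arr g).trans (θ.rng_app _).symm⟩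

theorem isLocalHomeomorph_left : IsLocalHomeomorph θ.left :=
  IsLocalHomeomorph.of_comp (g := 𝒢'.d0) F.isLocalHomeomorph_arr 𝒢'.isLocalHomeomorph_d0
    (((θ.continuous_app.comp 𝒢.isLocalHomeomorph_rng.continuous).prodMk
      F.isLocalHomeomorph_arr.continuous).subtype_mk _)

theorem isLocalHomeomorph_right : IsLocalHomeomorph θ.right :=
  IsLocalHomeomorph.of_comp (g := 𝒢'.d2) F'.isLocalHomeomorph_arr 𝒢'.isLocalHomeomorph_d2
    ((F'.isLocalHomeomorph_arr.continuous.prodMk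
      (θ.continuous_app.comp 𝒢.isLocalHomeomorph_src.continuous)).subtype_mk _)

theorem δ₁_push_app [T2Space X] [T2Space G'] (f : C_c(X, ℤ)) :
    𝒢'.δ₁ (push θ.app θ.isLocalHomeomorph_app f) = F.chain₀ f - F'.chain₀ f := by
  have := 𝒢'.t2_units
  change push _ 𝒢'.isLocalHomeomorph_src _ - push _ 𝒢'.isLocalHomeomorph_rng _
    = push F.pt F.isLocalHomeomorph_pt f - push F'.pt F'.isLocalHomeomorph_pt f
  rw [push_push, push_push, push_congr _ F.isLocalHomeomorph_pt
    (show 𝒢'.src ∘ θ.app = F.pt from funext θ.src_app), push_congr _ F'.isLocalHomeomorph_pt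
    (show 𝒢'.rng ∘ θ.app = F'.pt from funext θ.rng_app)]

theorem δ₂_push_left_sub_push_right [T2Space G] [T2Space X] [T2Space G'] (f : C_c(G, ℤ)) :
    𝒢'.δ₂ (push θ.left θ.isLocalHomeomorph_left f - push θ.right θ.isLocalHomeomorph_right f)
      = F.chain₁ f - F'.chain₁ f - push θ.app θ.isLocalHomeomorph_app (𝒢.δ₁ f) := by
  have hF : push (𝒢'.d0 ∘ θ.left) (𝒢'.isLocalHomeomorph_d0.comp θ.isLocalHomeomorph_left) f
    = F.chain₁ f := rfl
  have hF' : push (𝒢'.d2 ∘ θ.right) (𝒢'.isLocalHomeomorph_d2.comp θ.isLocalHomeomorph_right) f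
    = F'.chain₁ f := rfl
  have hr : push (𝒢'.d2 ∘ θ.left) (𝒢'.isLocalHomeomorph_d2.comp θ.isLocalHomeomorph_left) f
    = push θ.app θ.isLocalHomeomorph_app (push 𝒢.rng 𝒢.isLocalHomeomorph_rng f) :=
    (push_push 𝒢.isLocalHomeomorph_rng θ.isLocalHomeomorph_app f).symm
  have hs : push (𝒢'.d0 ∘ θ.right) (𝒢'.isLocalHomeomorph_d0.comp θ.isLocalHomeomorph_right) f
    = push θ.app θ.isLocalHomeomorph_app (push 𝒢.src 𝒢.isLocalHomeomorph_src f) :=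
    (push_push 𝒢.isLocalHomeomorph_src θ.isLocalHomeomorph_app f).symm
  change push _ 𝒢'.isLocalHomeomorph_d0 _ - push _ 𝒢'.isLocalHomeomorph_d1 _
    + push _ 𝒢'.isLocalHomeomorph_d2 _ = F.chain₁ f - F'.chain₁ f - push θ.app _
      (push _ 𝒢.isLocalHomeomorph_src f - push _ 𝒢.isLocalHomeomorph_rng f)
  rw [map_sub, map_sub, map_sub, map_sub, push_push, push_push, push_push, push_push, push_push,
    push_push, push_congr _ (𝒢'.isLocalHomeomorph_d1.comp θ.isLocalHomeomorph_right)
    (show 𝒢'.d1 ∘ θ.left = 𝒢'.d1 ∘ θ.right from funext θ.naturality), hF, hF', hr, hs]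
  abel

theorem mapH₀_eq (θ : NatTrans F F') : F.mapH₀ = F'.mapH₀ := by
  have := 𝒢.t2_units
  have := 𝒢'.t2_arrows
  ext f
  refine ((QuotientAddGroup.eq (s := 𝒢'.δ₁.range)).2 ⟨_, (θ.δ₁_push_app f).trans ?_⟩).symm
  exact sub_eq_neg_add _ _

theorem mapH₁_eq (θ : NatTrans F F') : F.mapH₁ = F'.mapH₁ := by
  have := 𝒢.t2_units
  have := 𝒢.t2_arrows
  have := 𝒢'.t2_arrows
  ext ⟨f, hf⟩
  refine ((QuotientAddGroup.eq (s := 𝒢'.δ₂.range.addSubgroupOf 𝒢'.δ₁.ker)).2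
    ⟨_, (θ.δ₂_push_left_sub_push_right f).trans ?_⟩).symm
  rw [AddMonoidHom.mem_ker.1 hf, map_zero, sub_zero]
  exact sub_eq_neg_add _ _

end NatTrans

end EtaleHom

section SkewProduct

variable {G X : Type*} [TopologicalSpace G] [TopologicalSpace X] {𝒢 : EtaleGroupoid G X}
  (ρ : Cocycle 𝒢)

/-- A continuous choice, for each unit `(x, k)` of the skew product, of an arrow from it to the
open set `𝒢⁽⁰⁾ × {0}`, which is the unit space of `ker ρ`. -/
structure Transversal extends EtaleHom.Gauge (EtaleHom.id (skew ρ)) where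
  rng_app_snd : ∀ y, ((skew ρ).rng (app y)).2 = 0

namespace Transversal

variable {ρ} (θ : Transversal ρ)

theorem conjArr_snd (a : G × ℤ) : (θ.conjArr a).2 = 0 := θ.rng_app_snd ((skew ρ).rng a)

theorem lag_conjArr (a : G × ℤ) : ρ.toFun (θ.conjArr a).1 = 0 := by
  have h : (θ.conjArr a).2 + ρ.toFun (θ.conjArr a).1 = 0 :=
    (congrArg Prod.snd (θ.src_conjArr a)).trans (θ.rng_app_snd _)
  rwa [θ.conjArr_snd, zero_add] at h

theorem lag_app (x : X) : ρ.toFun (θ.app (x, 0)).1 = 0 := by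
  have h : (θ.app (x, 0)).2 + ρ.toFun (θ.app (x, 0)).1 = 0 := congrArg Prod.snd (θ.src_app (x, 0))
  rwa [show (θ.app (x, 0)).2 = 0 from θ.rng_app_snd _, zero_add] at h

/-- The retraction of the skew product onto `ker ρ`. -/
def retract : EtaleHom (skew ρ) (kernel ρ) where
  arr a := ⟨(θ.conjArr a).1, θ.lag_conjArr a⟩
  pt y := ((skew ρ).rng (θ.app y)).1
  src_arr a := congrArg Prod.fst (θ.src_conjArr a)
  rng_arr a := congrArg Prod.fst (θ.rng_conjArr a)
  arr_mul a b p := Subtype.ext (congrArg Prod.fst (θ.conjArr_mul a b p))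
  isLocalHomeomorph_arr := by
    refine IsLocalHomeomorph.of_comp (g := (incl ρ).arr) ?_ (incl ρ).isLocalHomeomorph_arr
      ((continuous_fst.comp θ.continuous_conjArr).subtype_mk _)
    convert θ.conj.isLocalHomeomorph_arr using 1
    exact funext fun a => Prod.ext rfl (θ.conjArr_snd a).symm
  isLocalHomeomorph_pt := by
    refine IsLocalHomeomorph.of_comp (g := (incl ρ).pt) ?_ (incl ρ).isLocalHomeomorph_pt
      (continuous_fst.comp θ.conj.isLocalHomeomorph_pt.continuous)
    convert θ.conj.isLocalHomeomorph_pt using 1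
    exact funext fun y => Prod.ext rfl (θ.rng_app_snd y).symm

/-- The transversal as a natural transformation from the identity to `incl ∘ retract`. -/
def skewTrans : EtaleHom.NatTrans (EtaleHom.id (skew ρ)) (θ.retract.trans (incl ρ)) where
  __ := θ.toGauge
  rng_app y := Prod.ext rfl (θ.rng_app_snd y)
  naturality a := (θ.toConj.naturality a).trans
    ((skew ρ).mul_congr (g := θ.conjArr a) (g' := (incl ρ).arr (θ.retract.arr a))
      (Prod.ext rfl (θ.conjArr_snd a)) rfl _ _)

/-- The transversal as a natural transformation from the identity to `retract ∘ incl`. -/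
def kernelTrans : EtaleHom.NatTrans (EtaleHom.id (kernel ρ)) ((incl ρ).trans θ.retract) where
  app x := ⟨(θ.app (x, 0)).1, θ.lag_app x⟩
  continuous_app := (continuous_fst.comp
    (θ.continuous_app.comp (continuous_id.prodMk continuous_const))).subtype_mk _
  src_app x := congrArg Prod.fst (θ.src_app (x, 0))
  rng_app _ := rfl
  naturality g := Subtype.ext (congrArg Prod.fst (θ.conjArr_mul_app ((incl ρ).src_arr g)).symm)

theorem bijective_mapH₀ (θ : Transversal ρ) : Function.Bijective (incl ρ).mapH₀ := by
  refine Function.bijective_iff_has_inverse.2 ⟨θ.retract.mapH₀, fun ξ => ?_, fun ξ => ?_⟩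
  · rw [← EtaleHom.mapH₀_trans, ← θ.kernelTrans.mapH₀_eq, EtaleHom.mapH₀_id]
  · rw [← EtaleHom.mapH₀_trans, ← θ.skewTrans.mapH₀_eq, EtaleHom.mapH₀_id]

theorem bijective_mapH₁ (θ : Transversal ρ) : Function.Bijective (incl ρ).mapH₁ := by
  refine Function.bijective_iff_has_inverse.2 ⟨θ.retract.mapH₁, fun ξ => ?_, fun ξ => ?_⟩
  · rw [← EtaleHom.mapH₁_trans, ← θ.kernelTrans.mapH₁_eq, EtaleHom.mapH₁_id]
  · rw [← EtaleHom.mapH₁_trans, ← θ.skewTrans.mapH₁_eq, EtaleHom.mapH₁_id]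

end Transversal

end SkewProduct

theorem EtaleGroupoid.cls₀_eq_cls₀ {G X : Type*} [TopologicalSpace G] [TopologicalSpace X]
    {𝒢 : EtaleGroupoid G X} {f f' : C_c(X, ℤ)} :
    𝒢.cls₀ f = 𝒢.cls₀ f' ↔ ∃ c, 𝒢.δ₁ c = f - f' := by
  rw [eq_comm, cls₀, cls₀, QuotientAddGroup.eq (s := 𝒢.δ₁.range), neg_add_eq_sub]
  exact AddMonoidHom.mem_range

theorem EtaleGroupoid.cls₁_eq_cls₁ {G X : Type*} [TopologicalSpace G] [TopologicalSpace X]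
    {𝒢 : EtaleGroupoid G X} {f f' : C_c(G, ℤ)} {hf : 𝒢.δ₁ f = 0} {hf' : 𝒢.δ₁ f' = 0} :
    𝒢.cls₁ f hf = 𝒢.cls₁ f' hf' ↔ ∃ c, 𝒢.δ₂ c = f - f' := by
  rw [eq_comm, cls₁, cls₁, QuotientAddGroup.eq (s := 𝒢.δ₂.range.addSubgroupOf 𝒢.δ₁.ker),
    neg_add_eq_sub]
  exact AddMonoidHom.mem_range

section SkewProduct

variable {G X : Type*} [TopologicalSpace G] [TopologicalSpace X] {𝒢 : EtaleGroupoid G X}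
  {U W : Set G}

theorem EtaleGroupoid.IsBisection.skew (hU : 𝒢.IsBisection U) (ρ : Cocycle 𝒢) (k : ℤ) :
    (skew ρ).IsBisection (U ×ˢ {k}) where
  isCompact := hU.isCompact.prod isCompact_singleton
  isOpen := hU.isOpen.prod (isOpen_discrete _)
  injOn_src _ ha _ hb e :=
    Prod.ext (hU.injOn_src ha.1 hb.1 (congrArg Prod.fst e)) (ha.2.trans hb.2.symm)
  injOn_rng _ ha _ hb e :=
    Prod.ext (hU.injOn_rng ha.1 hb.1 (congrArg Prod.fst e)) (ha.2.trans hb.2.symm)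

theorem EtaleGroupoid.IsBisection.kernel (hU : 𝒢.IsBisection U) (ρ : Cocycle 𝒢) :
    (kernel ρ).IsBisection (Subtype.val ⁻¹' U) where
  isCompact := (isClosed_singleton.preimage ρ.continuous_toFun).isClosedEmbedding_subtypeVal
    |>.isCompact_preimage hU.isCompact
  isOpen := hU.isOpen.preimage continuous_subtype_val
  injOn_src _ hg _ hh e := Subtype.ext (hU.injOn_src hg hh e)
  injOn_rng _ hg _ hh e := Subtype.ext (hU.injOn_rng hg hh e)

variable {ρ : Cocycle 𝒢} {c : ℤ}

theorem src_image_skew (hc : ∀ g ∈ U, ρ.toFun g = c) (k : ℤ) :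
    (skew ρ).src '' (U ×ˢ {k}) = (𝒢.src '' U) ×ˢ {k + c} := by
  refine Subset.antisymm ?_ ?_
  · rintro _ ⟨⟨g, _⟩, ⟨hg, rfl⟩, rfl⟩
    exact ⟨mem_image_of_mem _ hg, congrArg (_ + ·) (hc g hg)⟩
  · rintro ⟨_, _⟩ ⟨⟨g, hg, rfl⟩, rfl⟩
    exact ⟨(g, k), ⟨hg, rfl⟩, Prod.ext rfl (congrArg (k + ·) (hc g hg))⟩

theorem rng_image_skew (k : ℤ) : (skew ρ).rng '' (U ×ˢ {k}) = (𝒢.rng '' U) ×ˢ {k} := by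
  refine Subset.antisymm ?_ ?_
  · rintro _ ⟨⟨g, _⟩, ⟨hg, rfl⟩, rfl⟩
    exact ⟨mem_image_of_mem _ hg, rfl⟩
  · rintro ⟨_, i⟩ ⟨⟨g, hg, rfl⟩, hi⟩
    exact ⟨(g, i), ⟨hg, hi⟩, rfl⟩

theorem d1_image_pairs_skew (hc : ∀ g ∈ U, ρ.toFun g = c) (k : ℤ) :
    (skew ρ).d1 '' (skew ρ).pairs (U ×ˢ {k}) (W ×ˢ {k + c}) = (𝒢.d1 '' 𝒢.pairs U W) ×ˢ {k} := by
  refine Subset.antisymm ?_ ?_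
  · rintro _ ⟨⟨⟨⟨g, i⟩, ⟨h, j⟩⟩, p⟩, ⟨⟨hg, rfl⟩, hh, _⟩, rfl⟩
    exact ⟨⟨⟨(g, h), congrArg Prod.fst p⟩, ⟨hg, hh⟩, rfl⟩, rfl⟩
  · rintro ⟨_, i⟩ ⟨⟨⟨⟨g, h⟩, p⟩, ⟨hg, hh⟩, rfl⟩, hi⟩
    exact ⟨⟨((g, i), (h, i + c)), Prod.ext p (congrArg (i + ·) (hc g hg))⟩,
      ⟨⟨hg, hi⟩, hh, congrArg (· + c) hi⟩, rfl⟩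

theorem src_image_kernel (hc : ∀ g ∈ U, ρ.toFun g = 0) :
    (kernel ρ).src '' (Subtype.val ⁻¹' U) = 𝒢.src '' U := by
  refine Subset.antisymm ?_ ?_
  · rintro _ ⟨g, hg, rfl⟩
    exact mem_image_of_mem _ hg
  · rintro _ ⟨g, hg, rfl⟩
    exact ⟨⟨g, hc g hg⟩, hg, rfl⟩

theorem rng_image_kernel (hc : ∀ g ∈ U, ρ.toFun g = 0) :
    (kernel ρ).rng '' (Subtype.val ⁻¹' U) = 𝒢.rng '' U := by
  refine Subset.antisymm ?_ ?_
  · rintro _ ⟨g, hg, rfl⟩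
    exact mem_image_of_mem _ hg
  · rintro _ ⟨g, hg, rfl⟩
    exact ⟨⟨g, hc g hg⟩, hg, rfl⟩

theorem d1_image_pairs_kernel (hU : ∀ g ∈ U, ρ.toFun g = 0) (hW : ∀ g ∈ W, ρ.toFun g = 0) :
    (kernel ρ).d1 '' (kernel ρ).pairs (Subtype.val ⁻¹' U) (Subtype.val ⁻¹' W)
      = Subtype.val ⁻¹' (𝒢.d1 '' 𝒢.pairs U W) := by
  refine Subset.antisymm ?_ ?_
  · rintro _ ⟨⟨⟨g, h⟩, p⟩, ⟨hg, hh⟩, rfl⟩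
    exact ⟨⟨(g.1, h.1), p⟩, ⟨hg, hh⟩, rfl⟩
  · rintro ⟨_, _⟩ ⟨⟨⟨g, h⟩, p⟩, ⟨hg, hh⟩, rfl⟩
    exact ⟨⟨(⟨g, hU g hg⟩, ⟨h, hW h hh⟩), p⟩, ⟨hg, hh⟩, rfl⟩

theorem chain₀_dual_incl_ind [T2Space X] (m : ℤ) {S : Set X} (cS : IsCompact S) (oS : IsOpen S) :
    (dual ρ m).chain₀ ((incl ρ).chain₀ (ind S cS oS))
      = ind (S ×ˢ {m}) (cS.prod isCompact_singleton) (oS.prod (isOpen_discrete _)) := by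
  refine (push_push (incl ρ).isLocalHomeomorph_pt (dual ρ m).isLocalHomeomorph_pt _).trans
    (push_ind _ cS oS (fun x _ y _ e => congrArg Prod.fst e) ?_ _ _)
  refine Subset.antisymm ?_ ?_
  · rintro _ ⟨x, hx, rfl⟩
    exact ⟨hx, add_zero m⟩
  · rintro ⟨x, _⟩ ⟨hx, rfl⟩
    exact ⟨x, hx, Prod.ext rfl (add_zero _)⟩

theorem chain₁_dual_incl_ind [T2Space G] (m : ℤ) (hU : 𝒢.IsBisection U)
    (hc : ∀ g ∈ U, ρ.toFun g = 0) :
    (dual ρ m).chain₁ ((incl ρ).chain₁ (ind _ (hU.kernel ρ).isCompact (hU.kernel ρ).isOpen))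
      = ind _ (hU.skew ρ m).isCompact (hU.skew ρ m).isOpen := by
  refine (push_push (incl ρ).isLocalHomeomorph_arr (dual ρ m).isLocalHomeomorph_arr _).trans
    (push_ind _ _ _ (fun g _ h _ e => Subtype.ext (congrArg Prod.fst e)) ?_ _ _)
  refine Subset.antisymm ?_ ?_
  · rintro _ ⟨g, hg, rfl⟩
    exact ⟨hg, add_zero m⟩
  · rintro ⟨g, _⟩ ⟨hg, rfl⟩
    exact ⟨⟨g, hc g hg⟩, hg, Prod.ext rfl (add_zero _)⟩

theorem dual_zero : dual ρ 0 = EtaleHom.id (skew ρ) := by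
  simp only [dual, EtaleHom.id, zero_add]

theorem chain₀_incl_ind [T2Space X] {S : Set X} (cS : IsCompact S) (oS : IsOpen S) :
    (incl ρ).chain₀ (ind S cS oS)
      = ind (S ×ˢ {0}) (cS.prod isCompact_singleton) (oS.prod (isOpen_discrete _)) := by
  rw [← chain₀_dual_incl_ind (ρ := ρ) 0 cS oS, dual_zero, EtaleHom.chain₀_id]

theorem chain₁_incl_ind [T2Space G] (hU : 𝒢.IsBisection U) (hc : ∀ g ∈ U, ρ.toFun g = 0) :
    (incl ρ).chain₁ (ind _ (hU.kernel ρ).isCompact (hU.kernel ρ).isOpen)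
      = ind _ (hU.skew ρ 0).isCompact (hU.skew ρ 0).isOpen := by
  rw [← chain₁_dual_incl_ind 0 hU hc, dual_zero, EtaleHom.chain₁_id]

theorem tilde₀_eq_iff (h : Function.Bijective (incl ρ).mapH₀) {m : ℤ} {ξ ζ : (kernel ρ).H₀} :
    tilde₀ ρ h m ξ = ζ ↔ (dual ρ m).mapH₀ ((incl ρ).mapH₀ ξ) = (incl ρ).mapH₀ ζ :=
  (AddEquiv.ofBijective (incl ρ).mapH₀ h).symm_apply_eq

theorem tilde₁_eq_iff (h : Function.Bijective (incl ρ).mapH₁) {m : ℤ} {ξ ζ : (kernel ρ).H₁} :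
    tilde₁ ρ h m ξ = ζ ↔ (dual ρ m).mapH₁ ((incl ρ).mapH₁ ξ) = (incl ρ).mapH₁ ζ :=
  (AddEquiv.ofBijective (incl ρ).mapH₁ h).symm_apply_eq

theorem tilde₀_cls₀_ind [T2Space X] (h : Function.Bijective (incl ρ).mapH₀)
    (hU : 𝒢.IsBisection U) (hc : ∀ g ∈ U, ρ.toFun g = c) {S R : Set X} (hS : 𝒢.src '' U = S)
    (hR : 𝒢.rng '' U = R) (cS : IsCompact S) (oS : IsOpen S) (cR : IsCompact R) (oR : IsOpen R) :
    tilde₀ ρ h c ((kernel ρ).cls₀ (ind S cS oS)) = (kernel ρ).cls₀ (ind R cR oR) := by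
  have := (skew ρ).t2_arrows
  refine (tilde₀_eq_iff h).2 (EtaleGroupoid.cls₀_eq_cls₀.2
    ⟨ind _ (hU.skew ρ 0).isCompact (hU.skew ρ 0).isOpen, ?_⟩)
  rw [chain₀_dual_incl_ind, chain₀_incl_ind]
  refine EtaleGroupoid.δ₁_ind (hU.skew ρ 0) ?_ ?_ _ _ _ _
  · rw [src_image_skew hc, hS, zero_add]
  · rw [rng_image_skew, hR]

/-- Conjugation by `U × {0}` carries the loops `W × {c}` to the loops `W' × {0}`. -/
theorem tilde₁_cls₁_ind [T2Space G] (h : Function.Bijective (incl ρ).mapH₁) {W' : Set G}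
    (hU : 𝒢.IsBisection U) (hW : 𝒢.IsBisection W) (hW' : 𝒢.IsBisection W')
    (hc : ∀ g ∈ U, ρ.toFun g = c) (hcW : ∀ g ∈ W, ρ.toFun g = 0)
    (hcW' : ∀ g ∈ W', ρ.toFun g = 0) (hUW : 𝒢.src '' U = 𝒢.rng '' W)
    (hWU : 𝒢.src '' W' = 𝒢.rng '' U) {P : Set G} (hP : 𝒢.d1 '' 𝒢.pairs U W = P)
    (hP' : 𝒢.d1 '' 𝒢.pairs W' U = P) (cP : IsCompact P) (oP : IsOpen P)
    (zW : (kernel ρ).δ₁ (ind _ (hW.kernel ρ).isCompact (hW.kernel ρ).isOpen) = 0)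
    (zW' : (kernel ρ).δ₁ (ind _ (hW'.kernel ρ).isCompact (hW'.kernel ρ).isOpen) = 0) :
    tilde₁ ρ h c ((kernel ρ).cls₁ _ zW) = (kernel ρ).cls₁ _ zW' := by
  have := (skew ρ).t2_arrows
  have hUW' : (skew ρ).src '' (U ×ˢ {0}) = (skew ρ).rng '' (W ×ˢ {c}) := by
    rw [src_image_skew hc, rng_image_skew, hUW, zero_add]
  have hWU' : (skew ρ).src '' (W' ×ˢ {0}) = (skew ρ).rng '' (U ×ˢ {0}) := by
    rw [src_image_skew hcW', rng_image_skew, hWU, zero_add]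
  have hP₀ : (skew ρ).d1 '' (skew ρ).pairs (U ×ˢ {0}) (W ×ˢ {c}) = P ×ˢ {0} := by
    rw [← hP, ← d1_image_pairs_skew hc, zero_add]
  have hP₀' : (skew ρ).d1 '' (skew ρ).pairs (W' ×ˢ {0}) (U ×ˢ {0}) = P ×ˢ {0} := by
    rw [← hP', ← d1_image_pairs_skew hcW', zero_add]
  have cP₀ : IsCompact (P ×ˢ {(0 : ℤ)}) := cP.prod isCompact_singleton
  have oP₀ : IsOpen (P ×ˢ {(0 : ℤ)}) := oP.prod (isOpen_discrete _)
  have e₁ := EtaleGroupoid.δ₂_ind_pairs (hU.skew ρ 0) (hW.skew ρ c) hUW' hP₀ cP₀ oP₀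
  have e₂ := EtaleGroupoid.δ₂_ind_pairs (hW'.skew ρ 0) (hU.skew ρ 0) hWU' hP₀' cP₀ oP₀
  refine (tilde₁_eq_iff h).2 (EtaleGroupoid.cls₁_eq_cls₁.2 ⟨_, (map_sub _ _ _).trans
    ((congrArg₂ (· - ·) e₁ e₂).trans ?_)⟩)
  change _ = (dual ρ c).chain₁ ((incl ρ).chain₁ _) - (incl ρ).chain₁ _
  rw [chain₁_dual_incl_ind c hW hcW, chain₁_incl_ind hW' hcW']
  abel

end SkewProduct

section FormalSums

variable {T L : Type*} [AddCommGroup L] {s : Set T}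

theorem linearCombination_congr_of_mem_supported [Module ℤ L] {F : T →₀ ℤ}
    (hF : F ∈ Finsupp.supported ℤ ℤ s) {w w' : T → L} (hw : ∀ t ∈ s, w t = w' t) :
    Finsupp.linearCombination ℤ w F = Finsupp.linearCombination ℤ w' F := by
  simp only [Finsupp.linearCombination_apply]
  exact Finsupp.sum_congr fun t ht => by rw [hw t (hF ht)]

theorem linearCombination_eq_zero_of_factors {V : Type*} {F : T →₀ ℤ}
    (hF : F ∈ Finsupp.supported ℤ ℤ s) {k : T → ℤ} {r : T → V}
    {g : T → L} (hg : ∀ t ∈ s, ∀ t' ∈ s, r t = r t' → g t = g t')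
    (h0 : Finsupp.linearCombination ℤ (fun t => k t • Finsupp.single (r t) (1 : ℤ)) F = 0) :
    Finsupp.linearCombination ℤ (fun t => k t • g t) F = 0 := by
  let g' : V → L := Function.extend (fun t : s => r t) (fun t : s => g t) 0
  have hg' : ∀ t ∈ s, g' (r t) = g t := fun t ht =>
    Function.FactorsThrough.extend_apply (f := fun t : s => r t) (g := fun t : s => g t)
      (fun t t' h => hg t t.2 t' t'.2 h) 0 ⟨t, ht⟩
  have h := congrArg (Finsupp.linearCombination ℤ g') h0
  rw [map_zero, Finsupp.apply_linearCombination] at h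
  rw [← h]
  refine linearCombination_congr_of_mem_supported hF fun t ht => ?_
  rw [Function.comp_apply, map_zsmul, Finsupp.linearCombination_single, one_smul, hg' t ht]

end FormalSums

/-- A sequence of finer and finer partitions of `X` into compact open cells: the cells of level `n`
are disjoint, each is the union of its finitely many children, which are cells of level `n + 1`,
and all cells together form a basis of the topology. -/
structure Subdivision (X T : Type*) [TopologicalSpace X] where
  lev : T → ℕ
  cell : T → Set X
  children : T → Finset T
  isCompact_cell : ∀ t, IsCompact (cell t)
  isOpen_cell : ∀ t, IsOpen (cell t)
  nonempty_cell : ∀ t, (cell t).Nonempty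
  eq_of_mem : ∀ t t' x, lev t = lev t' → x ∈ cell t → x ∈ cell t' → t = t'
  lev_child : ∀ t, ∀ c ∈ children t, lev c = lev t + 1
  child_subset : ∀ t, ∀ c ∈ children t, cell c ⊆ cell t
  exists_child : ∀ t, ∀ x ∈ cell t, ∃ c ∈ children t, x ∈ cell c
  exists_cell : ∀ x, ∀ U ∈ 𝓝 x, ∃ t, x ∈ cell t ∧ cell t ⊆ U

namespace Subdivision

variable {X T : Type*} [TopologicalSpace X] (𝒮 : Subdivision X T)

theorem exists_cell_of_lev_le {t : T} {x : X} (hx : x ∈ 𝒮.cell t) {n : ℕ} (hn : 𝒮.lev t ≤ n) :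
    ∃ t', 𝒮.lev t' = n ∧ x ∈ 𝒮.cell t' ∧ 𝒮.cell t' ⊆ 𝒮.cell t := by
  induction n, hn using Nat.le_induction with
  | base => exact ⟨t, rfl, hx, Subset.rfl⟩
  | succ n _ ih =>
    obtain ⟨t', rfl, hx', ht'⟩ := ih
    obtain ⟨c, hc, hxc⟩ := 𝒮.exists_child t' x hx'
    exact ⟨c, 𝒮.lev_child t' c hc, hxc, (𝒮.child_subset t' c hc).trans ht'⟩

theorem exists_finset_cover_subset {K : Set X} (hK : IsCompact K) {U : X → Set X}
    (hU : ∀ x, U x ∈ 𝓝 x) : ∃ n, ∃ s : Finset T, K ⊆ ⋃ t ∈ s, 𝒮.cell t ∧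
      ∀ t ∈ s, 𝒮.lev t = n ∧ ∃ y, 𝒮.cell t ⊆ U y := by
  choose c hxc hcU using fun x => 𝒮.exists_cell x (U x) (hU x)
  obtain ⟨s, -, hs⟩ := hK.elim_nhds_subcover (fun x => 𝒮.cell (c x))
    fun x _ => (𝒮.isOpen_cell _).mem_nhds (hxc x)
  let n := s.sup fun y => 𝒮.lev (c y)
  have hcover : K ⊆ ⋃ t ∈ {t | 𝒮.lev t = n ∧ ∃ y, 𝒮.cell t ⊆ U y}, 𝒮.cell t := by
    intro x hx
    obtain ⟨y, hy, hxy⟩ := mem_iUnion₂.1 (hs hx)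
    obtain ⟨t, hl, hxt, ht⟩ := 𝒮.exists_cell_of_lev_le hxy
      (Finset.le_sup (f := fun y => 𝒮.lev (c y)) hy)
    exact mem_iUnion₂.2 ⟨t, ⟨hl, y, ht.trans (hcU y)⟩, hxt⟩
  obtain ⟨b, hb, hfin, hKb⟩ := hK.elim_finite_subcover_image (fun t _ => 𝒮.isOpen_cell t) hcover
  refine ⟨n, hfin.toFinset, ?_, fun t ht => hb (hfin.mem_toFinset.1 ht)⟩
  simpa only [Finite.mem_toFinset] using hKb

/-- The replacement of every cell by the sum of its children, on formal sums of cells. -/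
def refine : Module.End ℤ (T →₀ ℤ) :=
  Finsupp.linearCombination ℤ fun t => ∑ c ∈ 𝒮.children t, Finsupp.single c 1

theorem refine_single (t : T) :
    𝒮.refine (Finsupp.single t 1) = ∑ c ∈ 𝒮.children t, Finsupp.single c 1 := by
  rw [refine, Finsupp.linearCombination_single, one_smul]

/-- The formal sums of cells of level `n`. -/
def level (n : ℕ) : Submodule ℤ (T →₀ ℤ) := Finsupp.supported ℤ ℤ {t | 𝒮.lev t = n}

variable {𝒮}

theorem single_mem_level {n : ℕ} {t : T} (ht : 𝒮.lev t = n) (k : ℤ) :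
    Finsupp.single t k ∈ 𝒮.level n :=
  Finsupp.single_mem_supported ℤ k ht

theorem linearCombination_mem_of_mem_level {L : Type*} [AddCommGroup L] [Module ℤ L] {n : ℕ}
    {F : T →₀ ℤ} (hF : F ∈ 𝒮.level n) {P : Submodule ℤ L} {w : T → L}
    (hw : ∀ t, 𝒮.lev t = n → w t ∈ P) : Finsupp.linearCombination ℤ w F ∈ P :=
  P.sum_mem fun t ht => P.smul_mem _ (hw t (hF ht))

theorem refine_mem_level {n : ℕ} {F : T →₀ ℤ} (hF : F ∈ 𝒮.level n) :
    𝒮.refine F ∈ 𝒮.level (n + 1) :=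
  linearCombination_mem_of_mem_level hF fun t ht => Submodule.sum_mem _ fun c hc =>
    single_mem_level (by rw [𝒮.lev_child t c hc, ht]) 1

theorem refine_pow_mem_level {n : ℕ} {F : T →₀ ℤ} (hF : F ∈ 𝒮.level n) (j : ℕ) :
    (𝒮.refine ^ j) F ∈ 𝒮.level (n + j) := by
  induction j with
  | zero => exact hF
  | succ j ih =>
    rw [pow_succ', Module.End.mul_apply]
    exact refine_mem_level ih

variable (𝒮)

theorem refine_pow_sub_mem_range (j : ℕ) (F : T →₀ ℤ) :
    (𝒮.refine ^ j) F - F ∈ LinearMap.range (𝒮.refine - 1) :=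
  ⟨(∑ i ∈ Finset.range j, 𝒮.refine ^ i) F, by
    rw [← Module.End.mul_apply, mul_geom_sum, LinearMap.sub_apply, Module.End.one_apply]⟩

theorem exists_level_sub_mem_range (F : T →₀ ℤ) :
    ∃ n, ∃ F' ∈ 𝒮.level n, F' - F ∈ LinearMap.range (𝒮.refine - 1) := by
  induction F using Finsupp.induction_linear with
  | zero => exact ⟨0, 0, zero_mem _, by rw [sub_zero]; exact zero_mem _⟩
  | add F₁ F₂ h₁ h₂ =>
    obtain ⟨n₁, F₁', hl₁, hd₁⟩ := h₁
    obtain ⟨n₂, F₂', hl₂, hd₂⟩ := h₂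
    have hr₁ := 𝒮.refine_pow_sub_mem_range n₂ F₁'
    have hr₂ := 𝒮.refine_pow_sub_mem_range n₁ F₂'
    refine ⟨n₁ + n₂, (𝒮.refine ^ n₂) F₁' + (𝒮.refine ^ n₁) F₂',
      add_mem (refine_pow_mem_level hl₁ n₂) ?_, ?_⟩
    · rw [add_comm]
      exact refine_pow_mem_level hl₂ n₁
    · convert add_mem (add_mem hr₁ hd₁) (add_mem hr₂ hd₂) using 1
      abel
  | single t k =>
    exact ⟨_, _, single_mem_level rfl k, by rw [sub_self]; exact zero_mem _⟩

variable [T2Space X]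

/-- The indicator function of a cell. -/
def cellInd (t : T) : C_c(X, ℤ) := ind (𝒮.cell t) (𝒮.isCompact_cell t) (𝒮.isOpen_cell t)

theorem cellInd_of_mem {t : T} {x : X} (hx : x ∈ 𝒮.cell t) : 𝒮.cellInd t x = 1 :=
  indicator_of_mem hx 1

theorem cellInd_of_notMem {t : T} {x : X} (hx : x ∉ 𝒮.cell t) : 𝒮.cellInd t x = 0 :=
  indicator_of_notMem hx 1

/-- The function represented by a formal sum of cells. -/
def realize : (T →₀ ℤ) →ₗ[ℤ] C_c(X, ℤ) := Finsupp.linearCombination ℤ 𝒮.cellInd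

theorem realize_single (t : T) : 𝒮.realize (Finsupp.single t 1) = 𝒮.cellInd t := by
  rw [realize, Finsupp.linearCombination_single, one_smul]

theorem realize_apply (F : T →₀ ℤ) (x : X) :
    𝒮.realize F x = ∑ t ∈ F.support, F t * 𝒮.cellInd t x := by
  rw [realize, Finsupp.linearCombination_apply, Finsupp.sum,
    CompactlySupportedContinuousMap.coe_sum, Finset.sum_apply]
  rfl

variable {𝒮} in
theorem realize_apply_of_mem_cell {n : ℕ} {F : T →₀ ℤ} (hF : F ∈ 𝒮.level n) {t : T}
    (ht : 𝒮.lev t = n) {x : X} (hx : x ∈ 𝒮.cell t) : 𝒮.realize F x = F t := by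
  rw [realize_apply, Finset.sum_eq_single t, 𝒮.cellInd_of_mem hx, _root_.mul_one]
  · intro t' ht' hne
    have hx' : x ∉ 𝒮.cell t' := fun h =>
      hne (𝒮.eq_of_mem t' t x ((hF ht').trans ht.symm) h hx)
    rw [𝒮.cellInd_of_notMem hx', mul_zero]
  · intro h
    rw [Finsupp.notMem_support_iff.1 h, zero_mul]

theorem cellInd_eq_sum_children (t : T) : 𝒮.cellInd t = ∑ c ∈ 𝒮.children t, 𝒮.cellInd c := by
  ext x
  rw [CompactlySupportedContinuousMap.coe_sum, Finset.sum_apply]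
  by_cases hx : x ∈ 𝒮.cell t
  · obtain ⟨c, hc, hxc⟩ := 𝒮.exists_child t x hx
    have h_lev := 𝒮.lev_child t c hc
    rw [Finset.sum_eq_single_of_mem c hc, 𝒮.cellInd_of_mem hx, 𝒮.cellInd_of_mem hxc]
    exact fun c' hc' hne => 𝒮.cellInd_of_notMem fun hx' =>
      hne (𝒮.eq_of_mem c' c x ((𝒮.lev_child t c' hc').trans h_lev.symm) hx' hxc)
  · rw [𝒮.cellInd_of_notMem hx]
    exact (Finset.sum_eq_zero fun c hc =>
      𝒮.cellInd_of_notMem fun hx' => hx (𝒮.child_subset t c hc hx')).symm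

theorem realize_comp_refine : 𝒮.realize ∘ₗ 𝒮.refine = 𝒮.realize := by
  ext t : 2
  change 𝒮.realize (𝒮.refine (Finsupp.single t 1)) = 𝒮.realize (Finsupp.single t 1)
  simp only [refine_single, map_sum, realize_single]
  exact (𝒮.cellInd_eq_sum_children t).symm

theorem exists_mem_level_realize_eq (f : C_c(X, ℤ)) :
    ∃ n, ∃ F ∈ 𝒮.level n, 𝒮.realize F = f := by
  obtain ⟨n, s, hs, hconst⟩ := 𝒮.exists_finset_cover_subset f.hasCompactSupport
    (U := fun x => f ⁻¹' {f x}) fun x =>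
      ((isOpen_discrete {f x}).preimage f.continuous).mem_nhds rfl
  choose p hp using 𝒮.nonempty_cell
  have hfp : ∀ t ∈ s, ∀ x ∈ 𝒮.cell t, f (p t) = f x := fun t ht x hx => by
    obtain ⟨-, y, hy⟩ := hconst t ht
    exact (hy (hp t)).trans (hy hx).symm
  have hF : ∑ t ∈ s, Finsupp.single t (f (p t)) ∈ 𝒮.level n :=
    sum_mem fun t ht => single_mem_level (hconst t ht).1 _
  refine ⟨n, _, hF, ?_⟩
  ext x
  by_cases hx : ∃ t ∈ s, x ∈ 𝒮.cell t
  · obtain ⟨t, ht, hxt⟩ := hx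
    rw [realize_apply_of_mem_cell hF (hconst t ht).1 hxt, Finsupp.finsetSum_apply,
      Finset.sum_eq_single_of_mem t ht fun _ _ hne => Finsupp.single_eq_of_ne' hne,
      Finsupp.single_eq_same, hfp t ht x hxt]
  · have hx' : x ∉ tsupport f := fun h => hx (by simpa only [mem_iUnion₂, exists_prop] using hs h)
    rw [image_eq_zero_of_notMem_tsupport hx', map_sum, CompactlySupportedContinuousMap.coe_sum,
      Finset.sum_apply]
    refine Finset.sum_eq_zero fun t ht => ?_
    rw [realize, Finsupp.linearCombination_single, CompactlySupportedContinuousMap.smul_apply,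
      𝒮.cellInd_of_notMem fun h => hx ⟨t, ht, h⟩, smul_zero]

theorem realize_surjective : Function.Surjective 𝒮.realize := fun f =>
  let ⟨_, F, _, hF⟩ := 𝒮.exists_mem_level_realize_eq f
  ⟨F, hF⟩

theorem map_realize {L : Type*} [AddCommGroup L] (φ : C_c(X, ℤ) →+ L) (F : T →₀ ℤ) :
    φ (𝒮.realize F) = Finsupp.linearCombination ℤ (fun t => φ (𝒮.cellInd t)) F :=
  Finsupp.apply_linearCombination ℤ φ.toIntLinearMap 𝒮.cellInd F

theorem eq_zero_of_cellInd {L : Type*} [AddCommGroup L] {φ : C_c(X, ℤ) →+ L}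
    (hφ : ∀ t, φ (𝒮.cellInd t) = 0) : φ = 0 := by
  ext f
  obtain ⟨F, rfl⟩ := 𝒮.realize_surjective f
  simp only [map_realize, hφ, Finsupp.linearCombination_apply, smul_zero, Finsupp.sum_fun_zero,
    AddMonoidHom.zero_apply]

variable {𝒮} in
theorem eq_zero_of_realize_eq_zero {n : ℕ} {F : T →₀ ℤ} (hF : F ∈ 𝒮.level n)
    (h0 : 𝒮.realize F = 0) : F = 0 := by
  ext t
  by_cases ht : 𝒮.lev t = n
  · obtain ⟨x, hx⟩ := 𝒮.nonempty_cell t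
    rw [← realize_apply_of_mem_cell hF ht hx, h0]
    rfl
  · exact Finsupp.notMem_support_iff.1 fun h => ht (hF h)

theorem ker_realize : LinearMap.ker 𝒮.realize = LinearMap.range (𝒮.refine - 1) := by
  have hle : LinearMap.range (𝒮.refine - 1) ≤ LinearMap.ker 𝒮.realize := by
    rintro _ ⟨D, rfl⟩
    rw [LinearMap.mem_ker, LinearMap.sub_apply, map_sub, ← LinearMap.comp_apply,
      realize_comp_refine, Module.End.one_apply, sub_self]
  refine le_antisymm (fun F hF => ?_) hle
  obtain ⟨n, F', hF', hd⟩ := 𝒮.exists_level_sub_mem_range F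
  have h0 : 𝒮.realize F' = 0 := by
    rw [← LinearMap.mem_ker.1 (hle hd), map_sub, LinearMap.mem_ker.1 hF, sub_zero]
  rw [eq_zero_of_realize_eq_zero hF' h0, zero_sub] at hd
  exact (Submodule.neg_mem_iff _).1 hd

section Integral

variable {L : Type*} [AddCommGroup L] [Module ℤ L] {a : (T →₀ ℤ) →ₗ[ℤ] L}

/-- The homomorphism on `C_c(X, ℤ)` induced by a finitely additive function on cells. -/
def integral (ha : a ∘ₗ 𝒮.refine = a) : C_c(X, ℤ) →ₗ[ℤ] L :=
  (LinearMap.ker 𝒮.realize).liftQ a (by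
    rw [ker_realize]
    rintro _ ⟨D, rfl⟩
    rw [LinearMap.mem_ker, LinearMap.sub_apply, map_sub, ← LinearMap.comp_apply, ha,
      Module.End.one_apply, sub_self]) ∘ₗ
  (𝒮.realize.quotKerEquivOfSurjective 𝒮.realize_surjective).symm

theorem integral_realize (ha : a ∘ₗ 𝒮.refine = a) (F : T →₀ ℤ) :
    𝒮.integral ha (𝒮.realize F) = a F := by
  have h : (𝒮.realize.quotKerEquivOfSurjective 𝒮.realize_surjective).symm (𝒮.realize F)
      = Submodule.Quotient.mk F :=
    (LinearEquiv.symm_apply_eq _).2 rfl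
  rw [integral, LinearMap.comp_apply, LinearEquiv.coe_coe, h, Submodule.liftQ_apply]

end Integral

end Subdivision

section IndLimit

variable {V : Type*} {M : Matrix V V ℤ}

instance directedSystem_rowMap (hM : RowFinite M) :
    DirectedSystem (fun _ : ℕ => V →₀ ℤ) fun i j (_ : i ≤ j) => ⇑(rowMap hM ^ (j - i)) where
  map_self i x := by rw [Nat.sub_self, pow_zero, Module.End.one_apply]
  map_map k j i hij hjk x := by
    rw [← Module.End.mul_apply, ← pow_add]
    congr 2
    omega

theorem toLim_pow (hM : RowFinite M) (i j : ℕ) (x : V →₀ ℤ) :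
    toLim hM (i + j) ((rowMap hM ^ j) x) = toLim hM i x := by
  have h := Module.DirectLimit.of_f (R := ℤ) (G := fun _ : ℕ => V →₀ ℤ)
    (f := fun i j (_ : i ≤ j) => rowMap hM ^ (j - i)) (hij := Nat.le_add_right i j) (x := x)
  rwa [Nat.add_sub_cancel_left] at h

theorem toLim_rowMap (hM : RowFinite M) (i : ℕ) (x : V →₀ ℤ) :
    toLim hM (i + 1) (rowMap hM x) = toLim hM i x := by
  have h := toLim_pow hM i 1 x
  rwa [pow_one] at h

theorem exists_pow_rowMap_eq_zero (hM : RowFinite M) {i : ℕ} {x : V →₀ ℤ}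
    (h : toLim hM i x = 0) : ∃ j, (rowMap hM ^ j) x = 0 := by
  obtain ⟨j, _, hj⟩ := Module.DirectLimit.of.zero_exact (R := ℤ) (G := fun _ : ℕ => V →₀ ℤ)
    (f := fun i j (_ : i ≤ j) => rowMap hM ^ (j - i)) h
  exact ⟨j - i, hj⟩

theorem exists_toLim_eq (hM : RowFinite M) (y : IndLim hM) : ∃ i x, toLim hM i x = y :=
  Module.DirectLimit.exists_of y

theorem rowMap_single (hM : RowFinite M) (v : V) :
    rowMap hM (Finsupp.single v 1) = Finsupp.ofSupportFinite (M v) (hM v) := by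
  rw [rowMap, Finsupp.linearCombination_single, one_smul]

end IndLimit

namespace Subdivision

variable {X T V : Type*} [TopologicalSpace X] (𝒮 : Subdivision X T) {M : Matrix V V ℤ}
  (hM : RowFinite M) (w : T → V →₀ ℤ)

/-- The extension to formal sums of `t ↦ φ_{n,∞}(w(t))`, for `n` the level of the cell `t`. -/
def limValue : (T →₀ ℤ) →ₗ[ℤ] IndLim hM :=
  Finsupp.linearCombination ℤ fun t => toLim hM (𝒮.lev t) (w t)

variable {𝒮 w} in
theorem limValue_of_mem_level {n : ℕ} {F : T →₀ ℤ} (hF : F ∈ 𝒮.level n) :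
    𝒮.limValue hM w F = toLim hM n (Finsupp.linearCombination ℤ w F) := by
  rw [Finsupp.apply_linearCombination]
  exact linearCombination_congr_of_mem_supported hF fun t ht => by rw [ht]; rfl

variable {w} (hw : ∀ t, ∑ c ∈ 𝒮.children t, w c = rowMap hM (w t))
include hw

theorem limValue_comp_refine : 𝒮.limValue hM w ∘ₗ 𝒮.refine = 𝒮.limValue hM w := by
  ext t : 2
  change 𝒮.limValue hM w (𝒮.refine (Finsupp.single t 1)) = 𝒮.limValue hM w (Finsupp.single t 1)
  simp only [refine_single, map_sum, limValue, Finsupp.linearCombination_single, one_smul]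
  rw [← toLim_rowMap, ← hw, map_sum]
  exact Finset.sum_congr rfl fun c hc => by rw [𝒮.lev_child t c hc]

theorem linearCombination_comp_refine :
    Finsupp.linearCombination ℤ w ∘ₗ 𝒮.refine = rowMap hM ∘ₗ Finsupp.linearCombination ℤ w := by
  ext t : 2
  change Finsupp.linearCombination ℤ w (𝒮.refine (Finsupp.single t 1))
    = rowMap hM (Finsupp.linearCombination ℤ w (Finsupp.single t 1))
  simp only [refine_single, map_sum, Finsupp.linearCombination_single, one_smul, hw]

variable [T2Space X]

/-- The homomorphism `1_{cell t} ↦ φ_{n,∞}(w(t))`, for `n` the level of the cell `t`. -/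
def limIntegral : C_c(X, ℤ) →ₗ[ℤ] IndLim hM := 𝒮.integral (𝒮.limValue_comp_refine hM hw)

theorem limIntegral_cellInd (t : T) :
    𝒮.limIntegral hM hw (𝒮.cellInd t) = toLim hM (𝒮.lev t) (w t) := by
  rw [limIntegral, ← realize_single, integral_realize, limValue, Finsupp.linearCombination_single,
    one_smul]

theorem exists_of_limIntegral_eq_zero {f : C_c(X, ℤ)} (hf : 𝒮.limIntegral hM hw f = 0) :
    ∃ n, ∃ F ∈ 𝒮.level n, 𝒮.realize F = f ∧ Finsupp.linearCombination ℤ w F = 0 := by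
  obtain ⟨n, F, hF, rfl⟩ := 𝒮.exists_mem_level_realize_eq f
  rw [limIntegral, integral_realize, limValue_of_mem_level hM hF] at hf
  obtain ⟨j, hj⟩ := exists_pow_rowMap_eq_zero hM hf
  refine ⟨n + j, (𝒮.refine ^ j) F, refine_pow_mem_level hF j, ?_, ?_⟩
  · have h := 𝒮.refine_pow_sub_mem_range j F
    rwa [← ker_realize, LinearMap.sub_mem_ker_iff] at h
  · have h := Module.End.commute_pow_left_of_commute (𝒮.linearCombination_comp_refine hM hw).symm j
    exact (LinearMap.congr_fun h F).symm.trans hj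

end Subdivision

section CompCells

variable {G X T : Type*} [TopologicalSpace G] [TopologicalSpace X]

open Classical in
/-- The subdivision of the space of composable pairs of `𝒢` into the sets `pairs U W` of composable
pairs, for cells `U` and `W` of the same level with `src '' U = rng '' W`. -/
def Subdivision.compCells (𝒮 : Subdivision G T) (𝒢 : EtaleGroupoid G X)
    (hcomp : ∀ t t' g h, 𝒮.lev t = 𝒮.lev t' → g ∈ 𝒮.cell t → h ∈ 𝒮.cell t' →
      𝒢.src g = 𝒢.rng h → 𝒢.src '' 𝒮.cell t = 𝒢.rng '' 𝒮.cell t') :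
    Subdivision 𝒢.Comp
      {p : T × T // 𝒮.lev p.1 = 𝒮.lev p.2 ∧ 𝒢.src '' 𝒮.cell p.1 = 𝒢.rng '' 𝒮.cell p.2} where
  lev p := 𝒮.lev p.1.1
  cell p := 𝒢.pairs (𝒮.cell p.1.1) (𝒮.cell p.1.2)
  children p := (𝒮.children p.1.1 ×ˢ 𝒮.children p.1.2).subtype _
  isCompact_cell p := 𝒢.isCompact_pairs (𝒮.isCompact_cell _) (𝒮.isCompact_cell _)
  isOpen_cell p := 𝒢.isOpen_pairs (𝒮.isOpen_cell _) (𝒮.isOpen_cell _)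
  nonempty_cell p := by
    obtain ⟨g, hg⟩ := 𝒮.nonempty_cell p.1.1
    obtain ⟨h, hh, hgh⟩ : 𝒢.src g ∈ 𝒢.rng '' 𝒮.cell p.1.2 := p.2.2 ▸ mem_image_of_mem _ hg
    exact ⟨⟨(g, h), hgh.symm⟩, hg, hh⟩
  eq_of_mem p p' x hl hx hx' := Subtype.ext <| Prod.ext (𝒮.eq_of_mem _ _ _ hl hx.1 hx'.1)
    (𝒮.eq_of_mem _ _ _ (p.2.1.symm.trans (hl.trans p'.2.1)) hx.2 hx'.2)
  lev_child p c hc := 𝒮.lev_child _ _ (Finset.mem_product.1 (Finset.mem_subtype.1 hc)).1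
  child_subset p c hc x hx :=
    have hc := Finset.mem_product.1 (Finset.mem_subtype.1 hc)
    ⟨𝒮.child_subset _ _ hc.1 hx.1, 𝒮.child_subset _ _ hc.2 hx.2⟩
  exists_child p x hx := by
    obtain ⟨c, hc, hxc⟩ := 𝒮.exists_child _ _ hx.1
    obtain ⟨c', hc', hxc'⟩ := 𝒮.exists_child _ _ hx.2
    have hl : 𝒮.lev c = 𝒮.lev c' := by rw [𝒮.lev_child _ c hc, 𝒮.lev_child _ c' hc', p.2.1]
    exact ⟨⟨(c, c'), hl, hcomp c c' _ _ hl hxc hxc' x.2⟩,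
      Finset.mem_subtype.2 (Finset.mem_product.2 ⟨hc, hc'⟩), hxc, hxc'⟩
  exists_cell x U hU := by
    obtain ⟨N, hN, hNU⟩ := mem_nhds_induced _ x U |>.1 hU
    obtain ⟨N₁, hN₁, N₂, hN₂, hNN⟩ := mem_nhds_prod_iff.1 hN
    obtain ⟨t₁, hxt₁, ht₁⟩ := 𝒮.exists_cell _ N₁ hN₁
    obtain ⟨t₂, hxt₂, ht₂⟩ := 𝒮.exists_cell _ N₂ hN₂
    obtain ⟨c₁, hl₁, hxc₁, hc₁⟩ := 𝒮.exists_cell_of_lev_le hxt₁ (le_max_left _ (𝒮.lev t₂))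
    obtain ⟨c₂, hl₂, hxc₂, hc₂⟩ := 𝒮.exists_cell_of_lev_le hxt₂ (le_max_right (𝒮.lev t₁) _)
    have hl := hl₁.trans hl₂.symm
    exact ⟨⟨(c₁, c₂), hl, hcomp c₁ c₂ _ _ hl hxc₁ hxc₂ x.2⟩, ⟨hxc₁, hxc₂⟩,
      fun z hz => hNU (hNN ⟨ht₁ (hc₁ hz.1), ht₂ (hc₂ hz.2)⟩)⟩

end CompCells

section Edges

variable {V : Type*} {A B : Matrix V V ℤ}

/-- The edges with source `v`. -/
def edgesFrom (hA : RowFinite A) (v : V) : Finset (Edge A) := (Edge.finite_source hA v).toFinset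

theorem mem_edgesFrom (hA : RowFinite A) {v : V} {e : Edge A} : e ∈ edgesFrom hA v ↔ v = e.s := by
  rw [edgesFrom, Set.Finite.mem_toFinset]
  exact eq_comm

theorem sum_edgesFrom_apply (hA : RowFinite A) (f : V → V → ℤ → ℤ) (v w : V) :
    (∑ e ∈ edgesFrom hA v, f e.s e.r e.idx • Finsupp.single e.r (1 : ℤ)) w
      = ∑ n ∈ Finset.range (A v w).toNat, f v w n := by
  classical
  rw [Finsupp.finsetSum_apply]
  simp only [Finsupp.smul_apply, Finsupp.single_apply, smul_eq_mul, mul_ite, _root_.mul_one,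
    mul_zero]
  rw [← Finset.sum_filter]
  have h_edge : ∀ e ∈ {e ∈ edgesFrom hA v | e.r = w}, v = e.s ∧ w = e.r := fun e he =>
    (Finset.mem_filter.1 he).imp (mem_edgesFrom hA).1 Eq.symm
  refine Finset.sum_bij' (fun e _ => e.idx.toNat)
    (fun n hn => ⟨v, w, n, Int.natCast_nonneg n, Int.lt_toNat.1 (Finset.mem_range.1 hn)⟩)
    (fun e he => ?_) (fun n hn => ?_) (fun e he => ?_) (fun n _ => Int.toNat_natCast n)
    (fun e he => ?_)
  · obtain ⟨rfl, rfl⟩ := h_edge e he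
    exact Finset.mem_range.2 (Int.toNat_lt_toNat e.pos |>.2 e.lt)
  · exact Finset.mem_filter.2 ⟨(mem_edgesFrom hA).2 rfl, rfl⟩
  · obtain ⟨rfl, rfl⟩ := h_edge e he
    exact Edge.ext rfl rfl (Int.toNat_of_nonneg e.nonneg)
  · obtain ⟨rfl, rfl⟩ := h_edge e he
    rw [Int.toNat_of_nonneg e.nonneg]

theorem sum_range_add_one_ediv {a : ℕ} (ha : 0 < a) (c : ℤ) :
    ∑ n ∈ Finset.range a, (c + 1 + n) / (a : ℤ) = ∑ n ∈ Finset.range a, (c + n) / (a : ℤ) + 1 := by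
  have ha' : (a : ℤ) ≠ 0 := Nat.cast_ne_zero.2 ha.ne'
  have h_shift : ∀ n : ℕ, (c + 1 + n) / (a : ℤ) = (c + (n + 1 : ℕ)) / (a : ℤ) := fun n => by
    rw [Nat.cast_succ, add_assoc, add_comm 1]
  have h_last : (c + (a : ℤ)) / (a : ℤ) = c / a + 1 := by
    simpa only [_root_.one_mul] using Int.add_mul_ediv_right c 1 ha'
  have h := Finset.sum_range_succ (fun n : ℕ => (c + n) / (a : ℤ)) a
  rw [Finset.sum_range_succ', h_last, Nat.cast_zero, add_zero] at h
  simp only [h_shift]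
  linarith

theorem sum_range_add_ediv {a : ℕ} (ha : 0 < a) (c : ℤ) :
    ∑ n ∈ Finset.range a, (c + n) / (a : ℤ) = c := by
  induction c using Int.induction_on with
  | zero =>
    refine Finset.sum_eq_zero fun n hn => ?_
    rw [zero_add]
    exact Int.ediv_eq_zero_of_lt (Int.natCast_nonneg n) (Nat.cast_lt.2 (Finset.mem_range.1 hn))
  | succ i ih => rw [sum_range_add_one_ediv ha, ih]
  | pred i ih =>
    have h := sum_range_add_one_ediv ha (-(i : ℤ) - 1)
    rw [sub_add_cancel, ih] at h
    linarith

theorem sum_single_r (hA : RowFinite A) (hnn : ∀ i j, 0 ≤ A i j) (v : V) :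
    ∑ e ∈ edgesFrom hA v, Finsupp.single e.r (1 : ℤ) = rowMap hA (Finsupp.single v 1) := by
  ext w
  have h := sum_edgesFrom_apply hA (fun _ _ _ => 1) v w
  simp only [one_smul, Finset.sum_const, Finset.card_range, nsmul_eq_mul, _root_.mul_one] at h
  rw [h, rowMap_single]
  exact Int.toNat_of_nonneg (hnn v w)

theorem sum_coc_single_r (hA : RowFinite A) (hB : RowFinite B) (hnn : ∀ i j, 0 ≤ A i j)
    (hAB : ∀ i j, A i j = 0 → B i j = 0) (m : ℤ) (v : V) :
    ∑ e ∈ edgesFrom hA v, e.coc B m • Finsupp.single e.r (1 : ℤ)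
      = rowMap hB (m • Finsupp.single v 1) := by
  ext w
  rw [map_smul, rowMap_single]
  refine (sum_edgesFrom_apply hA (fun i j n => (m * B i j + n) / A i j) v w).trans ?_
  change _ = m * B v w
  rcases (hnn v w).eq_or_lt with h | h
  · rw [hAB v w h.symm, ← h, Int.toNat_zero, Finset.sum_range_zero, mul_zero]
  · have hc := sum_range_add_ediv (Int.lt_toNat.2 h) (m * B v w)
    rwa [Int.toNat_of_nonneg h.le] at hc

end Edges

section PathCells

variable {V : Type*} {A : Matrix V V ℤ}

theorem FinPath.r_of_mem_cyl {α : FinPath A} {x : InfPath A} (h : x ∈ cyl α) :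
    α.r = (x.1 α.len).s := by
  have hx : x.take α.len = α := h
  rw [← x.r_take, hx]

theorem mem_cyl_take (x : InfPath A) (n : ℕ) : x ∈ cyl (x.take n) := by
  change x.take (x.take n).len = x.take n
  rw [x.len_take]

theorem FinPath.eq_of_mem_cyl {α α' : FinPath A} (hl : α.len = α'.len) {x : InfPath A}
    (h : x ∈ cyl α) (h' : x ∈ cyl α') : α = α' := by
  have hx : x.take α.len = α := h
  have hx' : x.take α'.len = α' := h'
  rw [← hx, hl, hx']

theorem mem_cyl_snoc {α : FinPath A} {e : Edge A} (h : α.r = e.s) {x : InfPath A} :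
    x ∈ cyl (α.snoc e h) ↔ x ∈ cyl α ∧ x.1 α.len = e := by
  change x.take (α.snoc e h).len = _ ↔ _
  rw [FinPath.len_snoc, InfPath.take_succ]
  exact ⟨fun hx => FinPath.snoc_inj hx, fun hx => FinPath.snoc_congr _ _ hx.1 hx.2⟩

theorem exists_infPath (hrow : ∀ i, ∃ j, A i j ≠ 0) (hnn : ∀ i j, 0 ≤ A i j) (v : V) :
    ∃ y : InfPath A, (y.1 0).s = v := by
  choose f hf using hrow
  let e : V → Edge A := fun w => ⟨w, f w, 0, le_rfl, (hnn _ _).lt_of_ne (hf w).symm⟩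
  exact ⟨⟨fun n => e (f^[n] v), fun n => (Function.iterate_succ_apply' f n v).symm⟩, rfl⟩

theorem nonempty_cyl (hrow : ∀ i, ∃ j, A i j ≠ 0) (hnn : ∀ i j, 0 ≤ A i j) (α : FinPath A) :
    (cyl α).Nonempty := by
  obtain ⟨y, hy⟩ := exists_infPath hrow hnn α.r
  exact ⟨α.append y hy.symm, InfPath.take_append α y hy.symm⟩

/-- The extensions of a finite path by one edge. -/
def FinPath.children (hA : RowFinite A) (α : FinPath A) : Finset (FinPath A) :=
  (edgesFrom hA α.r).attach.map
    ⟨fun e => α.snoc e.1 ((mem_edgesFrom hA).1 e.2), fun _ _ h =>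
      Subtype.ext (FinPath.snoc_inj h).2⟩

theorem FinPath.mem_children (hA : RowFinite A) {α γ : FinPath A} :
    γ ∈ α.children hA ↔ ∃ e, ∃ h : α.r = e.s, α.snoc e h = γ := by
  refine Finset.mem_map.trans ⟨?_, ?_⟩
  · rintro ⟨e, -, he⟩
    exact ⟨e, (mem_edgesFrom hA).1 e.2, he⟩
  · rintro ⟨e, h, he⟩
    exact ⟨⟨e, (mem_edgesFrom hA).2 h⟩, Finset.mem_attach _ _, he⟩

theorem FinPath.sum_children_single_r (hA : RowFinite A) (hnn : ∀ i j, 0 ≤ A i j) (α : FinPath A) :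
    ∑ γ ∈ α.children hA, Finsupp.single γ.r (1 : ℤ) = rowMap hA (Finsupp.single α.r 1) := by
  rw [children, Finset.sum_map, ← sum_single_r hA hnn, ← Finset.sum_attach (edgesFrom hA α.r)]
  exact Finset.sum_congr rfl fun e _ =>
    congrArg (fun v => Finsupp.single v (1 : ℤ)) (FinPath.r_snoc α e.1 ((mem_edgesFrom hA).1 e.2))

/-- The partitions of the infinite path space into the cylinders of the paths of length `n`. -/
def pathCells (hA : RowFinite A) (hrow : ∀ i, ∃ j, A i j ≠ 0) (hnn : ∀ i j, 0 ≤ A i j) :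
    Subdivision (InfPath A) (FinPath A) where
  lev := FinPath.len
  cell := cyl
  children := FinPath.children hA
  isCompact_cell := isCompact_cyl hA
  isOpen_cell := isOpen_cyl
  nonempty_cell := nonempty_cyl hrow hnn
  eq_of_mem _ _ _ hl hx hx' := FinPath.eq_of_mem_cyl hl hx hx'
  lev_child α γ hγ := by
    obtain ⟨e, h, rfl⟩ := (FinPath.mem_children hA).1 hγ
    exact FinPath.len_snoc α e h
  child_subset α γ hγ x hx := by
    obtain ⟨e, h, rfl⟩ := (FinPath.mem_children hA).1 hγ
    exact ((mem_cyl_snoc h).1 hx).1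
  exists_child α x hx :=
    have h := FinPath.r_of_mem_cyl hx
    ⟨α.snoc _ h, (FinPath.mem_children hA).2 ⟨_, h, rfl⟩, (mem_cyl_snoc h).2 ⟨hx, rfl⟩⟩
  exists_cell x U hU := by
    obtain ⟨n, hn⟩ := InfPath.exists_cyl_subset hU
    exact ⟨x.take n, mem_cyl_take x n, hn n le_rfl⟩

end PathCells

section Bisections

variable {V : Type*} {A B : Matrix V V ℤ}

namespace KArrow

theorem src_mem_cyl {α β : FinPath A} {m : ℤ} {g : KArrow A B} (hg : g ∈ Z B α m β) :
    g.src ∈ cyl β := by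
  obtain ⟨q, rfl, rfl, rfl, rfl⟩ := hg
  exact q.hx

theorem lag_eq_of_mem_Z {α β : FinPath A} {m : ℤ} {g : KArrow A B} (hg : g ∈ Z B α m β) :
    g.lag = α.len - β.len := by
  obtain ⟨q, rfl, rfl, rfl, rfl⟩ := hg
  rfl

theorem eq_of_mem_Z (hp : PseudoFree A B) {α α' β β' : FinPath A} {m m' : ℤ} {g : KArrow A B}
    (h : β.len = β'.len) (hg : g ∈ Z B α m β) (hg' : g ∈ Z B α' m' β') :
    α = α' ∧ m = m' ∧ β = β' := by
  obtain ⟨q, rfl, rfl, rfl, rfl⟩ := hg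
  obtain ⟨q', rfl, rfl, rfl, hq⟩ := hg'
  obtain ⟨i, j, hij⟩ := mk_eq_mk hq
  have h_len := congrArg (fun q : Quad A => q.β.len) hij
  simp only [Quad.lenβ_iterate] at h_len
  obtain rfl : i = j := by omega
  obtain rfl := (next_injective hp).iterate i hij
  exact ⟨rfl, rfl, rfl⟩

theorem mul_mem_Z {α β γ : FinPath A} {m m' : ℤ} {g h : KArrow A B} (hg : g ∈ Z B α m β)
    (hh : h ∈ Z B β m' γ) (hgh : g.src = h.rng) : mul g h hgh ∈ Z B α (m + m') γ := by
  obtain ⟨q, rfl, rfl, rfl, rfl⟩ := hg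
  obtain ⟨q', hβ, rfl, rfl, rfl⟩ := hh
  rw [mul_mk q q' hgh hβ.symm]
  exact mk_mem_Z (q.mul q' hβ.symm)

theorem exists_mul_of_mem_Z {α β γ : FinPath A} (hβ : β.r = γ.r) {m m' : ℤ} {k : KArrow A B}
    (hk : k ∈ Z B α (m + m') γ) :
    ∃ g ∈ Z B α m β, ∃ h ∈ Z B β m' γ, ∃ hgh, mul g h hgh = k := by
  obtain ⟨q, rfl, hm, rfl, rfl⟩ := hk
  let qh : Quad A := ⟨β, m', q.β, q.x, hβ, q.hx⟩
  let qg : Quad A := ⟨q.α, m, β, qh.rng B, q.hr.trans hβ.symm, InfPath.take_append _ _ _⟩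
  refine ⟨mk B qg, ⟨qg, rfl, rfl, rfl, rfl⟩, mk B qh, ⟨qh, rfl, rfl, rfl, rfl⟩, rfl, ?_⟩
  rw [mul_mk qg qh rfl rfl]
  exact congrArg (mk B) (Quad.ext rfl hm.symm rfl rfl)

theorem inv_image_Z (α : FinPath A) (m : ℤ) (β : FinPath A) :
    inv '' Z B α m β = Z B β (-m) α := by
  refine Subset.antisymm (image_subset_iff.2 fun g => inv_mem_Z) fun g hg => ?_
  have hg' := inv_mem_Z hg
  rw [neg_neg] at hg'
  exact ⟨g.inv, hg', inv_inv g⟩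

theorem rng_injOn_Z (α : FinPath A) (m : ℤ) (β : FinPath A) : (Z B α m β).InjOn rng := by
  intro g hg k hk h
  rw [← inv_inv g, ← inv_inv k]
  refine congrArg inv (src_injOn_Z _ _ _ (inv_mem_Z hg) (inv_mem_Z hk) ?_)
  rw [src_inv, src_inv]
  exact h

theorem rng_image_Z {α β : FinPath A} (h : α.r = β.r) (m : ℤ) : rng '' Z B α m β = cyl α := by
  rw [← src_image_Z (B := B) h.symm (-m), ← inv_image_Z, image_image]
  exact image_congr' fun g => (src_inv g).symm

theorem isBisection_Z (hA : RowFinite A) (hp : PseudoFree A B) {α β : FinPath A} (h : α.r = β.r)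
    (m : ℤ) : (katsura hp).IsBisection (Z B α m β) where
  isCompact := isCompact_Z hA h m
  isOpen := isOpen_Z h m
  injOn_src := src_injOn_Z α m β
  injOn_rng := rng_injOn_Z α m β

theorem d1_image_pairs_Z (hp : PseudoFree A B) {α β γ : FinPath A} (hβ : β.r = γ.r) (m m' : ℤ) :
    (katsura hp).d1 '' (katsura hp).pairs (Z B α m β) (Z B β m' γ) = Z B α (m + m') γ := by
  refine Subset.antisymm (image_subset_iff.2 fun p hp => mul_mem_Z hp.1 hp.2 p.2) fun k hk => ?_
  obtain ⟨g, hg, h, hh, hgh, rfl⟩ := exists_mul_of_mem_Z hβ hk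
  exact ⟨⟨(g, h), hgh⟩, ⟨hg, hh⟩, rfl⟩

end KArrow

end Bisections

open KArrow

section ArrowCells

variable {V : Type*} {A B : Matrix V V ℤ}

variable (A) in
/-- The triples `(α, m, β)` with `r(α) = r(β)` and `|α| = |β|`, which label the basic compact open
bisections `Z(α, m, β; Z(β))` of `ℋ_{A,B}`. -/
@[ext] structure Triple where
  α : FinPath A
  m : ℤ
  β : FinPath A
  hr : α.r = β.r
  hl : α.len = β.len

namespace Triple

/-- The triple `(α κ_m(e), φ(m, e), βe)`. -/
def snoc (B : Matrix V V ℤ) (t : Triple A) (e : Edge A) (h : t.β.r = e.s) : Triple A where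
  α := t.α.snoc (e.act B t.m) (t.hr.trans h)
  m := e.coc B t.m
  β := t.β.snoc e h
  hr := by
    rw [FinPath.r_snoc, FinPath.r_snoc]
    rfl
  hl := by rw [FinPath.len_snoc, FinPath.len_snoc, t.hl]

theorem snoc_inj {t : Triple A} {e e' : Edge A} {h : t.β.r = e.s} {h' : t.β.r = e'.s}
    (heq : t.snoc B e h = t.snoc B e' h') : e = e' :=
  (FinPath.snoc_inj (show t.β.snoc e h = t.β.snoc e' h' from congrArg Triple.β heq)).2

/-- The labels of the cells into which `Z(α, m, β; Z(β))` is divided by the edges after `β`. -/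
def children (B : Matrix V V ℤ) (hA : RowFinite A) (t : Triple A) : Finset (Triple A) :=
  (edgesFrom hA t.β.r).attach.map
    ⟨fun e => t.snoc B e.1 ((mem_edgesFrom hA).1 e.2), fun _ _ h => Subtype.ext (snoc_inj h)⟩

theorem mem_children (hA : RowFinite A) {t c : Triple A} :
    c ∈ t.children B hA ↔ ∃ e, ∃ h : t.β.r = e.s, t.snoc B e h = c := by
  refine Finset.mem_map.trans ⟨?_, ?_⟩
  · rintro ⟨e, -, he⟩
    exact ⟨e, (mem_edgesFrom hA).1 e.2, he⟩
  · rintro ⟨e, h, he⟩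
    exact ⟨⟨e, (mem_edgesFrom hA).2 h⟩, Finset.mem_attach _ _, he⟩

theorem sum_children_m_smul_single_r (hA : RowFinite A) (hB : RowFinite B)
    (hnn : ∀ i j, 0 ≤ A i j) (hAB : ∀ i j, A i j = 0 → B i j = 0) (t : Triple A) :
    ∑ c ∈ t.children B hA, c.m • Finsupp.single c.β.r (1 : ℤ)
      = rowMap hB (t.m • Finsupp.single t.β.r 1) := by
  rw [children, Finset.sum_map, ← sum_coc_single_r hA hB hnn hAB,
    ← Finset.sum_attach (edgesFrom hA t.β.r)]
  exact Finset.sum_congr rfl fun e _ => congrArg (fun v => e.1.coc B t.m • Finsupp.single v (1 : ℤ))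
    (FinPath.r_snoc t.β e.1 ((mem_edgesFrom hA).1 e.2))

end Triple

theorem KArrow.mem_Z_snoc {t : Triple A} {e : Edge A} (h : t.β.r = e.s) {g : KArrow A B} :
    g ∈ Z B (t.snoc B e h).α (t.snoc B e h).m (t.snoc B e h).β
      ↔ g ∈ Z B t.α t.m t.β ∧ g.src.1 t.β.len = e := by
  constructor
  · intro hg
    obtain ⟨hβ, rfl⟩ := (mem_cyl_snoc h).1 (src_mem_cyl hg)
    exact ⟨Z_next ⟨t.α, t.m, t.β, g.src, t.hr, hβ⟩ hg, rfl⟩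
  · rintro ⟨⟨q, hα, hm, hβ, rfl⟩, he⟩
    obtain ⟨α, m, β, hr, hl⟩ := t
    obtain rfl : q.α = α := hα
    obtain rfl : q.m = m := hm
    obtain rfl : q.β = β := hβ
    obtain rfl : q.x.1 q.β.len = e := he
    exact ⟨q.next B, rfl, rfl, rfl, mk_next q⟩

/-- The partitions of `ℋ_{A,B}` into the sets `Z(α, m, β; Z(β))` with `|α| = |β| = n`. -/
def arrowCells (hA : RowFinite A) (hrow : ∀ i, ∃ j, A i j ≠ 0) (hnn : ∀ i j, 0 ≤ A i j)
    (hp : PseudoFree A B) : Subdivision {g : KArrow A B // (rho hp).toFun g = 0} (Triple A) where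
  lev t := t.β.len
  cell t := Subtype.val ⁻¹' Z B t.α t.m t.β
  children := Triple.children B hA
  isCompact_cell t := ((isBisection_Z hA hp t.hr t.m).kernel (rho hp)).isCompact
  isOpen_cell t := ((isBisection_Z hA hp t.hr t.m).kernel (rho hp)).isOpen
  nonempty_cell t := by
    obtain ⟨x, hx⟩ := nonempty_cyl hrow hnn t.β
    have hg := mk_mem_Z (B := B) ⟨t.α, t.m, t.β, x, t.hr, hx⟩
    exact ⟨⟨mk B _, (lag_eq_of_mem_Z hg).trans (sub_eq_zero.2 (congrArg Nat.cast t.hl))⟩, hg⟩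
  eq_of_mem t t' g h hg hg' := by
    obtain ⟨hα, hm, hβ⟩ := eq_of_mem_Z hp h hg hg'
    exact Triple.ext hα hm hβ
  lev_child t c hc := by
    obtain ⟨e, h, rfl⟩ := (Triple.mem_children hA).1 hc
    exact FinPath.len_snoc t.β e h
  child_subset t c hc g hg := by
    obtain ⟨e, h, rfl⟩ := (Triple.mem_children hA).1 hc
    exact ((mem_Z_snoc h).1 hg).1
  exists_child t g hg :=
    have h := FinPath.r_of_mem_cyl (src_mem_cyl hg)
    ⟨t.snoc B _ h, (Triple.mem_children hA).2 ⟨_, h, rfl⟩, (mem_Z_snoc h).2 ⟨hg, rfl⟩⟩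
  exists_cell g U hU := by
    obtain ⟨N, hN, hNU⟩ := mem_nhds_induced _ g U |>.1 hU
    obtain ⟨q, hq⟩ := exists_mk g.1
    obtain ⟨n, hn⟩ := exists_Z_subset (hq.symm ▸ hN)
    have hg := mk_mem_Z (B := B) ((Quad.next B)^[n] q)
    rw [mk_iterate, hq] at hg
    have h_lag := (lag_eq_of_mem_Z hg).symm.trans g.2
    exact ⟨⟨_, _, _, ((Quad.next B)^[n] q).hr, Nat.cast_injective (sub_eq_zero.1 h_lag)⟩, hg,
      (preimage_mono hn).trans hNU⟩

end ArrowCells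

open EtaleGroupoid

section CellBoundaries

variable {V : Type*} {A B : Matrix V V ℤ} (hA : RowFinite A) (hrow : ∀ i, ∃ j, A i j ≠ 0)
  (hnn : ∀ i j, 0 ≤ A i j) (hp : PseudoFree A B)

instance t2Space_kernel_rho : T2Space {g : KArrow A B // (rho hp).toFun g = 0} := (ℋ hp).t2_arrows

variable {hp} in
theorem Triple.rho_eq_zero_of_mem_Z {t : Triple A} {g : KArrow A B} (hg : g ∈ Z B t.α t.m t.β) :
    (rho hp).toFun g = 0 :=
  (lag_eq_of_mem_Z hg).trans (sub_eq_zero.2 (congrArg Nat.cast t.hl))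

theorem isBisection_arrowCells (t : Triple A) :
    (ℋ hp).IsBisection ((arrowCells hA hrow hnn hp).cell t) :=
  (isBisection_Z hA hp t.hr t.m).kernel (rho hp)

theorem src_image_arrowCells (t : Triple A) :
    (ℋ hp).src '' (arrowCells hA hrow hnn hp).cell t = cyl t.β :=
  (src_image_kernel fun _ => Triple.rho_eq_zero_of_mem_Z).trans (src_image_Z t.hr t.m)

theorem rng_image_arrowCells (t : Triple A) :
    (ℋ hp).rng '' (arrowCells hA hrow hnn hp).cell t = cyl t.α :=
  (rng_image_kernel fun _ => Triple.rho_eq_zero_of_mem_Z).trans (rng_image_Z t.hr t.m)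

theorem δ₁_arrowCells (t : Triple A) :
    (ℋ hp).δ₁ ((arrowCells hA hrow hnn hp).cellInd t)
      = (pathCells hA hrow hnn).cellInd t.β - (pathCells hA hrow hnn).cellInd t.α :=
  δ₁_ind (isBisection_arrowCells hA hrow hnn hp t) (src_image_arrowCells hA hrow hnn hp t)
    (rng_image_arrowCells hA hrow hnn hp t) _ _ _ _

/-- The label of the product of the cells labelled by `(α, m, β)` and `(β, m', γ)`. -/
def Triple.comp (t t' : Triple A) (h : t.β = t'.α) : Triple A where
  α := t.α
  m := t.m + t'.m
  β := t'.β
  hr := by rw [t.hr, h, t'.hr]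
  hl := by rw [t.hl, h, t'.hl]

theorem d1_image_pairs_arrowCells (t t' : Triple A) (h : t.β = t'.α) :
    (ℋ hp).d1 '' (ℋ hp).pairs ((arrowCells hA hrow hnn hp).cell t)
        ((arrowCells hA hrow hnn hp).cell t')
      = (arrowCells hA hrow hnn hp).cell (t.comp t' h) := by
  refine (d1_image_pairs_kernel (fun _ => Triple.rho_eq_zero_of_mem_Z)
    fun _ => Triple.rho_eq_zero_of_mem_Z).trans (congrArg _ ?_)
  rw [← h]
  exact d1_image_pairs_Z hp (h ▸ t'.hr) t.m t'.m

theorem δ₂_pairs_arrowCells (t t' : Triple A) (h : t.β = t'.α) :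
    (ℋ hp).δ₂ (ind ((ℋ hp).pairs ((arrowCells hA hrow hnn hp).cell t)
        ((arrowCells hA hrow hnn hp).cell t'))
      ((ℋ hp).isCompact_pairs ((arrowCells hA hrow hnn hp).isCompact_cell t)
        ((arrowCells hA hrow hnn hp).isCompact_cell t'))
      ((ℋ hp).isOpen_pairs ((arrowCells hA hrow hnn hp).isOpen_cell t)
        ((arrowCells hA hrow hnn hp).isOpen_cell t')))
      = (arrowCells hA hrow hnn hp).cellInd t'
        - (arrowCells hA hrow hnn hp).cellInd (t.comp t' h)
        + (arrowCells hA hrow hnn hp).cellInd t :=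
  δ₂_ind_pairs (isBisection_arrowCells hA hrow hnn hp t)
    (isBisection_arrowCells hA hrow hnn hp t')
    (by rw [src_image_arrowCells, rng_image_arrowCells, h])
    (d1_image_pairs_arrowCells hA hrow hnn hp t t' h) _ _

theorem src_image_eq_rng_image_arrowCells (t t' : Triple A)
    (g h : {g : KArrow A B // (rho hp).toFun g = 0})
    (hl : (arrowCells hA hrow hnn hp).lev t = (arrowCells hA hrow hnn hp).lev t')
    (hg : g ∈ (arrowCells hA hrow hnn hp).cell t) (hh : h ∈ (arrowCells hA hrow hnn hp).cell t')
    (hgh : (ℋ hp).src g = (ℋ hp).rng h) :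
    (ℋ hp).src '' (arrowCells hA hrow hnn hp).cell t
      = (ℋ hp).rng '' (arrowCells hA hrow hnn hp).cell t' := by
  have hgβ := mem_image_of_mem (ℋ hp).src hg
  have hhα := mem_image_of_mem (ℋ hp).rng hh
  rw [src_image_arrowCells] at hgβ ⊢
  rw [← hgh, rng_image_arrowCells] at hhα
  rw [rng_image_arrowCells, FinPath.eq_of_mem_cyl (Eq.trans hl t'.hl.symm) hgβ hhα]

end CellBoundaries

section Integrals

variable {V : Type*} {A B : Matrix V V ℤ} (hA : RowFinite A) (hrow : ∀ i, ∃ j, A i j ≠ 0)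
  (hnn : ∀ i j, 0 ≤ A i j) (hp : PseudoFree A B)

/-- The homomorphism `1_{Z(α)} ↦ φ_{n,∞}(1_{r(α)})`, `n = |α|`. -/
def pathIntegral : C_c(InfPath A, ℤ) →ₗ[ℤ] IndLim hA :=
  (pathCells hA hrow hnn).limIntegral hA (FinPath.sum_children_single_r hA hnn)

theorem pathIntegral_cellInd (α : FinPath A) :
    pathIntegral hA hrow hnn ((pathCells hA hrow hnn).cellInd α)
      = toLim hA α.len (Finsupp.single α.r 1) :=
  (pathCells hA hrow hnn).limIntegral_cellInd hA _ α

theorem pathIntegral_comp_δ₁ :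
    (pathIntegral hA hrow hnn).toAddMonoidHom.comp (ℋ hp).δ₁ = 0 := by
  refine (arrowCells hA hrow hnn hp).eq_zero_of_cellInd fun t => ?_
  change pathIntegral hA hrow hnn ((ℋ hp).δ₁ _) = 0
  rw [δ₁_arrowCells, map_sub, pathIntegral_cellInd, pathIntegral_cellInd, t.hr, t.hl, sub_self]

variable (hB : RowFinite B) (hAB : ∀ i j, A i j = 0 → B i j = 0)

/-- The homomorphism `1_{Z(α, m, β; Z(β))} ↦ m φ_{n,∞}(1_{r(β)})`, `n = |β|`. -/
def arrowIntegral : C_c({g : KArrow A B // (rho hp).toFun g = 0}, ℤ) →ₗ[ℤ] IndLim hB :=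
  (arrowCells hA hrow hnn hp).limIntegral hB (Triple.sum_children_m_smul_single_r hA hB hnn hAB)

theorem arrowIntegral_cellInd (t : Triple A) :
    arrowIntegral hA hrow hnn hp hB hAB ((arrowCells hA hrow hnn hp).cellInd t)
      = t.m • toLim hB t.β.len (Finsupp.single t.β.r 1) := by
  rw [← map_zsmul]
  exact (arrowCells hA hrow hnn hp).limIntegral_cellInd hB _ t

theorem arrowIntegral_comp_δ₂ :
    (arrowIntegral hA hrow hnn hp hB hAB).toAddMonoidHom.comp (ℋ hp).δ₂ = 0 := by
  refine ((arrowCells hA hrow hnn hp).compCells (ℋ hp)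
    (src_image_eq_rng_image_arrowCells hA hrow hnn hp)).eq_zero_of_cellInd ?_
  rintro ⟨⟨t, t'⟩, hl, hcyl⟩
  rw [src_image_arrowCells, rng_image_arrowCells] at hcyl
  obtain ⟨x, hx⟩ := nonempty_cyl hrow hnn t.β
  have h := FinPath.eq_of_mem_cyl (Eq.trans hl t'.hl.symm) hx (hcyl ▸ hx)
  have hr : t.β.r = t'.β.r := by rw [h, t'.hr]
  change arrowIntegral hA hrow hnn hp hB hAB ((ℋ hp).δ₂ (ind ((ℋ hp).pairs _ _) _ _)) = 0
  rw [δ₂_pairs_arrowCells hA hrow hnn hp t t' h, map_add, map_sub, arrowIntegral_cellInd,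
    arrowIntegral_cellInd, arrowIntegral_cellInd, hr, show t.β.len = t'.β.len from hl]
  change t'.m • _ - (t.m + t'.m) • toLim hB t'.β.len (Finsupp.single t'.β.r 1) + t.m • _ = 0
  rw [add_smul]
  abel

end Integrals

section Kernels

variable {V : Type*} {A B : Matrix V V ℤ} (hA : RowFinite A) (hrow : ∀ i, ∃ j, A i j ≠ 0)
  (hnn : ∀ i j, 0 ≤ A i j) (hp : PseudoFree A B)

theorem mk_cellInd_eq_of_r_eq {α β : FinPath A} (hr : α.r = β.r) (hl : α.len = β.len) :
    ((pathCells hA hrow hnn).cellInd α : C_c(InfPath A, ℤ) ⧸ (ℋ hp).δ₁.range)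
      = (pathCells hA hrow hnn).cellInd β := by
  refine QuotientAddGroup.eq.2 ⟨(arrowCells hA hrow hnn hp).cellInd ⟨α, 0, β, hr, hl⟩, ?_⟩
  rw [δ₁_arrowCells, sub_eq_neg_add]

theorem mem_range_δ₁_of_pathIntegral_eq_zero {f : C_c(InfPath A, ℤ)}
    (hf : pathIntegral hA hrow hnn f = 0) : f ∈ (ℋ hp).δ₁.range := by
  obtain ⟨n, F, hF, rfl, h0⟩ := (pathCells hA hrow hnn).exists_of_limIntegral_eq_zero hA
    (FinPath.sum_children_single_r hA hnn) hf
  rw [← QuotientAddGroup.eq_zero_iff]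
  have h := linearCombination_eq_zero_of_factors (k := fun _ => 1) (r := FinPath.r) hF
    (fun α hα β hβ hr => mk_cellInd_eq_of_r_eq hA hrow hnn hp hr (Eq.trans hα hβ.symm))
    (by simpa only [one_smul] using h0)
  simp only [one_smul] at h
  exact ((pathCells hA hrow hnn).map_realize (QuotientAddGroup.mk' (ℋ hp).δ₁.range) F).trans h

/-- The class of `1_{Z(α, m, β; Z(β))}` modulo the image of `δ₂`. -/
def arrowClass (t : Triple A) :
    C_c({g : KArrow A B // (rho hp).toFun g = 0}, ℤ) ⧸ (ℋ hp).δ₂.range :=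
  (arrowCells hA hrow hnn hp).cellInd t

theorem arrowClass_add {α β γ : FinPath A} (hr : α.r = β.r) (hl : α.len = β.len)
    (hr' : β.r = γ.r) (hl' : β.len = γ.len) (m m' : ℤ) :
    arrowClass hA hrow hnn hp ⟨α, m + m', γ, hr.trans hr', hl.trans hl'⟩
      = arrowClass hA hrow hnn hp ⟨α, m, β, hr, hl⟩
        + arrowClass hA hrow hnn hp ⟨β, m', γ, hr', hl'⟩ := by
  refine QuotientAddGroup.eq.2 ⟨_, (δ₂_pairs_arrowCells hA hrow hnn hp ⟨α, m, β, hr, hl⟩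
    ⟨β, m', γ, hr', hl'⟩ rfl).trans ?_⟩
  rw [neg_add_eq_sub, sub_add_eq_add_sub, add_comm]
  rfl

theorem arrowClass_loop (β : FinPath A) (m : ℤ) :
    arrowClass hA hrow hnn hp ⟨β, m, β, rfl, rfl⟩
      = m • arrowClass hA hrow hnn hp ⟨β, 1, β, rfl, rfl⟩ := by
  let φ : ℤ →+ C_c({g : KArrow A B // (rho hp).toFun g = 0}, ℤ) ⧸ (ℋ hp).δ₂.range :=
    AddMonoidHom.mk' (fun m => arrowClass hA hrow hnn hp ⟨β, m, β, rfl, rfl⟩)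
      (arrowClass_add hA hrow hnn hp rfl rfl rfl rfl)
  have h := map_zsmul φ m 1
  rwa [smul_eq_mul, _root_.mul_one] at h

theorem arrowClass_eq_add_smul (t : Triple A) :
    arrowClass hA hrow hnn hp t = arrowClass hA hrow hnn hp ⟨t.α, 0, t.β, t.hr, t.hl⟩
      + t.m • arrowClass hA hrow hnn hp ⟨t.β, 1, t.β, rfl, rfl⟩ := by
  have h := arrowClass_add hA hrow hnn hp t.hr t.hl rfl rfl 0 t.m
  rw [arrowClass_loop] at h
  simpa only [zero_add] using h

theorem arrowClass_loop_eq_of_r_eq {α β : FinPath A} (hr : α.r = β.r) (hl : α.len = β.len) :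
    arrowClass hA hrow hnn hp ⟨α, 1, α, rfl, rfl⟩
      = arrowClass hA hrow hnn hp ⟨β, 1, β, rfl, rfl⟩ := by
  have h₁ := arrowClass_add hA hrow hnn hp hr hl rfl rfl 0 1
  have h₂ := arrowClass_add hA hrow hnn hp rfl rfl hr hl 1 0
  exact add_right_cancel ((h₂.symm.trans h₁).trans (add_comm _ _))

/-- A path with the length and the range of `α`, chosen depending on these only. -/
def FinPath.base (α : FinPath A) : FinPath A :=
  haveI : Nonempty (FinPath A) := ⟨α⟩
  Function.invFunOn FinPath.r {γ | γ.len = α.len} α.r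

theorem FinPath.base_spec (α : FinPath A) : α.base.len = α.len ∧ α.base.r = α.r := by
  have : Nonempty (FinPath A) := ⟨α⟩
  have h : α.r ∈ FinPath.r '' {γ : FinPath A | γ.len = α.len} := mem_image_of_mem _ rfl
  exact ⟨Function.invFunOn_mem h, Function.invFunOn_eq h⟩

theorem FinPath.base_congr {α β : FinPath A} (hr : α.r = β.r) (hl : α.len = β.len) :
    α.base = β.base := by
  rw [base, base, hr, hl]

theorem arrowClass_zero_eq_sub {α β : FinPath A} (hr : α.r = β.r) (hl : α.len = β.len) :
    arrowClass hA hrow hnn hp ⟨α, 0, β, hr, hl⟩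
      = arrowClass hA hrow hnn hp ⟨α, 0, α.base, α.base_spec.2.symm, α.base_spec.1.symm⟩
        - arrowClass hA hrow hnn hp ⟨β, 0, β.base, β.base_spec.2.symm, β.base_spec.1.symm⟩ := by
  have h := arrowClass_add hA hrow hnn hp hr hl β.base_spec.2.symm β.base_spec.1.symm 0 0
  simp only [FinPath.base_congr hr hl]
  exact eq_sub_of_add_eq h.symm

theorem linearCombination_boundary_eq_zero {n : ℕ} {F : Triple A →₀ ℤ}
    (hF : F ∈ (arrowCells hA hrow hnn hp).level n)
    (h0 : (ℋ hp).δ₁ ((arrowCells hA hrow hnn hp).realize F) = 0) :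
    Finsupp.linearCombination ℤ
      (fun t : Triple A => Finsupp.single t.β (1 : ℤ) - Finsupp.single t.α 1) F = 0 := by
  refine (pathCells hA hrow hnn).eq_zero_of_realize_eq_zero (n := n)
    (Subdivision.linearCombination_mem_of_mem_level hF fun t ht => Submodule.sub_mem _
      (Subdivision.single_mem_level (𝒮 := pathCells hA hrow hnn) ht 1)
      (Subdivision.single_mem_level (𝒮 := pathCells hA hrow hnn) (t.hl.trans ht) 1)) ?_
  rw [← h0, Subdivision.map_realize, Finsupp.apply_linearCombination]
  congr 2
  ext1 t
  rw [Function.comp_apply, map_sub, Subdivision.realize_single, Subdivision.realize_single,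
    δ₁_arrowCells]

theorem linearCombination_arrowClass_zero {n : ℕ} {F : Triple A →₀ ℤ}
    (hF : F ∈ (arrowCells hA hrow hnn hp).level n)
    (h0 : (ℋ hp).δ₁ ((arrowCells hA hrow hnn hp).realize F) = 0) :
    Finsupp.linearCombination ℤ
      (fun t => arrowClass hA hrow hnn hp ⟨t.α, 0, t.β, t.hr, t.hl⟩) F = 0 := by
  have h := congrArg (Finsupp.linearCombination ℤ fun α : FinPath A =>
      -arrowClass hA hrow hnn hp ⟨α, 0, α.base, α.base_spec.2.symm, α.base_spec.1.symm⟩)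
    (linearCombination_boundary_eq_zero hA hrow hnn hp hF h0)
  rw [map_zero, Finsupp.apply_linearCombination] at h
  rw [← h]
  congr 2
  ext1 t
  rw [Function.comp_apply, map_sub, Finsupp.linearCombination_single,
    Finsupp.linearCombination_single, one_smul, one_smul, neg_sub_neg, arrowClass_zero_eq_sub]

theorem mem_range_δ₂_of_arrowIntegral_eq_zero (hB : RowFinite B)
    (hAB : ∀ i j, A i j = 0 → B i j = 0)
    {f : C_c({g : KArrow A B // (rho hp).toFun g = 0}, ℤ)}
    (hf : arrowIntegral hA hrow hnn hp hB hAB f = 0) (hf' : (ℋ hp).δ₁ f = 0) :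
    f ∈ (ℋ hp).δ₂.range := by
  obtain ⟨n, F, hF, rfl, h0⟩ := (arrowCells hA hrow hnn hp).exists_of_limIntegral_eq_zero hB
    (Triple.sum_children_m_smul_single_r hA hB hnn hAB) hf
  have h_loops := linearCombination_eq_zero_of_factors hF
    (fun t ht t' ht' hr => arrowClass_loop_eq_of_r_eq hA hrow hnn hp hr (Eq.trans ht ht'.symm)) h0
  have h_paths := linearCombination_arrowClass_zero hA hrow hnn hp hF hf'
  rw [← QuotientAddGroup.eq_zero_iff]
  refine ((arrowCells hA hrow hnn hp).map_realize
    (QuotientAddGroup.mk' (ℋ hp).δ₂.range) F).trans ?_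
  change Finsupp.linearCombination ℤ (arrowClass hA hrow hnn hp) F = 0
  rw [funext (arrowClass_eq_add_smul hA hrow hnn hp)]
  simp only [Finsupp.linearCombination_apply, smul_add, Finsupp.sum_add] at h_loops h_paths ⊢
  rw [h_paths, h_loops, add_zero]

end Kernels

section Reach

variable {V : Type*} {A M : Matrix V V ℤ}

/-- The ranges of the paths of length `n`. -/
def reach (A : Matrix V V ℤ) (n : ℕ) : Set V := {v | ∃ α : FinPath A, α.len = n ∧ α.r = v}

theorem reach_zero : reach A 0 = univ :=
  eq_univ_of_forall fun v => ⟨⟨v, [], nofun, nofun⟩, rfl, rfl⟩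

theorem mem_reach_succ (hnn : ∀ i j, 0 ≤ A i j) {v w : V} {n : ℕ} (hv : v ∈ reach A n)
    (h : A v w ≠ 0) : w ∈ reach A (n + 1) := by
  obtain ⟨α, rfl, rfl⟩ := hv
  let e : Edge A := ⟨α.r, w, 0, le_rfl, (hnn _ _).lt_of_ne h.symm⟩
  exact ⟨α.snoc e rfl, FinPath.len_snoc α e rfl, FinPath.r_snoc α e rfl⟩

theorem InfPath.s_mem_reach (x : InfPath A) (n : ℕ) : (x.1 n).s ∈ reach A n :=
  ⟨x.take n, x.len_take n, x.r_take n⟩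

theorem antitone_reach (hrow : ∀ i, ∃ j, A i j ≠ 0) (hnn : ∀ i j, 0 ≤ A i j) :
    Antitone (reach A) := by
  refine antitone_nat_of_succ_le fun n => ?_
  rintro _ ⟨α, hα, rfl⟩
  obtain ⟨x, hx⟩ := nonempty_cyl hrow hnn α
  rw [FinPath.r_of_mem_cyl hx, hα, add_comm]
  exact (x.drop 1).s_mem_reach n

theorem reach_eq_univ (hnn : ∀ i j, 0 ≤ A i j) (hcol : ∀ j, ∃ i, A i j ≠ 0) (n : ℕ) :
    reach A n = univ := by
  induction n with
  | zero => exact reach_zero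
  | succ n ih =>
    refine eq_univ_of_forall fun v => ?_
    obtain ⟨i, hi⟩ := hcol v
    exact mem_reach_succ hnn (ih ▸ mem_univ i) hi

theorem exists_forall_reach_subset (hrow : ∀ i, ∃ j, A i j ≠ 0) (hnn : ∀ i j, 0 ≤ A i j)
    (hcol : Finite V ∨ ∀ j, ∃ i, A i j ≠ 0) : ∃ N, ∀ n, reach A N ⊆ reach A n := by
  rcases hcol with hV | hcol
  · have hanti := antitone_reach hrow hnn
    let f : ℕ →o (Set V)ᵒᵈ := ⟨fun n => OrderDual.toDual (reach A n), hanti.dual_right⟩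
    obtain ⟨N, hN⟩ := WellFoundedGT.monotone_chain_condition f
    refine ⟨N, fun n => ?_⟩
    rcases le_total N n with h | h
    · exact (show reach A N = reach A n from hN n h).le
    · exact hanti h
  · exact ⟨0, fun n => (subset_univ _).trans (reach_eq_univ hnn hcol n).ge⟩

theorem support_pow_rowMap_subset_reach (hnn : ∀ i j, 0 ≤ A i j) (hM : RowFinite M)
    (hAM : ∀ i j, A i j = 0 → M i j = 0) (x : V →₀ ℤ) (n : ℕ) :
    ↑((rowMap hM ^ n) x).support ⊆ reach A n := by
  induction n with
  | zero => exact (subset_univ _).trans reach_zero.ge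
  | succ n ih =>
    intro w hw
    rw [pow_succ', Module.End.mul_apply, rowMap, Finsupp.linearCombination_apply, Finsupp.sum,
      Finset.mem_coe, Finsupp.mem_support_iff, Finsupp.finsetSum_apply] at hw
    obtain ⟨v, hv, hvw⟩ := Finset.exists_ne_zero_of_sum_ne_zero hw
    refine mem_reach_succ hnn (ih hv) fun h => hvw ?_
    rw [Finsupp.smul_apply, smul_eq_mul]
    exact mul_eq_zero_of_right _ (hAM v w h)

variable (hrow : ∀ i, ∃ j, A i j ≠ 0) (hnn : ∀ i j, 0 ≤ A i j)
  (hcol : Finite V ∨ ∀ j, ∃ i, A i j ≠ 0) (hM : RowFinite M)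
  (hAM : ∀ i j, A i j = 0 → M i j = 0)

include hrow hnn hcol hAM

theorem eq_top_of_single_mem {P : ℕ → AddSubgroup (V →₀ ℤ)}
    (hP : ∀ n x, rowMap hM x ∈ P (n + 1) → x ∈ P n)
    (h : ∀ n v, (∀ k, v ∈ reach A k) → Finsupp.single v 1 ∈ P n) (n : ℕ) : P n = ⊤ := by
  have hP_pow : ∀ j n x, (rowMap hM ^ j) x ∈ P (n + j) → x ∈ P n := by
    intro j
    induction j with
    | zero => exact fun _ _ hx => hx
    | succ j ih =>
      intro n x hx
      rw [pow_succ, Module.End.mul_apply, ← add_assoc, add_right_comm] at hx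
      exact hP n x (ih (n + 1) _ hx)
  obtain ⟨N, hN⟩ := exists_forall_reach_subset hrow hnn hcol
  refine eq_top_iff.2 fun x _ => hP_pow N n x ?_
  rw [← ((rowMap hM ^ N) x).sum_single]
  refine sum_mem fun v hv => ?_
  have hv_reach : ∀ k, v ∈ reach A k := fun k =>
    hN k (support_pow_rowMap_subset_reach hnn hM hAM x N hv)
  rw [← Finsupp.smul_single_one]
  exact zsmul_mem (h _ v hv_reach) _

theorem surjective_of_toLim_mem_range {L : Type*} [AddCommGroup L] {Φ : L →+ IndLim hM}
    (hΦ : ∀ α : FinPath A, toLim hM α.len (Finsupp.single α.r 1) ∈ Φ.range) :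
    Function.Surjective Φ := by
  intro y
  obtain ⟨n, x, rfl⟩ := exists_toLim_eq hM y
  have h := eq_top_of_single_mem hrow hnn hcol hM hAM
    (P := fun n => Φ.range.comap (toLim hM n).toAddMonoidHom)
    (fun n x hx => (congrArg (· ∈ Φ.range) (toLim_rowMap hM n x)).mp hx) (fun n v hv => by
      obtain ⟨α, rfl, rfl⟩ := hv n
      exact hΦ α) n
  exact h.ge (AddSubgroup.mem_top x)

theorem apply_symm_toLim_eq_toLim_succ {L : Type*} [AddCommGroup L] (Φ : L ≃+ IndLim hM)
    (τ : L →+ L) (c : FinPath A → L)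
    (hΦ : ∀ α, Φ (c α) = toLim hM α.len (Finsupp.single α.r 1))
    (hτ : ∀ α α' : FinPath A, α'.r = α.r → α'.len = α.len + 1 → τ (c α) = c α')
    (i : ℕ) (x : V →₀ ℤ) : Φ (τ (Φ.symm (toLim hM i x))) = toLim hM (i + 1) x := by
  let shift : ℕ → (V →₀ ℤ) →+ IndLim hM := fun n =>
    ((Φ.toAddMonoidHom.comp τ).comp Φ.symm.toAddMonoidHom).comp (toLim hM n).toAddMonoidHom
  have h_shift : ∀ n x, shift (n + 1) (rowMap hM x) = shift n x := fun n x =>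
    congrArg (fun y => Φ (τ (Φ.symm y))) (toLim_rowMap hM n x)
  have h := eq_top_of_single_mem hrow hnn hcol hM hAM
    (P := fun n => (shift n).eqLocus (toLim hM (n + 1)).toAddMonoidHom)
    (fun n x hx => (h_shift n x).symm.trans (Eq.trans hx (toLim_rowMap hM (n + 1) x)))
    (fun n v hv => by
      obtain ⟨α, rfl, rfl⟩ := hv n
      obtain ⟨α', hl, hr⟩ := hv (α.len + 1)
      change Φ (τ (Φ.symm (toLim hM α.len (Finsupp.single α.r 1))))
        = toLim hM (α.len + 1) (Finsupp.single α.r 1)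
      rw [← hΦ, AddEquiv.symm_apply_apply, hτ α α' hr hl, hΦ, hl, hr]) i
  exact h.ge (AddSubgroup.mem_top x)

end Reach

section Transversal

variable {V : Type*} {A B : Matrix V V ℤ}

theorem continuous_mk_of_eventually_eq {Y : Type*} [TopologicalSpace Y] {q : Y → Quad A}
    (hx : Continuous fun y => (q y).x)
    (h : ∀ y, ∀ᶠ y' in 𝓝 y, (q y').α = (q y).α ∧ (q y').m = (q y).m ∧ (q y').β = (q y).β) :
    Continuous fun y => mk B (q y) := by
  refine continuous_iff_continuousAt.2 fun y W hW => ?_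
  have h_src := hx.continuousAt (isLocalHomeomorph_src.isOpenMap.image_mem_nhds
    (Filter.inter_mem hW (Z_mem_nhds (B := B) (q y))))
  rw [Filter.mem_map]
  filter_upwards [h_src, h y] with y' ⟨g, ⟨hgW, hgZ⟩, hg⟩ ⟨hα, hm, hβ⟩
  have hZ : mk B (q y') ∈ Z B (q y).α (q y).m (q y).β := ⟨q y', hα, hm, hβ, rfl⟩
  have hgq : g = mk B (q y') := src_injOn_Z _ _ _ hgZ hZ hg
  exact show mk B (q y') ∈ W from hgq ▸ hgW

theorem nonempty_transversal (hrow : ∀ i, ∃ j, A i j ≠ 0) (hnn : ∀ i j, 0 ≤ A i j)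
    (hcol : Finite V ∨ ∀ j, ∃ i, A i j ≠ 0) (hp : PseudoFree A B) :
    Nonempty (Transversal (rho hp)) := by
  obtain ⟨N, hN⟩ := exists_forall_reach_subset hrow hnn hcol
  have hP : ∀ (j : ℕ) (v : reach A N), ∃ α : FinPath A, α.len = j ∧ α.r = v := fun j v => hN j v.2
  choose P hPl hPr using hP
  let b : ℤ → ℕ := fun k => N + k.natAbs
  have hb : ∀ (x : InfPath A) k, (x.take (b k)).r ∈ reach A N := fun x k => by
    rw [x.r_take]
    exact antitone_reach hrow hnn (Nat.le_add_right N k.natAbs) (x.s_mem_reach _)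
  -- Replace the first `b k` edges of `x` by a path that is longer by `k`.
  let q : InfPath A × ℤ → Quad A := fun y =>
    ⟨P (b y.2 + y.2).toNat ⟨_, hb y.1 y.2⟩, 0, y.1.take (b y.2), y.1, hPr _ _,
      congrArg y.1.take (y.1.len_take (b y.2))⟩
  have hq : Continuous fun y => mk B (q y) := by
    refine continuous_mk_of_eventually_eq continuous_fst ?_
    rintro ⟨x, k⟩
    rw [nhds_prod_eq, nhds_discrete ℤ, Filter.prod_pure, Filter.eventually_map]
    filter_upwards [x.eventually_take (b k)] with x' hx'
    refine ⟨?_, rfl, hx'⟩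
    change P _ _ = P _ _
    simp only [hx']
  refine ⟨⟨⟨fun y => (mk B (q y), 0), hq.prodMk continuous_const, ?_⟩, fun _ => rfl⟩⟩
  rintro ⟨x, k⟩
  refine Prod.ext rfl ?_
  change 0 + (((P (b k + k).toNat _).len : ℤ) - (x.take (b k)).len) = k
  rw [hPl, InfPath.len_take]
  simp only [b]
  omega

end Transversal

section Shift

variable {V : Type*} {A B : Matrix V V ℤ} (hA : RowFinite A) (hp : PseudoFree A B)
  {α α' : FinPath A}

theorem rho_eq_one_of_mem_Z (hl : α'.len = α.len + 1) {m : ℤ} {g : KArrow A B}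
    (hg : g ∈ Z B α' m α) : (rho hp).toFun g = 1 :=
  (lag_eq_of_mem_Z hg).trans (by rw [hl, Nat.cast_succ, add_sub_cancel_left])

theorem tilde₀_pathClass (h : Function.Bijective (incl (rho hp)).mapH₀)
    (hr : α'.r = α.r) (hl : α'.len = α.len + 1) :
    tilde₀ (rho hp) h 1 (pathClass hA hp α) = pathClass hA hp α' :=
  tilde₀_cls₀_ind h (isBisection_Z hA hp hr 0) (fun _ => rho_eq_one_of_mem_Z hp hl)
    (src_image_Z hr 0) (rng_image_Z hr 0) _ _ _ _

theorem tilde₁_loopClass (h : Function.Bijective (incl (rho hp)).mapH₁)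
    (hr : α'.r = α.r) (hl : α'.len = α.len + 1) :
    tilde₁ (rho hp) h 1 (loopClass hA hp α) = loopClass hA hp α' := by
  have := (katsura hp).t2_arrows
  have h_loop : ∀ {β : FinPath A} {g : KArrow A B}, g ∈ Z B β 1 β → (rho hp).toFun g = 0 :=
    fun hg => (lag_eq_of_mem_Z hg).trans (sub_self _)
  exact tilde₁_cls₁_ind h (isBisection_Z hA hp hr 0) (isBisection_Z hA hp rfl 1)
    (isBisection_Z hA hp rfl 1) (fun _ => rho_eq_one_of_mem_Z hp hl) (fun _ => h_loop)
    (fun _ => h_loop) ((src_image_Z hr 0).trans (rng_image_Z rfl 1).symm)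
    ((src_image_Z rfl 1).trans (rng_image_Z hr 0).symm)
    (d1_image_pairs_Z hp rfl 0 1) (d1_image_pairs_Z hp hr 1 0)
    (isCompact_Z hA hr 1) (isOpen_Z hr 1) _ _

end Shift

section Isomorphisms

variable {V : Type*} {A B : Matrix V V ℤ} (hA : RowFinite A) (hrow : ∀ i, ∃ j, A i j ≠ 0)
  (hnn : ∀ i j, 0 ≤ A i j) (hcol : Finite V ∨ ∀ j, ∃ i, A i j ≠ 0) (hp : PseudoFree A B)

include hrow hnn hcol

theorem exists_isPhiA : ∃ Φ : (ℋ hp).H₀ ≃+ IndLim hA, IsPhiA hA hp Φ := by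
  let φ : (ℋ hp).H₀ →+ IndLim hA := QuotientAddGroup.lift _
    (pathIntegral hA hrow hnn).toAddMonoidHom
    ((AddMonoidHom.range_le_ker_iff _ _).2 (pathIntegral_comp_δ₁ hA hrow hnn hp))
  have hφ : ∀ α, φ (pathClass hA hp α) = toLim hA α.len (Finsupp.single α.r 1) :=
    pathIntegral_cellInd hA hrow hnn
  have h_inj : Function.Injective φ := by
    rw [injective_iff_map_eq_zero]
    rintro ⟨f⟩ hf
    exact (QuotientAddGroup.eq_zero_iff f).2
      (mem_range_δ₁_of_pathIntegral_eq_zero hA hrow hnn hp hf)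
  have h_surj : Function.Surjective φ :=
    surjective_of_toLim_mem_range hrow hnn hcol hA (fun _ _ h => h) fun α => ⟨_, hφ α⟩
  exact ⟨AddEquiv.ofBijective φ ⟨h_inj, h_surj⟩, hφ⟩

theorem exists_isPhiB (hB : RowFinite B) (hAB : ∀ i j, A i j = 0 → B i j = 0) :
    ∃ Φ : (ℋ hp).H₁ ≃+ IndLim hB, IsPhiB hA hB hp Φ := by
  let φ : (ℋ hp).H₁ →+ IndLim hB := QuotientAddGroup.lift _
    ((arrowIntegral hA hrow hnn hp hB hAB).toAddMonoidHom.comp (ℋ hp).δ₁.ker.subtype) (by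
      rintro ⟨_, _⟩ ⟨f, rfl⟩
      exact DFunLike.congr_fun (arrowIntegral_comp_δ₂ hA hrow hnn hp hB hAB) f)
  have hφ : ∀ α, φ (loopClass hA hp α) = toLim hB α.len (Finsupp.single α.r 1) := fun α =>
    (arrowIntegral_cellInd hA hrow hnn hp hB hAB ⟨α, 1, α, rfl, rfl⟩).trans (one_smul ℤ _)
  have h_inj : Function.Injective φ := by
    rw [injective_iff_map_eq_zero]
    rintro ⟨f⟩ hf
    exact (QuotientAddGroup.eq_zero_iff f).2
      (mem_range_δ₂_of_arrowIntegral_eq_zero hA hrow hnn hp hB hAB hf f.2)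
  have h_surj : Function.Surjective φ :=
    surjective_of_toLim_mem_range hrow hnn hcol hB hAB fun α => ⟨_, hφ α⟩
  exact ⟨AddEquiv.ofBijective φ ⟨h_inj, h_surj⟩, hφ⟩

end Isomorphisms

end KEP

end

theorem mainTheorem5_general {V : Type*} (A B : Matrix V V ℤ)
    (hA : KEP.RowFinite A) (hB : KEP.RowFinite B)
    (hA_nonneg : ∀ i j, 0 ≤ A i j)
    (hA_row : ∀ i, ∃ j, A i j ≠ 0)
    (hAB : ∀ i j, A i j = 0 → B i j = 0)
    (hA_col : Finite V ∨ ∀ j, ∃ i, A i j ≠ 0)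
    (hp : KEP.PseudoFree A B) :
    ∃ (h₀ : Function.Bijective (KEP.incl (KEP.rho hp)).mapH₀)
      (h₁ : Function.Bijective (KEP.incl (KEP.rho hp)).mapH₁),
      ((∃ ΦA : (KEP.ℋ hp).H₀ ≃+ KEP.IndLim hA, KEP.IsPhiA hA hp ΦA) ∧
        ∀ ΦA : (KEP.ℋ hp).H₀ ≃+ KEP.IndLim hA, KEP.IsPhiA hA hp ΦA →
          ∀ (i : ℕ) (x : V →₀ ℤ),
            ΦA (KEP.tilde₀ (KEP.rho hp) h₀ 1 (ΦA.symm (KEP.toLim hA i x)))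
              = KEP.toLim hA (i + 1) x) ∧
      ((∃ ΦB : (KEP.ℋ hp).H₁ ≃+ KEP.IndLim hB, KEP.IsPhiB hA hB hp ΦB) ∧
        ∀ ΦB : (KEP.ℋ hp).H₁ ≃+ KEP.IndLim hB, KEP.IsPhiB hA hB hp ΦB →
          ∀ (i : ℕ) (x : V →₀ ℤ),
            ΦB (KEP.tilde₁ (KEP.rho hp) h₁ 1 (ΦB.symm (KEP.toLim hB i x)))
              = KEP.toLim hB (i + 1) x) := by
  obtain ⟨θ⟩ := KEP.nonempty_transversal hA_row hA_nonneg hA_col hp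
  refine ⟨θ.bijective_mapH₀, θ.bijective_mapH₁,
    ⟨KEP.exists_isPhiA hA hA_row hA_nonneg hA_col hp, fun ΦA hΦ => ?_⟩,
    ⟨KEP.exists_isPhiB hA hA_row hA_nonneg hA_col hp hB hAB, fun ΦB hΦ => ?_⟩⟩
  · exact KEP.apply_symm_toLim_eq_toLim_succ hA_row hA_nonneg hA_col hA (fun _ _ h => h) ΦA _
      (KEP.pathClass hA hp) hΦ fun _ _ => KEP.tilde₀_pathClass hA hp θ.bijective_mapH₀
  · exact KEP.apply_symm_toLim_eq_toLim_succ hA_row hA_nonneg hA_col hB hAB ΦB _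
      (KEP.loopClass hA hp) hΦ fun _ _ => KEP.tilde₁_loopClass hA hp θ.bijective_mapH₁

theorem mainTheorem5 {V : Type*} [Countable V] (A B : Matrix V V ℤ)
    (hA : KEP.RowFinite A) (hB : KEP.RowFinite B)
    (hA_nonneg : ∀ i j, 0 ≤ A i j)
    (hA_row : ∀ i, ∃ j, A i j ≠ 0)
    (hAB : ∀ i j, A i j = 0 → B i j = 0)
    (hA_col : Finite V ∨ ∀ j, ∃ i, A i j ≠ 0)
    (hp : KEP.PseudoFree A B) :
    ∃ (h₀ : Function.Bijective (KEP.incl (KEP.rho hp)).mapH₀)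
      (h₁ : Function.Bijective (KEP.incl (KEP.rho hp)).mapH₁),
      ((∃ ΦA : (KEP.ℋ hp).H₀ ≃+ KEP.IndLim hA, KEP.IsPhiA hA hp ΦA) ∧
        ∀ ΦA : (KEP.ℋ hp).H₀ ≃+ KEP.IndLim hA, KEP.IsPhiA hA hp ΦA →
          ∀ (i : ℕ) (x : V →₀ ℤ),
            ΦA (KEP.tilde₀ (KEP.rho hp) h₀ 1 (ΦA.symm (KEP.toLim hA i x)))
              = KEP.toLim hA (i + 1) x) ∧
      ((∃ ΦB : (KEP.ℋ hp).H₁ ≃+ KEP.IndLim hB, KEP.IsPhiB hA hB hp ΦB) ∧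
        ∀ ΦB : (KEP.ℋ hp).H₁ ≃+ KEP.IndLim hB, KEP.IsPhiB hA hB hp ΦB →
          ∀ (i : ℕ) (x : V →₀ ℤ),
            ΦB (KEP.tilde₁ (KEP.rho hp) h₁ 1 (ΦB.symm (KEP.toLim hB i x)))
              = KEP.toLim hB (i + 1) x) :=
  mainTheorem5_general A B hA hB hA_nonneg hA_row hAB hA_col hp
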